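/- Let $\mathbf F$ be a field of characteristic $0$ and let $C$ be a finitely semi-simple, non-degenerate, $\mathrm{Vect}$-linear semi-strict spherical 2-category over $\mathbf F$ in the sense of Mackaay. That is: $C$ is a strict 2-category with a semi-strict monoidal structure (tensor product strictly associative and unital with identity object $I$, all structural 2-isomorphisms being identities except the tensorators $\otimes_{f,g}\colon (f\otimes B)(A'\otimes g)\Rightarrow(A\otimes g)(f\otimes B')$ for $f\colon A\to A'$, $g\colon B\to B'$), with duals in the sense of Baez and Langford (duals $X^*$ of objects, 1- and 2-morphisms, units $i_X$ and counits $e_X$ of objects and 1-morphisms, unitary triangulators), with a consistent pivotal structure and a spherical structure. Each $\mathrm{Hom}(A,B)$ is a 2-vector space of finite rank over $\mathbf F$, composition and tensor product are $\mathrm{Vect}$-bilinear, $\mathrm{End}(I)\simeq\mathrm{Vect}$, and $\mathrm{2End}(1_I)=\mathbf F$. The pairing $\langle\alpha,\beta\rangle=\cap^R_f\cdot\mathrm{Tr}_R((\alpha\cdot\beta)\circ 1_{f^*})\cdot\cup^R_f\in \mathrm{2End}(1_I)=\mathbf F$ for $\alpha\in\mathrm{2Hom}(f,g)$, $\beta\in\mathrm{2Hom}(g,f)$,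 where $\cap^R_f$ and $\cup^R_f$ are the unit of $i_A(f\otimes A^*)$ (with $A$ the source of $f$) and its dual and $\mathrm{Tr}_R$ is the right trace functor, is non-degenerate. Finite semi-simplicity means that there is a finite set $\mathcal E$ of pairwise non-equivalent non-zero objects such that composition gives equivalences $\bigoplus_{X\in\mathcal E}\mathrm{Hom}(A,X)\otimes\mathrm{Hom}(X,B)\simeq\mathrm{Hom}(A,B)$ for all $A,B$. Fix such an $\mathcal E$ and, for all $A,B$, a finite basis $\mathcal F_{A,B}$ of simple 1-morphisms of $\mathrm{Hom}(A,B)$. Composites are written in diagrammatic order throughout. Put $\dim_q(A)=\langle 1_{1_A},1_{1_A}\rangle$ for an object $A$ and $\dim_q(f)=\langle 1_f,1_f\rangle$ for a 1-morphism $f$. Call an object $A$ simple if $\mathrm{End}(A)$ has rank $1$, and let $K$ be the number of equivalence classes of non-zero simple objects of $C$. Labels: every pair $i<j$ in $\{0,\dots,5\}$ (edge) gets $e_{ij}\in\mathcal E$ and every triple $i<j<k$ (face) gets $f_{ijk}\in\mathcal F_{e_{ik},\,e_{jk}\otimes e_{ij}}$. Put $f_{(ijk)l}=f_{ikl}(e_{kl}\otimes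 f_{ijk})$, $f_{i(jkl)}=f_{ijl}(f_{jkl}\otimes e_{ij})$ and $2H(ijkl)=\mathrm{2Hom}(f_{(ijk)l},f_{i(jkl)})$; write $2H(ijkl)^{\vee}=\mathrm{2Hom}(f_{i(jkl)},f_{(ijk)l})$, which is identified with the dual space of $2H(ijkl)$ by the pairing. For $i<j<k<l<m$ the linear map $Z(+(ijklm))\colon 2H(iklm)\otimes 2H(ijkm)\to 2H(jklm)\otimes 2H(ijlm)\otimes 2H(ijkl)$ is the one determined by $\langle Z(+(ijklm))(\beta\otimes\delta),\alpha\otimes\gamma\otimes\epsilon\rangle=\langle\beta\delta,\alpha\gamma\epsilon\rangle$ for all $\beta\in 2H(iklm)$, $\delta\in 2H(ijkm)$, $\alpha\in 2H(jklm)^\vee$, $\gamma\in 2H(ijlm)^\vee$, $\epsilon\in 2H(ijkl)^\vee$, where the left-hand side is the tensor product of the pairings and $$\beta\delta=(\beta\circ(e_{lm}\otimes e_{kl}\otimes f_{ijk}))\cdot(f_{ikm}\circ\otimes_{f_{klm},f_{ijk}})\cdot(\delta\circ(f_{klm}\otimes e_{jk}\otimes e_{ij})),$$ $$\alpha\gamma\epsilon=(f_{ijm}\circ(\alpha\otimes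 e_{ij}))\cdot(\gamma\circ(e_{lm}\otimes f_{jkl}\otimes e_{ij}))\cdot(f_{ilm}\circ(e_{lm}\otimes\epsilon)).$$ The linear map $Z(-(ijklm))\colon 2H(jklm)\otimes 2H(ijlm)\otimes 2H(ijkl)\to 2H(iklm)\otimes 2H(ijkm)$ is the one determined by $\langle Z(-(ijklm))(\alpha\otimes\gamma\otimes\epsilon),\beta\otimes\delta\rangle=\langle\delta\beta,\epsilon\gamma\alpha\rangle$ for all $\alpha\in 2H(jklm)$, $\gamma\in 2H(ijlm)$, $\epsilon\in 2H(ijkl)$, $\beta\in 2H(iklm)^\vee$, $\delta\in 2H(ijkm)^\vee$, where $$\delta\beta=(\delta\circ(f_{klm}\otimes e_{jk}\otimes e_{ij}))\cdot(f_{ikm}\circ\otimes^{-1}_{f_{klm},f_{ijk}})\cdot(\beta\circ(e_{lm}\otimes e_{kl}\otimes f_{ijk})),$$ $$\epsilon\gamma\alpha=(f_{ilm}\circ(e_{lm}\otimes\epsilon))\cdot(\gamma\circ(e_{lm}\otimes f_{jkl}\otimes e_{ij}))\cdot(f_{ijm}\circ(\alpha\otimes e_{ij})).$$ **Lemma 5.4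 ($1\rightleftharpoons 5$).** Fix arbitrary labels of the edges and faces of the 5-simplex $(012345)$ that do not contain the vertex $4$. Then $$Z(+(01235))=K^{-1}\sum \mathrm{tr}_1\big[(Z(+(02345))\otimes 1)(1\otimes 1\otimes P)(1\otimes Z(+(01245))\otimes 1)(1\otimes 1\otimes 1\otimes P)(1\otimes 1\otimes 1\otimes Z(+(01234)))$$ $$(1\otimes 1\otimes P\otimes 1\otimes 1)(Z(-(12345))\otimes 1\otimes 1\otimes 1)(P\otimes 1\otimes 1\otimes 1)(1\otimes Z(-(01345))\otimes 1)(P\otimes 1\otimes 1)\big]$$ $$\cdot\prod_{\substack{i<j\\ i=4\text{ or }j=4}}\dim_q(e_{ij})^{-1}\prod_{\substack{i<j<k\\ j=4\text{ or }k=4}}\dim_q(f_{ijk}),$$ where the sum runs over all labels $e_{04},e_{14},e_{24},e_{34},e_{45}\in\mathcal E$ and $f_{014},f_{024},f_{034},f_{045},f_{124},f_{134},f_{145},f_{234},f_{245},f_{345}$ (in the corresponding bases) of the edges and faces that contain the vertex $4$, $P$ is the flip of two adjacent tensor factors, the composite in brackets is a linear map $2H(0345)\otimes 2H(0235)\otimes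 2H(0125)\to 2H(0345)\otimes 2H(1235)\otimes 2H(0135)\otimes 2H(0123)$, and $\mathrm{tr}_1$ is its partial trace over the first factor $2H(0345)$. -/

import Mathlib

open CategoryTheory Bicategory
open scoped TensorProduct

universe w v u

noncomputable section

namespace Spherical

/-! ### Strict composition helpers -/

section Strict

variable {C : Type u} [Bicategory.{w, v} C] [Bicategory.Strict C]

/-- Composition (in diagrammatic order) of 1-morphisms whose middle objects are provably equal. -/
abbrev hcomp₁ {A B B' D : C} (f : A ⟶ B) (g : B' ⟶ D)
    (h : B = B' := by simp [mul_assoc]) : A ⟶ D :=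
  f ≫ eqToHom h ≫ g

infixr:80 " ≫ₛ " => hcomp₁

/-- Vertical composition (in diagrammatic order) of 2-morphisms whose middle 1-morphisms are provably
equal. -/
def vcomp {A B : C} {f g g' h : A ⟶ B} (α : f ⟶ g) (β : g' ⟶ h)
    (e : g = g' := by simp [-eqToHom_naturality, -eqToHom_naturality_assoc]) : f ⟶ h :=
  α ≫ eqToHom e ≫ β

infixr:60 " ⬝ " => vcomp

/-- Horizontal composition of 2-morphisms. -/
def hcomp₂ {A B D : C} {f f' : A ⟶ B} {g g' : B ⟶ D} (α : f ⟶ f') (β : g ⟶ g') :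
    f ≫ g ⟶ f' ≫ g' :=
  α ▷ g ≫ f' ◁ β

/-- `X ∘ α ∘ Y`. -/
def whisk {P Q Q' R R' S : C} (X : P ⟶ Q) {f g : Q' ⟶ R} (α : f ⟶ g) (Y : R' ⟶ S)
    (hQ : Q = Q' := by simp [mul_assoc]) (hR : R = R' := by simp [mul_assoc]) :
    hcomp₁ X (hcomp₁ f Y hR) hQ ⟶ hcomp₁ X (hcomp₁ g Y hR) hQ :=
  X ◁ (eqToHom hQ ◁ (α ▷ (eqToHom hR ≫ Y)))

attribute [simp] hcomp₁

end Strict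

/-- The operations of a semi-strict monoidal structure: `A ⊗ B` is `A * B`, the identity object `I` is
`1`, and `A ⊳ f`, `f ⊲ A`, `A ⊳₂ α`, `α ⊲₂ A` are the tensor products of an object with 1- and
2-morphisms. The `Monoid` laws are the strict associativity and unitality on objects. -/
class TensorData (C : Type u) [Bicategory.{w, v} C] extends Monoid C where
  lT (A : C) {X Y : C} (f : X ⟶ Y) : A * X ⟶ A * Y
  rT {X Y : C} (f : X ⟶ Y) (A : C) : X * A ⟶ Y * A
  lT₂ (A : C) {X Y : C} {f g : X ⟶ Y} (α : f ⟶ g) : lT A f ⟶ lT A g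
  rT₂ {X Y : C} {f g : X ⟶ Y} (α : f ⟶ g) (A : C) : rT f A ⟶ rT g A

infixr:85 " ⊳ " => TensorData.lT
infixl:86 " ⊲ " => TensorData.rT
infixr:85 " ⊳₂ " => TensorData.lT₂
infixl:86 " ⊲₂ " => TensorData.rT₂

/-- A semi-strict monoidal structure on a strict 2-category: tensoring with an object on either side is a
strict 2-functor, associativity and unit laws hold strictly, and there is a natural tensorator
`ten f g = ⊗_{f,g} : (f ⊗ B)(A' ⊗ g) ⇒ (A ⊗ g)(f ⊗ B')` compatible with composition and tensor
product. Equations between 2-morphisms (or 1-morphisms) whose sources and targets are only provably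
equal are written with `≍`. -/
class SemiStrictMonoidal (C : Type u) [Bicategory.{w, v} C] [Bicategory.Strict C]
    extends TensorData C where
  lT_id (A X : C) : A ⊳ 𝟙 X = 𝟙 (A * X)
  lT_comp (A : C) {X Y Z : C} (f : X ⟶ Y) (g : Y ⟶ Z) : A ⊳ (f ≫ g) = (A ⊳ f) ≫ (A ⊳ g)
  rT_id (X A : C) : 𝟙 X ⊲ A = 𝟙 (X * A)
  rT_comp {X Y Z : C} (f : X ⟶ Y) (g : Y ⟶ Z) (A : C) : (f ≫ g) ⊲ A = (f ⊲ A) ≫ (g ⊲ A)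
  lT₂_id (A : C) {X Y : C} (f : X ⟶ Y) : A ⊳₂ 𝟙 f = 𝟙 (A ⊳ f)
  lT₂_comp (A : C) {X Y : C} {f g h : X ⟶ Y} (α : f ⟶ g) (β : g ⟶ h) :
    A ⊳₂ (α ≫ β) = (A ⊳₂ α) ≫ (A ⊳₂ β)
  rT₂_id {X Y : C} (f : X ⟶ Y) (A : C) : 𝟙 f ⊲₂ A = 𝟙 (f ⊲ A)
  rT₂_comp {X Y : C} {f g h : X ⟶ Y} (α : f ⟶ g) (β : g ⟶ h) (A : C) :
    (α ≫ β) ⊲₂ A = (α ⊲₂ A) ≫ (β ⊲₂ A)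
  lT₂_hcomp (A : C) {X Y Z : C} {f f' : X ⟶ Y} {g g' : Y ⟶ Z} (α : f ⟶ f') (β : g ⟶ g') :
    A ⊳₂ hcomp₂ α β ≍ hcomp₂ (A ⊳₂ α) (A ⊳₂ β)
  rT₂_hcomp {X Y Z : C} {f f' : X ⟶ Y} {g g' : Y ⟶ Z} (α : f ⟶ f') (β : g ⟶ g') (A : C) :
    hcomp₂ α β ⊲₂ A ≍ hcomp₂ (α ⊲₂ A) (β ⊲₂ A)
  one_lT {X Y : C} (f : X ⟶ Y) : (1 : C) ⊳ f ≍ f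
  rT_one {X Y : C} (f : X ⟶ Y) : f ⊲ (1 : C) ≍ f
  one_lT₂ {X Y : C} {f g : X ⟶ Y} (α : f ⟶ g) : (1 : C) ⊳₂ α ≍ α
  rT₂_one {X Y : C} {f g : X ⟶ Y} (α : f ⟶ g) : α ⊲₂ (1 : C) ≍ α
  mul_lT (A B : C) {X Y : C} (f : X ⟶ Y) : (A * B) ⊳ f ≍ A ⊳ (B ⊳ f)
  rT_mul {X Y : C} (f : X ⟶ Y) (A B : C) : f ⊲ (A * B) ≍ (f ⊲ A) ⊲ B
  lT_rT (A : C) {X Y : C} (f : X ⟶ Y) (B : C) : (A ⊳ f) ⊲ B ≍ A ⊳ (f ⊲ B)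
  mul_lT₂ (A B : C) {X Y : C} {f g : X ⟶ Y} (α : f ⟶ g) : (A * B) ⊳₂ α ≍ A ⊳₂ (B ⊳₂ α)
  rT₂_mul {X Y : C} {f g : X ⟶ Y} (α : f ⟶ g) (A B : C) : α ⊲₂ (A * B) ≍ (α ⊲₂ A) ⊲₂ B
  lT₂_rT₂ (A : C) {X Y : C} {f g : X ⟶ Y} (α : f ⟶ g) (B : C) :
    (A ⊳₂ α) ⊲₂ B ≍ A ⊳₂ (α ⊲₂ B)
  ten {A A' B B' : C} (f : A ⟶ A') (g : B ⟶ B') : (f ⊲ B) ≫ (A' ⊳ g) ≅ (A ⊳ g) ≫ (f ⊲ B')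
  ten_natural {A A' B B' : C} {f f' : A ⟶ A'} {g g' : B ⟶ B'} (α : f ⟶ f') (β : g ⟶ g') :
    hcomp₂ (α ⊲₂ B) (A' ⊳₂ β) ≫ (ten f' g').hom = (ten f g).hom ≫ hcomp₂ (A ⊳₂ β) (α ⊲₂ B')
  ten_id_left (A : C) {B B' : C} (g : B ⟶ B') : (ten (𝟙 A) g).hom ≍ 𝟙 (A ⊳ g)
  ten_id_right {A A' : C} (f : A ⟶ A') (B : C) : (ten f (𝟙 B)).hom ≍ 𝟙 (f ⊲ B)
  ten_comp_left {A A' A'' B B' : C} (f : A ⟶ A') (f' : A' ⟶ A'') (g : B ⟶ B') :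
    (ten (f ≫ f') g).hom ≍
      ((f ⊲ B) ◁ (ten f' g).hom) ⬝ ((ten f g).hom ▷ (f' ⊲ B'))
  ten_comp_right {A A' B B' B'' : C} (f : A ⟶ A') (g : B ⟶ B') (g' : B' ⟶ B'') :
    (ten f (g ≫ g')).hom ≍
      ((ten f g).hom ▷ (A' ⊳ g')) ⬝ ((A ⊳ g) ◁ (ten f g').hom)
  ten_lT (A : C) {X X' Y Y' : C} (f : X ⟶ X') (g : Y ⟶ Y') :
    (ten (A ⊳ f) g).hom ≍ A ⊳₂ (ten f g).hom
  ten_rT_lT {X X' Y Y' : C} (f : X ⟶ X') (B : C) (g : Y ⟶ Y') :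
    (ten (f ⊲ B) g).hom ≍ (ten f (B ⊳ g)).hom
  ten_rT {X X' Y Y' : C} (f : X ⟶ X') (g : Y ⟶ Y') (A : C) :
    (ten f (g ⊲ A)).hom ≍ (ten f g).hom ⊲₂ A

open SemiStrictMonoidal

section
variable {C : Type u} [Bicategory.{w, v} C] [Bicategory.Strict C] [SemiStrictMonoidal C]

attribute [simp] SemiStrictMonoidal.lT_id SemiStrictMonoidal.lT_comp
  SemiStrictMonoidal.rT_id SemiStrictMonoidal.rT_comp

@[simp] lemma lT_eqToHom (A : C) {X Y : C} (h : X = Y) :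
    A ⊳ eqToHom h = eqToHom (congrArg (A * ·) h) := by
  subst h; simp

@[simp] lemma eqToHom_rT {X Y : C} (h : X = Y) (A : C) :
    eqToHom h ⊲ A = eqToHom (congrArg (· * A) h) := by
  subst h; simp

@[simp] lemma one_lT' {X Y : C} (f : X ⟶ Y) :
    (1 : C) ⊳ f = eqToHom (one_mul X) ≫ f ≫ eqToHom (one_mul Y).symm :=
  (conj_eqToHom_iff_heq' _ _ _ _).2 (one_lT f)

@[simp] lemma rT_one' {X Y : C} (f : X ⟶ Y) :
    f ⊲ (1 : C) = eqToHom (mul_one X) ≫ f ≫ eqToHom (mul_one Y).symm :=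
  (conj_eqToHom_iff_heq' _ _ _ _).2 (rT_one f)

@[simp] lemma mul_lT' (A B : C) {X Y : C} (f : X ⟶ Y) :
    (A * B) ⊳ f = eqToHom (mul_assoc A B X) ≫ (A ⊳ (B ⊳ f)) ≫ eqToHom (mul_assoc A B Y).symm :=
  (conj_eqToHom_iff_heq' _ _ _ _).2 (mul_lT A B f)

@[simp] lemma rT_mul' {X Y : C} (f : X ⟶ Y) (A B : C) :
    f ⊲ (A * B) = eqToHom (mul_assoc X A B).symm ≫ ((f ⊲ A) ⊲ B) ≫ eqToHom (mul_assoc Y A B) :=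
  (conj_eqToHom_iff_heq' _ _ _ _).2 (rT_mul f A B)

@[simp] lemma lT_rT' (A : C) {X Y : C} (f : X ⟶ Y) (B : C) :
    (A ⊳ f) ⊲ B = eqToHom (mul_assoc A X B) ≫ (A ⊳ (f ⊲ B)) ≫ eqToHom (mul_assoc A Y B).symm :=
  (conj_eqToHom_iff_heq' _ _ _ _).2 (lT_rT A f B)

end

/-- The duality operations, with those conditions that are equations between objects or 1-morphisms:
duals of objects, 1-morphisms, 2-morphisms, unit `iota f = i_f` and counit `eps f = e_f` of a
1-morphism, unit `coev A = i_A`, counit `ev A = e_A` and triangulator `tri A = T_A` of an object. -/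
class DualStructure (C : Type u) [Bicategory.{w, v} C] [Bicategory.Strict C]
    [SemiStrictMonoidal C] where
  dual₀ : C → C
  dual₁ {A B : C} (f : A ⟶ B) : B ⟶ A
  dual₂ {A B : C} {f g : A ⟶ B} (α : f ⟶ g) : g ⟶ f
  iota {A B : C} (f : A ⟶ B) : 𝟙 A ⟶ f ≫ dual₁ f
  eps {A B : C} (f : A ⟶ B) : dual₁ f ≫ f ⟶ 𝟙 B
  coev (A : C) : 1 ⟶ A * dual₀ A
  ev (A : C) : dual₀ A * A ⟶ 1
  tri (A : C) : 𝟙 A ≫ₛ (coev A ⊲ A) ≫ₛ (A ⊳ ev A) ≫ₛ 𝟙 A ⟶ 𝟙 A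
  dual₀_dual₀ (A : C) : dual₀ (dual₀ A) = A
  dual₁_dual₁ {A B : C} (f : A ⟶ B) : dual₁ (dual₁ f) = f
  dual₁_id (A : C) : dual₁ (𝟙 A) = 𝟙 A
  dual₁_comp {A B D : C} (f : A ⟶ B) (g : B ⟶ D) : dual₁ (f ≫ g) = dual₁ g ≫ dual₁ f
  dual₁_lT (A : C) {X Y : C} (f : X ⟶ Y) : dual₁ (A ⊳ f) = A ⊳ dual₁ f
  dual₁_rT {X Y : C} (f : X ⟶ Y) (A : C) : dual₁ (f ⊲ A) = dual₁ f ⊲ A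
  dual₀_mul (A B : C) : dual₀ (A * B) = dual₀ B * dual₀ A
  coev_dual₀ (A : C) : coev (dual₀ A) ≍ dual₁ (ev A)
  ev_dual₀ (A : C) : ev (dual₀ A) ≍ dual₁ (coev A)
  coev_mul (A B : C) : coev (A * B) ≍ coev A ≫ₛ ((A ⊳ coev B) ⊲ dual₀ A)
  ev_mul (A B : C) : ev (A * B) ≍ ((dual₀ B ⊳ ev A) ⊲ B) ≫ₛ ev B
  coev_one : coev 1 ≍ 𝟙 (1 : C)
  ev_one : ev 1 ≍ 𝟙 (1 : C)

open DualStructure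

postfix:max "ᵛ" => DualStructure.dual₀
postfix:max "ᵃ" => DualStructure.dual₁

section
variable {C : Type u} [Bicategory.{w, v} C] [Bicategory.Strict C] [SemiStrictMonoidal C]
  [DualStructure C]

attribute [simp] DualStructure.dual₀_dual₀ DualStructure.dual₁_dual₁ DualStructure.dual₁_id
  DualStructure.dual₁_comp DualStructure.dual₁_lT DualStructure.dual₁_rT

@[simp] lemma dual₁_eqToHom {X Y : C} (h : X = Y) : (eqToHom h)ᵃ = eqToHom h.symm := by
  subst h; simp

/-- `α† = (g* ∘ i_f) · (g* ∘ α ∘ f*) · (e_g ∘ f*)`. -/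
def dagger {A B : C} {f g : A ⟶ B} (α : f ⟶ g) : gᵃ ⟶ fᵃ :=
  𝟙 gᵃ ⬝ (gᵃ ◁ iota f) ⬝ (gᵃ ◁ (α ▷ fᵃ)) ⬝ (eps g ▷ fᵃ) ⬝ 𝟙 fᵃ

/-- `†α = (i_{f*} ∘ g*) · (f* ∘ α ∘ g*) · (f* ∘ e_{g*})`, with `i_{f*} = e_f*` and `e_{g*} = i_g*`. -/
def ldagger {A B : C} {f g : A ⟶ B} (α : f ⟶ g) : gᵃ ⟶ fᵃ :=
  𝟙 gᵃ ⬝ (dual₂ (eps f) ▷ gᵃ) ⬝ (fᵃ ◁ (α ▷ gᵃ)) ⬝ (fᵃ ◁ dual₂ (iota g)) ⬝ 𝟙 fᵃ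

/-- `α` is invertible with inverse `α*`. -/
def IsUnitary {A B : C} {f g : A ⟶ B} (α : f ⟶ g) : Prop :=
  α ≫ dual₂ α = 𝟙 f ∧ dual₂ α ≫ α = 𝟙 g

@[simp] lemma coev_dual₀' (A : C) :
    coev Aᵛ = (ev A)ᵃ ≫ eqToHom (by rw [dual₀_dual₀]) := by
  have := (conj_eqToHom_iff_heq' (coev Aᵛ) (ev A)ᵃ rfl (by rw [dual₀_dual₀])).2 (coev_dual₀ A)
  simpa using this

@[simp] lemma ev_dual₀' (A : C) :
    ev Aᵛ = eqToHom (by rw [dual₀_dual₀]) ≫ (coev A)ᵃ := by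
  have := (conj_eqToHom_iff_heq' (ev Aᵛ) (coev A)ᵃ (by rw [dual₀_dual₀]) rfl).2 (ev_dual₀ A)
  simpa using this

end

/-- The conditions on the duality that are equations between 2-morphisms; with them `C` is a semi-strict
monoidal 2-category with duals. -/
class HasDuals (C : Type u) [Bicategory.{w, v} C] [Bicategory.Strict C]
    [SemiStrictMonoidal C] [DualStructure C] : Prop where
  dual₂_dual₂ {A B : C} {f g : A ⟶ B} (α : f ⟶ g) : dual₂ (dual₂ α) = α
  dual₂_id {A B : C} (f : A ⟶ B) : dual₂ (𝟙 f) = 𝟙 f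
  dual₂_comp {A B : C} {f g h : A ⟶ B} (α : f ⟶ g) (β : g ⟶ h) :
    dual₂ (α ≫ β) = dual₂ β ≫ dual₂ α
  dual₂_hcomp {A B D : C} {f f' : A ⟶ B} {g g' : B ⟶ D} (α : f ⟶ f') (β : g ⟶ g') :
    dual₂ (hcomp₂ α β) = hcomp₂ (dual₂ α) (dual₂ β)
  dual₂_lT (A : C) {X Y : C} {f g : X ⟶ Y} (α : f ⟶ g) : dual₂ (A ⊳₂ α) = A ⊳₂ dual₂ α
  dual₂_rT {X Y : C} {f g : X ⟶ Y} (α : f ⟶ g) (A : C) : dual₂ (α ⊲₂ A) = dual₂ α ⊲₂ A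
  ten_unitary {A A' B B' : C} (f : A ⟶ A') (g : B ⟶ B') : IsUnitary (ten f g).hom
  iota_dual₁ {A B : C} (f : A ⟶ B) : iota fᵃ ≍ dual₂ (eps f)
  eps_dual₁ {A B : C} (f : A ⟶ B) : eps fᵃ ≍ dual₂ (iota f)
  tri_unitary (A : C) : IsUnitary (tri A)
  tri_mul (A B : C) : tri (A * B) ≍
    whisk (𝟙 (A * B) ≫ₛ (coev A ⊲ (A * B))) ((A ⊳₂ (ten (coev B) (ev A)).hom) ⊲₂ B)
        (((A * B) ⊳ ev B) ≫ₛ 𝟙 (A * B))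
      ⬝ hcomp₂ (tri A ⊲₂ B) (A ⊳₂ tri B)
  tri_one : tri (1 : C) ≍ 𝟙 (𝟙 (1 : C))
  iota_lT (A : C) {X Y : C} (f : X ⟶ Y) : iota (A ⊳ f) ≍ A ⊳₂ iota f
  iota_rT {X Y : C} (f : X ⟶ Y) (A : C) : iota (f ⊲ A) ≍ iota f ⊲₂ A
  eps_lT (A : C) {X Y : C} (f : X ⟶ Y) : eps (A ⊳ f) ≍ A ⊳₂ eps f
  eps_rT {X Y : C} (f : X ⟶ Y) (A : C) : eps (f ⊲ A) ≍ eps f ⊲₂ A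
  iota_comp {A B D : C} (f : A ⟶ B) (g : B ⟶ D) :
    iota (f ≫ g) ≍ iota f ⬝ (f ◁ (iota g ▷ fᵃ))
  eps_comp {A B D : C} (f : A ⟶ B) (g : B ⟶ D) :
    eps (f ≫ g) ≍ (gᵃ ◁ (eps f ▷ g)) ⬝ eps g
  zigzag_left {A B : C} (f : A ⟶ B) : (iota f ▷ f) ⬝ (f ◁ eps f) ≍ 𝟙 f
  zigzag_right {A B : C} (f : A ⟶ B) : (fᵃ ◁ iota f) ⬝ (eps f ▷ fᵃ) ≍ 𝟙 fᵃ
  dagger_dual₂ {A B : C} {f g : A ⟶ B} (α : f ⟶ g) : dual₂ (dagger α) = dagger (dual₂ α)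
  swallowtail (A : C) :
    whisk (coev A) (A ⊳₂ dagger (tri Aᵛ)) (𝟙 (A * Aᵛ))
      ⬝ whisk (𝟙 1) (ten (coev A) (coev A)).hom (((A ⊳ ev A) ⊲ Aᵛ) ≫ₛ 𝟙 (A * Aᵛ))
      ⬝ whisk (coev A) (tri A ⊲₂ Aᵛ) (𝟙 (A * Aᵛ)) ≍ 𝟙 (coev A)


section
variable {C : Type u} [Bicategory.{w, v} C] [Bicategory.Strict C] [SemiStrictMonoidal C]
  [DualStructure C]

/-- `i_{A*} ⊗ D`, where `i_{A*} = e_A*`. -/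
abbrev lsharpIn (A D : C) : D ⟶ (Aᵛ * A) * D := 𝟙 D ≫ₛ ((ev A)ᵃ ⊲ D)
/-- `D ⊗ e_{B*}`, where `e_{B*} = i_B*`. -/
abbrev lsharpOut (D B : C) : (D * B) * Bᵛ ⟶ D := 𝟙 ((D * B) * Bᵛ) ≫ₛ (D ⊳ (coev B)ᵃ) ≫ₛ 𝟙 D
/-- `D ⊗ i_A`. -/
abbrev rsharpIn (D A : C) : D ⟶ D * (A * Aᵛ) := 𝟙 D ≫ₛ (D ⊳ coev A)
/-- `e_B ⊗ D`. -/
abbrev rsharpOut (B D : C) : Bᵛ * (B * D) ⟶ D := 𝟙 (Bᵛ * (B * D)) ≫ₛ (ev B ⊲ D) ≫ₛ 𝟙 D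

/-- `#f = (i_{A*} ⊗ B*)(A* ⊗ f ⊗ B*)(A* ⊗ e_{B*})`. -/
abbrev lsharp {A B : C} (f : A ⟶ B) : Bᵛ ⟶ Aᵛ :=
  lsharpIn A Bᵛ ≫ ((Aᵛ ⊳ f) ⊲ Bᵛ) ≫ lsharpOut Aᵛ B

/-- `#α : #f ⇒ #g`. -/
def lsharp₂ {A B : C} {f g : A ⟶ B} (α : f ⟶ g) : lsharp f ⟶ lsharp g :=
  lsharpIn A Bᵛ ◁ (((Aᵛ ⊳₂ α) ⊲₂ Bᵛ) ▷ lsharpOut Aᵛ B)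

/-- `f# = (B* ⊗ i_A)(B* ⊗ f ⊗ A*)(e_B ⊗ A*)`. -/
abbrev rsharp {A B : C} (f : A ⟶ B) : Bᵛ ⟶ Aᵛ :=
  rsharpIn Bᵛ A ≫ (Bᵛ ⊳ (f ⊲ Aᵛ)) ≫ rsharpOut B Aᵛ

/-- `α# : f# ⇒ g#`. -/
def rsharp₂ {A B : C} {f g : A ⟶ B} (α : f ⟶ g) : rsharp f ⟶ rsharp g :=
  rsharpIn Bᵛ A ◁ ((Bᵛ ⊳₂ (α ⊲₂ Aᵛ)) ▷ rsharpOut B Aᵛ)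

attribute [local simp] lsharp rsharp lsharpIn lsharpOut rsharpIn rsharpOut

/-- The 2-isomorphism `#(fg) ⇒ #g #f` built from the triangulator and tensorators. -/
def lsharpComp {A B D : C} (f : A ⟶ B) (g : B ⟶ D) : lsharp (f ≫ g) ⟶ lsharp g ≫ lsharp f :=
  𝟙 _ ⬝ whisk (𝟙 Dᵛ ≫ₛ ((ev A)ᵃ ⊲ Dᵛ) ≫ₛ ((Aᵛ ⊳ f) ⊲ Dᵛ)) ((Aᵛ ⊳₂ dagger (tri B)) ⊲₂ Dᵛ)
        (((Aᵛ ⊳ g) ⊲ Dᵛ) ≫ₛ (Aᵛ ⊳ (coev D)ᵃ) ≫ₛ 𝟙 Aᵛ)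
    ⬝ whisk (𝟙 Dᵛ ≫ₛ ((ev A)ᵃ ⊲ Dᵛ) ≫ₛ ((Aᵛ ⊳ f) ⊲ Dᵛ) ≫ₛ (((Aᵛ * B) ⊳ (ev B)ᵃ) ⊲ Dᵛ))
        ((Aᵛ ⊳₂ (ten (coev B)ᵃ g).hom) ⊲₂ Dᵛ) ((Aᵛ ⊳ (coev D)ᵃ) ≫ₛ 𝟙 Aᵛ)
    ⬝ whisk (𝟙 Dᵛ)
        (ten ((ev A)ᵃ ≫ (Aᵛ ⊳ f)) (𝟙 Dᵛ ≫ₛ ((ev B)ᵃ ⊲ Dᵛ) ≫ₛ ((Bᵛ ⊳ g) ⊲ Dᵛ))).hom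
        (((Aᵛ ⊳ (coev B)ᵃ) ⊲ (D * Dᵛ)) ≫ₛ (Aᵛ ⊳ (coev D)ᵃ) ≫ₛ 𝟙 Aᵛ)
    ⬝ whisk (𝟙 Dᵛ ≫ₛ ((ev B)ᵃ ⊲ Dᵛ) ≫ₛ ((Bᵛ ⊳ g) ⊲ Dᵛ))
        (ten (lsharp f) (coev D)ᵃ).hom (𝟙 Aᵛ) ⬝ 𝟙 _

/-- The 2-isomorphism `(fg)# ⇒ g# f#` built from the triangulator and tensorators. -/
def rsharpComp {A B D : C} (f : A ⟶ B) (g : B ⟶ D) :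
    rsharp (f ≫ g) ⟶ rsharp g ≫ rsharp f :=
  𝟙 _ ⬝ whisk (𝟙 Dᵛ ≫ₛ (Dᵛ ⊳ coev A) ≫ₛ (Dᵛ ⊳ (f ⊲ Aᵛ))) (Dᵛ ⊳₂ (dual₂ (tri B) ⊲₂ Aᵛ))
        ((Dᵛ ⊳ (g ⊲ Aᵛ)) ≫ₛ (ev D ⊲ Aᵛ) ≫ₛ 𝟙 Aᵛ)
    ⬝ whisk (𝟙 Dᵛ ≫ₛ (Dᵛ ⊳ coev A) ≫ₛ (Dᵛ ⊳ (f ⊲ Aᵛ)) ≫ₛ (Dᵛ ⊳ (coev B ⊲ (B * Aᵛ))))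
        (Dᵛ ⊳₂ ((ten g (ev B)).inv ⊲₂ Aᵛ)) ((ev D ⊲ Aᵛ) ≫ₛ 𝟙 Aᵛ)
    ⬝ whisk (𝟙 Dᵛ)
        (Dᵛ ⊳₂ (ten (coev B ≫ (g ⊲ Bᵛ)) (coev A ≫ (f ⊲ Aᵛ))).inv)
        (((Dᵛ * D) ⊳ (ev B ⊲ Aᵛ)) ≫ₛ (ev D ⊲ Aᵛ) ≫ₛ 𝟙 Aᵛ)
    ⬝ whisk (𝟙 Dᵛ ≫ₛ (Dᵛ ⊳ coev B) ≫ₛ (Dᵛ ⊳ (g ⊲ Bᵛ)))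
        (ten (ev D) (rsharp f)).inv (𝟙 Aᵛ) ⬝ 𝟙 _

/-- A pivotal structure: unitary `phi f : #f ⇒ f#`, natural, compatible with duals and composition. -/
class Pivotal (C : Type u) [Bicategory.{w, v} C] [Bicategory.Strict C] [SemiStrictMonoidal C]
    [DualStructure C] where
  phi {A B : C} (f : A ⟶ B) : lsharp f ⟶ rsharp f
  phi_unitary {A B : C} (f : A ⟶ B) : IsUnitary (phi f)
  phi_natural {A B : C} {f g : A ⟶ B} (α : f ⟶ g) : lsharp₂ α ≫ phi g = phi f ≫ rsharp₂ α
  phi_dagger {A B : C} (f : A ⟶ B) : dagger (phi f) ≍ phi fᵃ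
  phi_comp {A B D : C} (f : A ⟶ B) (g : B ⟶ D) :
    phi (f ≫ g) ≫ rsharpComp f g = lsharpComp f g ≫ hcomp₂ (phi g) (phi f)
  lsharp_dagger {A B : C} {f g : A ⟶ B} (α : f ⟶ g) : lsharp₂ (dagger α) ≍ ldagger (rsharp₂ α)
  dagger_lsharp {A B : C} {f g : A ⟶ B} (α : f ⟶ g) : dagger (lsharp₂ α) ≍ rsharp₂ (ldagger α)

open Pivotal

/-- The left trace functor on objects, `Tr_L(f) = i_{A*} (A* ⊗ f) e_A`. -/
abbrev TrL {A : C} (f : A ⟶ A) : (1 : C) ⟶ 1 := (ev A)ᵃ ≫ (Aᵛ ⊳ f) ≫ ev A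
/-- The left trace functor on morphisms. -/
def TrL₂ {A : C} {f g : A ⟶ A} (α : f ⟶ g) : TrL f ⟶ TrL g := (ev A)ᵃ ◁ ((Aᵛ ⊳₂ α) ▷ ev A)
/-- The right trace functor on objects, `Tr_R(f) = i_A (f ⊗ A*) e_{A*}`. -/
abbrev TrR {A : C} (f : A ⟶ A) : (1 : C) ⟶ 1 := coev A ≫ (f ⊲ Aᵛ) ≫ (coev A)ᵃ
/-- The right trace functor on morphisms. -/
def TrR₂ {A : C} {f g : A ⟶ A} (α : f ⟶ g) : TrR f ⟶ TrR g :=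
  coev A ◁ ((α ⊲₂ Aᵛ) ▷ (coev A)ᵃ)

attribute [local simp] TrL TrR

/-- The 2-isomorphism `θ^R_{f,g} : Tr_R(fg) ⇒ Tr_R(gf)`. -/
def thetaR [Pivotal C] {A B : C} (f : A ⟶ B) (g : B ⟶ A) : TrR (f ≫ g) ⟶ TrR (g ≫ f) :=
  𝟙 _ ⬝ whisk (coev A ≫ (f ⊲ Aᵛ)) (dagger (tri B) ⊲₂ Aᵛ) ((g ⊲ Aᵛ) ≫ (coev A)ᵃ)
    ⬝ whisk (coev A ≫ₛ (f ⊲ Aᵛ) ≫ₛ ((B ⊳ (ev B)ᵃ) ⊲ Aᵛ))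
        (ten (coev B)ᵃ ((g ⊲ Aᵛ) ≫ (coev A)ᵃ)).hom (𝟙 1)
    ⬝ whisk (coev A ≫ (f ⊲ Aᵛ)) (B ⊳₂ phi g) (coev B)ᵃ
    ⬝ whisk (𝟙 1) (ten (coev A ≫ (f ⊲ Aᵛ)) (coev B ≫ (g ⊲ Bᵛ))).hom
        (((B ⊳ ev A) ⊲ Bᵛ) ≫ₛ (coev B)ᵃ)
    ⬝ whisk (coev B ≫ₛ (g ⊲ Bᵛ) ≫ₛ (coev A ⊲ (A * Bᵛ))) ((ten f (ev A)).hom ⊲₂ Bᵛ) (coev B)ᵃ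
    ⬝ whisk (coev B ≫ (g ⊲ Bᵛ)) (tri A ⊲₂ Bᵛ) ((f ⊲ Bᵛ) ≫ (coev B)ᵃ) ⬝ 𝟙 _

/-- The 2-isomorphism `θ^L_{f,g} : Tr_L(fg) ⇒ Tr_L(gf)`, the mirror image of `θ^R`. -/
def thetaL [Pivotal C] {A B : C} (f : A ⟶ B) (g : B ⟶ A) : TrL (f ≫ g) ⟶ TrL (g ≫ f) :=
  𝟙 _ ⬝ whisk ((ev A)ᵃ ≫ (Aᵛ ⊳ f)) (Aᵛ ⊳₂ dual₂ (tri B)) ((Aᵛ ⊳ g) ≫ ev A)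
    ⬝ whisk ((ev A)ᵃ ≫ₛ (Aᵛ ⊳ f) ≫ₛ (Aᵛ ⊳ (coev B ⊲ B)))
        (ten ((Aᵛ ⊳ g) ≫ ev A) (ev B)).inv (𝟙 1)
    ⬝ whisk ((ev A)ᵃ ≫ (Aᵛ ⊳ f)) (dual₂ (phi g) ⊲₂ B) (ev B)
    ⬝ whisk (𝟙 1) (ten ((ev B)ᵃ ≫ (Bᵛ ⊳ g)) ((ev A)ᵃ ≫ (Aᵛ ⊳ f))).inv
        ((Bᵛ ⊳ ((coev A)ᵃ ⊲ B)) ≫ₛ ev B)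
    ⬝ whisk ((ev B)ᵃ ≫ₛ (Bᵛ ⊳ g) ≫ₛ ((Bᵛ * A) ⊳ (ev A)ᵃ)) (Bᵛ ⊳₂ (ten (coev A)ᵃ f).inv) (ev B)
    ⬝ whisk ((ev B)ᵃ ≫ (Bᵛ ⊳ g)) (Bᵛ ⊳₂ dual₂ (dagger (tri A))) ((Bᵛ ⊳ f) ≫ ev B) ⬝ 𝟙 _

/-- `∩_f^R : 1_I ⇒ Tr_R(f f*)`. -/
def capR {A B : C} (f : A ⟶ B) : 𝟙 (1 : C) ⟶ TrR (f ≫ fᵃ) :=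
  iota (coev A ≫ (f ⊲ Aᵛ)) ⬝ 𝟙 _
/-- `∪_f^R : Tr_R(f f*) ⇒ 1_I`. -/
def cupR {A B : C} (f : A ⟶ B) : TrR (f ≫ fᵃ) ⟶ 𝟙 (1 : C) :=
  𝟙 _ ⬝ dual₂ (iota (coev A ≫ (f ⊲ Aᵛ)))
/-- `∩_f^L : 1_I ⇒ Tr_L(f f*)`. -/
def capL {A B : C} (f : A ⟶ B) : 𝟙 (1 : C) ⟶ TrL (f ≫ fᵃ) :=
  iota ((ev A)ᵃ ≫ (Aᵛ ⊳ f)) ⬝ 𝟙 _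
/-- `∪_f^L : Tr_L(f f*) ⇒ 1_I`. -/
def cupL {A B : C} (f : A ⟶ B) : TrL (f ≫ fᵃ) ⟶ 𝟙 (1 : C) :=
  𝟙 _ ⬝ dual₂ (iota ((ev A)ᵃ ≫ (Aᵛ ⊳ f)))

/-- Caps and cups are compatible with the conjugation invariance of the traces. -/
class Consistent (C : Type u) [Bicategory.{w, v} C] [Bicategory.Strict C] [SemiStrictMonoidal C]
    [DualStructure C] [Pivotal C] : Prop where
  capR_theta {A B : C} (f : A ⟶ B) : capR f ≫ thetaR f fᵃ = capR fᵃ ⬝ 𝟙 _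
  theta_cupR {A B : C} (f : A ⟶ B) : thetaR f fᵃ ⬝ cupR fᵃ = cupR f
  capL_theta {A B : C} (f : A ⟶ B) : capL f ≫ thetaL f fᵃ = capL fᵃ ⬝ 𝟙 _
  theta_cupL {A B : C} (f : A ⟶ B) : thetaL f fᵃ ⬝ cupL fᵃ = cupL f

/-- A spherical structure: natural unitary `sigma f : Tr_L(f) ⇒ Tr_R(f)` compatible with the caps and
cups of identity 1-morphisms. -/
class IsSpherical (C : Type u) [Bicategory.{w, v} C] [Bicategory.Strict C] [SemiStrictMonoidal C]
    [DualStructure C] where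
  sigma {A : C} (f : A ⟶ A) : TrL f ⟶ TrR f
  sigma_unitary {A : C} (f : A ⟶ A) : IsUnitary (sigma f)
  sigma_natural {A : C} {f g : A ⟶ A} (α : f ⟶ g) : sigma f ≫ TrR₂ α = TrL₂ α ≫ sigma g
  capL_sigma (A : C) : capL (𝟙 A) ⬝ sigma (𝟙 A) = capR (𝟙 A) ⬝ 𝟙 (TrR (𝟙 A))
  sigma_cupR (A : C) : sigma (𝟙 A) ⬝ cupR (𝟙 A) = 𝟙 (TrL (𝟙 A)) ⬝ cupL (𝟙 A)

/-- The pairing `⟨α, β⟩ = ∩_f^R · Tr_R((α · β) ∘ 1_{f*}) · ∪_f^R` with values in `2End(1_I)`. -/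
def pairing₀ {A B : C} {f g : A ⟶ B} (α : f ⟶ g) (β : g ⟶ f) : 𝟙 (1 : C) ⟶ 𝟙 (1 : C) :=
  capR f ≫ TrR₂ ((α ≫ β) ▷ fᵃ) ≫ cupR f


end

/-! ### Linear structure -/

section Linear

open CategoryTheory.Limits

/-- A family `s` of objects of an `F`-linear category is a *basis* if the `s i` are simple with
endomorphism ring `F`, there are no non-zero morphisms between different members, and every
object is a direct sum of finitely many members. -/
def IsBasis (F : Type*) [Field F] {H : Type*} [Category H] [Preadditive H] [Linear F H]
    {ι : Type*} (s : ι → H) : Prop :=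
  (∀ (i : ι) (φ : s i ⟶ s i), ∃! r : F, φ = r • 𝟙 (s i)) ∧
  (∀ i j : ι, i ≠ j → ∀ φ : s i ⟶ s j, φ = 0) ∧
  ∀ X : H, ∃ (n : ℕ) (k : Fin n → ι) (b : Bicone fun a => s (k a)),
    b.pt = X ∧ Nonempty b.IsBilimit

/-- `H` has a basis with `n` elements; for an `F`-linear category with finite direct sums and
finite-dimensional morphism spaces this says that `H` is equivalent to `Vectⁿ`, i.e. that `H` is a
2-vector space of rank `n`. -/
def HasRank (F : Type*) [Field F] (H : Type*) [Category H] [Preadditive H] [Linear F H]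
    (n : ℕ) : Prop :=
  ∃ s : Fin n → H, IsBasis F s

variable (F : Type*) [Field F] (C : Type u) [Bicategory.{w, v} C] [Bicategory.Strict C]
  [SemiStrictMonoidal C] [∀ A B : C, Preadditive (A ⟶ B)] [∀ A B : C, Linear F (A ⟶ B)]

/-- `C` is `Vect`-linear: every `Hom(A, B)` is a 2-vector space of finite rank over `F`, the
composition and the tensor product are bilinear; moreover `End(I)` is equivalent to `Vect` and
`2End(1_I)` is `F`. -/
class VectLinear : Prop where
  hasFiniteBiproducts (A B : C) : HasFiniteBiproducts (A ⟶ B)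
  hasRank (A B : C) : ∃ n : ℕ, HasRank F (A ⟶ B) n
  finite {A B : C} (f g : A ⟶ B) : Module.Finite F (f ⟶ g)
  whiskerLeft_add {A B D : C} (f : A ⟶ B) {g h : B ⟶ D} (α β : g ⟶ h) :
    f ◁ (α + β) = f ◁ α + f ◁ β
  whiskerLeft_smul {A B D : C} (f : A ⟶ B) {g h : B ⟶ D} (r : F) (α : g ⟶ h) :
    f ◁ (r • α) = r • f ◁ α
  whiskerRight_add {A B D : C} {f g : A ⟶ B} (α β : f ⟶ g) (h : B ⟶ D) :
    (α + β) ▷ h = α ▷ h + β ▷ h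
  whiskerRight_smul {A B D : C} {f g : A ⟶ B} (r : F) (α : f ⟶ g) (h : B ⟶ D) :
    (r • α) ▷ h = r • α ▷ h
  lT₂_add (A : C) {X Y : C} {f g : X ⟶ Y} (α β : f ⟶ g) : A ⊳₂ (α + β) = A ⊳₂ α + A ⊳₂ β
  lT₂_smul (A : C) {X Y : C} {f g : X ⟶ Y} (r : F) (α : f ⟶ g) : A ⊳₂ (r • α) = r • (A ⊳₂ α)
  rT₂_add {X Y : C} {f g : X ⟶ Y} (α β : f ⟶ g) (A : C) : (α + β) ⊲₂ A = α ⊲₂ A + β ⊲₂ A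
  rT₂_smul {X Y : C} {f g : X ⟶ Y} (r : F) (α : f ⟶ g) (A : C) : (r • α) ⊲₂ A = r • (α ⊲₂ A)
  end_one : HasRank F ((1 : C) ⟶ 1) 1
  twoEnd_one (z : 𝟙 (1 : C) ⟶ 𝟙 (1 : C)) : ∃! r : F, z = r • 𝟙 (𝟙 (1 : C))

variable {C}

/-- An object is non-zero if `End(A)` is not the zero category. -/
def IsNonzero (A : C) : Prop := ∃ f : A ⟶ A, ¬ IsZero f

/-- An object `A` is simple if `End(A)` has rank one. -/
def IsSimple (A : C) : Prop := HasRank F (A ⟶ A) 1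

variable (C) in
/-- The dimension of `C`: the number of equivalence classes of non-zero simple objects. -/
def dimension : ℕ :=
  Nat.card (Quot fun A B : {A : C // IsNonzero A ∧ IsSimple F A} => Nonempty (A.1 ≌ B.1))

/-- The composition functor `⨁ₓ Hom(A, X) ⊗ Hom(X, B) → Hom(A, B)`, `X` running over the family
`obj`, is an equivalence for all `A`, `B`. Since the tensor product of two 2-vector spaces has as a
basis the pairs of basis elements, this says that the composites of the elements of bases of the
`Hom(A, X)` and of the `Hom(X, B)` form a basis of `Hom(A, B)`. -/
def HorizontallySemisimple {n : ℕ} (obj : Fin n → C) : Prop :=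
  ∀ (A B : C) (a b : Fin n → ℕ)
    (p : ∀ x, Fin (a x) → (A ⟶ obj x)) (q : ∀ x, Fin (b x) → (obj x ⟶ B)),
    (∀ x, IsBasis F (p x)) → (∀ x, IsBasis F (q x)) →
      IsBasis F (fun t : Σ x, Fin (a x) × Fin (b x) => p t.1 t.2.1 ≫ q t.1 t.2.2)

variable (C) in
/-- Finite semi-simplicity, with a fixed choice of the finite set `ℰ` of non-equivalent non-zero
objects and of a basis of every `Hom(A, B)`. -/
structure SimpleBases where
  n : ℕ
  obj : Fin n → C
  obj_nonzero (x : Fin n) : IsNonzero (obj x)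
  obj_inequivalent (x y : Fin n) : x ≠ y → IsEmpty (obj x ≌ obj y)
  semisimple : HorizontallySemisimple F obj
  rk : C → C → ℕ
  mor (A B : C) : Fin (rk A B) → (A ⟶ B)
  isBasis (A B : C) : IsBasis F (mor A B)

/-- Labels of a face `(ijk)` whose edges have the labels `e_{ij}`, `e_{jk}`, `e_{ik}`: the elements of
the chosen basis of `Hom(e_{ik}, e_{jk} ⊗ e_{ij})`. -/
abbrev SimpleBases.Face {F : Type*} [Field F] [∀ A B : C, Linear F (A ⟶ B)]
    (ℬ : SimpleBases F C) (eij ejk eik : Fin ℬ.n) : Type :=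
  Fin (ℬ.rk (ℬ.obj eik) (ℬ.obj ejk * ℬ.obj eij))

/-- The basis 1-morphism `f_{ijk} : e_{ik} ⟶ e_{jk} ⊗ e_{ij}` given by a label of a face. -/
abbrev SimpleBases.face {F : Type*} [Field F] [∀ A B : C, Linear F (A ⟶ B)]
    (ℬ : SimpleBases F C) {eij ejk eik : Fin ℬ.n} (t : ℬ.Face eij ejk eik) :
    ℬ.obj eik ⟶ ℬ.obj ejk * ℬ.obj eij :=
  ℬ.mor (ℬ.obj eik) (ℬ.obj ejk * ℬ.obj eij) t

/-! ### The pairing with values in `F` -/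

section
variable [VectLinear F C]

instance instModuleFinite2Hom {A B : C} (f g : A ⟶ B) : Module.Finite F (f ⟶ g) :=
  VectLinear.finite f g

/-- The scalar in `F` that an element of `2End(1_I)` is. -/
def scalar : (𝟙 (1 : C) ⟶ 𝟙 (1 : C)) →ₗ[F] F where
  toFun z := (VectLinear.twoEnd_one (F := F) z).choose
  map_add' x y := by
    refine ((VectLinear.twoEnd_one (F := F) (x + y)).choose_spec.2 _ ?_).symm
    dsimp only
    rw [add_smul, ← (VectLinear.twoEnd_one (F := F) x).choose_spec.1,
      ← (VectLinear.twoEnd_one (F := F) y).choose_spec.1]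
  map_smul' r x := by
    refine ((VectLinear.twoEnd_one (F := F) (r • x)).choose_spec.2 _ ?_).symm
    dsimp only [RingHom.id_apply, smul_eq_mul]
    rw [mul_smul, ← (VectLinear.twoEnd_one (F := F) x).choose_spec.1]

lemma scalar_spec (z : 𝟙 (1 : C) ⟶ 𝟙 (1 : C)) : z = scalar F z • 𝟙 (𝟙 (1 : C)) :=
  (VectLinear.twoEnd_one (F := F) z).choose_spec.1

section
variable [DualStructure C]

/-- The pairing of 2-morphisms as a bilinear form with values in `F = 2End(1_I)`. -/
def pairing {A B : C} (f g : A ⟶ B) : (f ⟶ g) →ₗ[F] (g ⟶ f) →ₗ[F] F :=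
  (LinearMap.mk₂ F (fun α β => pairing₀ α β)
    (by
      intros
      simp only [pairing₀, TrR₂, Preadditive.add_comp]
      rw [VectLinear.whiskerRight_add (F := F), VectLinear.rT₂_add (F := F),
        VectLinear.whiskerRight_add (F := F), VectLinear.whiskerLeft_add (F := F),
        Preadditive.add_comp, Preadditive.comp_add])
    (by
      intros
      simp only [pairing₀, TrR₂, Linear.smul_comp]
      rw [VectLinear.whiskerRight_smul, VectLinear.rT₂_smul, VectLinear.whiskerRight_smul,
        VectLinear.whiskerLeft_smul, Linear.smul_comp, Linear.comp_smul])
    (by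
      intros
      simp only [pairing₀, TrR₂, Preadditive.comp_add]
      rw [VectLinear.whiskerRight_add (F := F), VectLinear.rT₂_add (F := F),
        VectLinear.whiskerRight_add (F := F), VectLinear.whiskerLeft_add (F := F),
        Preadditive.add_comp, Preadditive.comp_add])
    (by
      intros
      simp only [pairing₀, TrR₂, Linear.comp_smul]
      rw [VectLinear.whiskerRight_smul, VectLinear.rT₂_smul, VectLinear.whiskerRight_smul,
        VectLinear.whiskerLeft_smul, Linear.smul_comp, Linear.comp_smul])).compr₂ (scalar F)

variable (C) in
/-- The pairing is non-degenerate. -/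
class NonDegenerate : Prop where
  nondegenerate {A B : C} (f g : A ⟶ B) : (pairing F f g).Nondegenerate

/-- The quantum dimension of an object. -/
def dimObj (A : C) : F := pairing F (𝟙 A) (𝟙 A) (𝟙 (𝟙 A)) (𝟙 (𝟙 A))

/-- The quantum dimension of a 1-morphism. -/
def dimMor {A B : C} (f : A ⟶ B) : F := pairing F f f (𝟙 f) (𝟙 f)

variable [NonDegenerate F C]

/-- The identification `2Hom(f, g) ≃ 2Hom(g, f)*`, `x ↦ ⟨x, ·⟩`. -/
def toDual {A B : C} (f g : A ⟶ B) : (f ⟶ g) ≃ₗ[F] Module.Dual F (g ⟶ f) :=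
  haveI : (pairing F f g).IsPerfPair :=
    have h := NonDegenerate.nondegenerate (F := F) f g
    LinearMap.IsPerfPair.of_injective
      (LinearMap.separatingLeft_iff_ker_eq_bot.1 h.1 |> LinearMap.ker_eq_bot.1)
      (LinearMap.separatingRight_iff_flip_ker_eq_bot.1 h.2 |> LinearMap.ker_eq_bot.1)
  (pairing F f g).toPerfPair

end
end

end Linear

/-! ### The linear maps attached to the oriented 4-simplices -/

section Simplex

variable {C : Type u} [Bicategory.{w, v} C] [Bicategory.Strict C] [SemiStrictMonoidal C]

/-- `f_{(ijk)l} = f_{ikl} (e_{kl} ⊗ f_{ijk})`. -/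
abbrev fL {eij eik eil ejk ekl : C} (fijk : eik ⟶ ejk * eij) (fikl : eil ⟶ ekl * eik) :
    eil ⟶ ekl * (ejk * eij) :=
  fikl ≫ (ekl ⊳ fijk)

/-- `f_{i(jkl)} = f_{ijl} (f_{jkl} ⊗ e_{ij})`. -/
abbrev fR {eij eil ejk ejl ekl : C} (fijl : eil ⟶ ejl * eij) (fjkl : ejl ⟶ ekl * ejk) :
    eil ⟶ ekl * (ejk * eij) :=
  fijl ≫ (fjkl ⊲ eij) ≫ eqToHom (mul_assoc ekl ejk eij)

/-- `2H(ijkl) = 2Hom(f_{(ijk)l}, f_{i(jkl)})`. -/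
abbrev twoH {eij eik eil ejk ejl ekl : C} (fijk : eik ⟶ ejk * eij) (fijl : eil ⟶ ejl * eij)
    (fikl : eil ⟶ ekl * eik) (fjkl : ejl ⟶ ekl * ejk) : Type w :=
  fL fijk fikl ⟶ fR fijl fjkl

/-- `2Hom(f_{i(jkl)}, f_{(ijk)l})`. -/
abbrev twoHop {eij eik eil ejk ejl ekl : C} (fijk : eik ⟶ ejk * eij) (fijl : eil ⟶ ejl * eij)
    (fikl : eil ⟶ ekl * eik) (fjkl : ejl ⟶ ekl * ejk) : Type w :=
  fR fijl fjkl ⟶ fL fijk fikl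

/-- `f_{((ijk)l)m} = f_{ilm} (e_{lm} ⊗ f_{ikl}) (e_{lm} ⊗ e_{kl} ⊗ f_{ijk})`. -/
abbrev fLL {eij eik eil eim ejk ekl elm : C} (fijk : eik ⟶ ejk * eij) (fikl : eil ⟶ ekl * eik)
    (film : eim ⟶ elm * eil) : eim ⟶ elm * (ekl * (ejk * eij)) :=
  film ≫ (elm ⊳ fikl) ≫ (elm ⊳ (ekl ⊳ fijk))

/-- `f_{i(j(klm))} = f_{ijm} (f_{jkm} ⊗ e_{ij}) (f_{klm} ⊗ e_{jk} ⊗ e_{ij})`. -/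
abbrev fRR {eij eim ejk ejm ekl ekm elm : C} (fijm : eim ⟶ ejm * eij) (fjkm : ejm ⟶ ekm * ejk)
    (fklm : ekm ⟶ elm * ekl) : eim ⟶ elm * (ekl * (ejk * eij)) :=
  fijm ≫ₛ (fjkm ⊲ eij) ≫ₛ ((fklm ⊲ ejk) ⊲ eij) ≫ₛ 𝟙 (elm * (ekl * (ejk * eij)))

attribute [local simp] fL fR fLL fRR

section

variable {eij eik eil eim ejk ejl ejm ekl ekm elm : C}
  {fijk : eik ⟶ ejk * eij} {fijl : eil ⟶ ejl * eij} {fijm : eim ⟶ ejm * eij}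
  {fikl : eil ⟶ ekl * eik} {fikm : eim ⟶ ekm * eik} {film : eim ⟶ elm * eil}
  {fjkl : ejl ⟶ ekl * ejk} {fjkm : ejm ⟶ ekm * ejk} {fjlm : ejm ⟶ elm * ejl}
  {fklm : ekm ⟶ elm * ekl}

/-- `βδ = (β ∘ (e_{lm} ⊗ e_{kl} ⊗ f_{ijk})) · (f_{ikm} ∘ ⊗_{f_{klm}, f_{ijk}}) ·
(δ ∘ (f_{klm} ⊗ e_{jk} ⊗ e_{ij}))`. -/
def betaDelta₀ (β : twoH fikl fikm film fklm) (δ : twoH fijk fijm fikm fjkm) :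
    fLL fijk fikl film ⟶ fRR fijm fjkm fklm :=
  𝟙 (fLL fijk fikl film)
    ⬝ whisk (𝟙 eim) β (elm ⊳ (ekl ⊳ fijk))
    ⬝ whisk fikm (SemiStrictMonoidal.ten fklm fijk).hom (𝟙 (elm * (ekl * (ejk * eij))))
    ⬝ whisk (𝟙 eim) δ ((fklm ⊲ (ejk * eij)) ≫ₛ 𝟙 (elm * (ekl * (ejk * eij))))
    ⬝ 𝟙 (fRR fijm fjkm fklm)

/-- `δβ = (δ ∘ (f_{klm} ⊗ e_{jk} ⊗ e_{ij})) · (f_{ikm} ∘ ⊗⁻¹_{f_{klm}, f_{ijk}}) ·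
(β ∘ (e_{lm} ⊗ e_{kl} ⊗ f_{ijk}))`. -/
def deltaBeta₀ (β : twoHop fikl fikm film fklm) (δ : twoHop fijk fijm fikm fjkm) :
    fRR fijm fjkm fklm ⟶ fLL fijk fikl film :=
  𝟙 (fRR fijm fjkm fklm)
    ⬝ whisk (𝟙 eim) δ ((fklm ⊲ (ejk * eij)) ≫ₛ 𝟙 (elm * (ekl * (ejk * eij))))
    ⬝ whisk fikm (SemiStrictMonoidal.ten fklm fijk).inv (𝟙 (elm * (ekl * (ejk * eij))))
    ⬝ whisk (𝟙 eim) β (elm ⊳ (ekl ⊳ fijk))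
    ⬝ 𝟙 (fLL fijk fikl film)

/-- `αγϵ = (f_{ijm} ∘ (α ⊗ e_{ij})) · (γ ∘ (e_{lm} ⊗ f_{jkl} ⊗ e_{ij})) ·
(f_{ilm} ∘ (e_{lm} ⊗ ϵ))`. -/
def alphaGammaEps₀ (α : twoHop fjkl fjkm fjlm fklm) (γ : twoHop fijl fijm film fjlm)
    (ϵ : twoHop fijk fijl fikl fjkl) : fRR fijm fjkm fklm ⟶ fLL fijk fikl film :=
  𝟙 (fRR fijm fjkm fklm)
    ⬝ whisk fijm (α ⊲₂ eij) (𝟙 (elm * (ekl * (ejk * eij))))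
    ⬝ whisk (𝟙 eim) γ ((elm ⊳ (fjkl ⊲ eij)) ≫ₛ 𝟙 (elm * (ekl * (ejk * eij))))
    ⬝ whisk film (elm ⊳₂ ϵ) (𝟙 (elm * (ekl * (ejk * eij))))
    ⬝ 𝟙 (fLL fijk fikl film)

/-- `ϵγα = (f_{ilm} ∘ (e_{lm} ⊗ ϵ)) · (γ ∘ (e_{lm} ⊗ f_{jkl} ⊗ e_{ij})) ·
(f_{ijm} ∘ (α ⊗ e_{ij}))`. -/
def epsGammaAlpha₀ (α : twoH fjkl fjkm fjlm fklm) (γ : twoH fijl fijm film fjlm)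
    (ϵ : twoH fijk fijl fikl fjkl) : fLL fijk fikl film ⟶ fRR fijm fjkm fklm :=
  𝟙 (fLL fijk fikl film)
    ⬝ whisk film (elm ⊳₂ ϵ) (𝟙 (elm * (ekl * (ejk * eij))))
    ⬝ whisk (𝟙 eim) γ ((elm ⊳ (fjkl ⊲ eij)) ≫ₛ 𝟙 (elm * (ekl * (ejk * eij))))
    ⬝ whisk fijm (α ⊲₂ eij) (𝟙 (elm * (ekl * (ejk * eij))))
    ⬝ 𝟙 (fRR fijm fjkm fklm)

end

section

variable {C : Type u} [Bicategory.{w, v} C] [Bicategory.Strict C]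
  [∀ A B : C, Preadditive (A ⟶ B)]

lemma vcomp_add_left {A B : C} {f g g' h : A ⟶ B} (α α' : f ⟶ g) (β : g' ⟶ h) (e : g = g') :
    vcomp (α + α') β e = vcomp α β e + vcomp α' β e := by
  simp [vcomp]

lemma vcomp_smul_left {F : Type*} [Field F] [∀ A B : C, Linear F (A ⟶ B)]
    {A B : C} {f g g' h : A ⟶ B} (r : F) (α : f ⟶ g) (β : g' ⟶ h)
    (e : g = g') : vcomp (r • α) β e = r • vcomp α β e := by
  simp [vcomp]

lemma vcomp_add_right {A B : C} {f g g' h : A ⟶ B} (α : f ⟶ g) (β β' : g' ⟶ h) (e : g = g') :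
    vcomp α (β + β') e = vcomp α β e + vcomp α β' e := by
  simp [vcomp]

lemma vcomp_smul_right {F : Type*} [Field F] [∀ A B : C, Linear F (A ⟶ B)]
    {A B : C} {f g g' h : A ⟶ B} (r : F) (α : f ⟶ g) (β : g' ⟶ h)
    (e : g = g') : vcomp α (r • β) e = r • vcomp α β e := by
  simp [vcomp]

lemma whisk_add (F : Type*) [Field F] [∀ A B : C, Linear F (A ⟶ B)] [SemiStrictMonoidal C]
    [VectLinear F C]
    {P Q Q' R R' S : C} (X : P ⟶ Q) {f g : Q' ⟶ R} (α β : f ⟶ g) (Y : R' ⟶ S)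
    (hQ : Q = Q') (hR : R = R') :
    whisk X (α + β) Y hQ hR = whisk X α Y hQ hR + whisk X β Y hQ hR := by
  simp only [whisk]
  rw [VectLinear.whiskerRight_add (F := F), VectLinear.whiskerLeft_add (F := F),
    VectLinear.whiskerLeft_add (F := F)]

lemma whisk_smul {F : Type*} [Field F] [∀ A B : C, Linear F (A ⟶ B)] [SemiStrictMonoidal C]
    [VectLinear F C]
    {P Q Q' R R' S : C} (X : P ⟶ Q) {f g : Q' ⟶ R} (r : F) (α : f ⟶ g)
    (Y : R' ⟶ S) (hQ : Q = Q') (hR : R = R') :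
    whisk X (r • α) Y hQ hR = r • whisk X α Y hQ hR := by
  simp only [whisk]
  rw [VectLinear.whiskerRight_smul, VectLinear.whiskerLeft_smul, VectLinear.whiskerLeft_smul]

end

/-- The linear map on `U ⊗ (V ⊗ W)` induced by a trilinear function. -/
def lift₃ {F : Type*} [Field F] {U V W X : Type*} [AddCommGroup U] [Module F U]
    [AddCommGroup V] [Module F V] [AddCommGroup W] [Module F W] [AddCommGroup X] [Module F X]
    (t : U → V → W → X)
    (add₁ : ∀ x x' y z, t (x + x') y z = t x y z + t x' y z)
    (smul₁ : ∀ (r : F) x y z, t (r • x) y z = r • t x y z)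
    (add₂ : ∀ x y y' z, t x (y + y') z = t x y z + t x y' z)
    (smul₂ : ∀ (r : F) x y z, t x (r • y) z = r • t x y z)
    (add₃ : ∀ x y z z', t x y (z + z') = t x y z + t x y z')
    (smul₃ : ∀ (r : F) x y z, t x y (r • z) = r • t x y z) : U ⊗[F] (V ⊗[F] W) →ₗ[F] X :=
  TensorProduct.lift
    { toFun := fun x => TensorProduct.lift (LinearMap.mk₂ F (t x) (add₂ x)
        (fun r y z => smul₂ r x y z) (add₃ x) (fun r y z => smul₃ r x y z))
      map_add' := fun x x' => TensorProduct.ext' fun y z => by simp [add₁]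
      map_smul' := fun r x => TensorProduct.ext' fun y z => by simp [smul₁] }

variable (F : Type*) [Field F] [∀ A B : C, Preadditive (A ⟶ B)] [∀ A B : C, Linear F (A ⟶ B)]
  [VectLinear F C]

section

variable {eij eik eil eim ejk ejl ejm ekl ekm elm : C}
  (fijk : eik ⟶ ejk * eij) (fijl : eil ⟶ ejl * eij) (fijm : eim ⟶ ejm * eij)
  (fikl : eil ⟶ ekl * eik) (fikm : eim ⟶ ekm * eik) (film : eim ⟶ elm * eil)
  (fjkl : ejl ⟶ ekl * ejk) (fjkm : ejm ⟶ ekm * ejk) (fjlm : ejm ⟶ elm * ejl)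
  (fklm : ekm ⟶ elm * ekl)

/-- `β ⊗ δ ↦ βδ`. -/
def betaDelta : twoH fikl fikm film fklm ⊗[F] twoH fijk fijm fikm fjkm →ₗ[F]
    (fLL fijk fikl film ⟶ fRR fijm fjkm fklm) :=
  TensorProduct.lift (LinearMap.mk₂ F betaDelta₀
    (by intros; simp only [betaDelta₀, whisk_add F, vcomp_add_left, vcomp_add_right])
    (by intros; simp only [betaDelta₀, whisk_smul, vcomp_smul_left, vcomp_smul_right])
    (by intros; simp only [betaDelta₀, whisk_add F, vcomp_add_left, vcomp_add_right])
    (by intros; simp only [betaDelta₀, whisk_smul, vcomp_smul_left, vcomp_smul_right]))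

/-- `β ⊗ δ ↦ δβ`. -/
def deltaBeta : twoHop fikl fikm film fklm ⊗[F] twoHop fijk fijm fikm fjkm →ₗ[F]
    (fRR fijm fjkm fklm ⟶ fLL fijk fikl film) :=
  TensorProduct.lift (LinearMap.mk₂ F deltaBeta₀
    (by intros; simp only [deltaBeta₀, whisk_add F, vcomp_add_left, vcomp_add_right])
    (by intros; simp only [deltaBeta₀, whisk_smul, vcomp_smul_left, vcomp_smul_right])
    (by intros; simp only [deltaBeta₀, whisk_add F, vcomp_add_left, vcomp_add_right])
    (by intros; simp only [deltaBeta₀, whisk_smul, vcomp_smul_left, vcomp_smul_right]))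

/-- `α ⊗ γ ⊗ ϵ ↦ αγϵ`. -/
def alphaGammaEps : twoHop fjkl fjkm fjlm fklm ⊗[F]
      (twoHop fijl fijm film fjlm ⊗[F] twoHop fijk fijl fikl fjkl) →ₗ[F]
    (fRR fijm fjkm fklm ⟶ fLL fijk fikl film) :=
  lift₃ alphaGammaEps₀
    (by intros; simp only [alphaGammaEps₀, VectLinear.rT₂_add (F := F), whisk_add F,
      vcomp_add_left, vcomp_add_right])
    (by intros; simp only [alphaGammaEps₀, VectLinear.rT₂_smul, whisk_smul, vcomp_smul_left,
      vcomp_smul_right])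
    (by intros; simp only [alphaGammaEps₀, whisk_add F, vcomp_add_left, vcomp_add_right])
    (by intros; simp only [alphaGammaEps₀, whisk_smul, vcomp_smul_left, vcomp_smul_right])
    (by intros; simp only [alphaGammaEps₀, VectLinear.lT₂_add (F := F), whisk_add F,
      vcomp_add_left, vcomp_add_right])
    (by intros; simp only [alphaGammaEps₀, VectLinear.lT₂_smul, whisk_smul, vcomp_smul_left,
      vcomp_smul_right])

/-- `α ⊗ γ ⊗ ϵ ↦ ϵγα`. -/
def epsGammaAlpha : twoH fjkl fjkm fjlm fklm ⊗[F]
      (twoH fijl fijm film fjlm ⊗[F] twoH fijk fijl fikl fjkl) →ₗ[F]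
    (fLL fijk fikl film ⟶ fRR fijm fjkm fklm) :=
  lift₃ epsGammaAlpha₀
    (by intros; simp only [epsGammaAlpha₀, VectLinear.rT₂_add (F := F), whisk_add F,
      vcomp_add_left, vcomp_add_right])
    (by intros; simp only [epsGammaAlpha₀, VectLinear.rT₂_smul, whisk_smul, vcomp_smul_left,
      vcomp_smul_right])
    (by intros; simp only [epsGammaAlpha₀, whisk_add F, vcomp_add_left, vcomp_add_right])
    (by intros; simp only [epsGammaAlpha₀, whisk_smul, vcomp_smul_left, vcomp_smul_right])
    (by intros; simp only [epsGammaAlpha₀, VectLinear.lT₂_add (F := F), whisk_add F,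
      vcomp_add_left, vcomp_add_right])
    (by intros; simp only [epsGammaAlpha₀, VectLinear.lT₂_smul, whisk_smul, vcomp_smul_left,
      vcomp_smul_right])

variable [DualStructure C] [NonDegenerate F C]

/-- `2H(1) ⊗ 2H(2)` is the dual of the tensor product of the opposite spaces. -/
def toDual₂ {A B A' B' : C} (f g : A ⟶ B) (f' g' : A' ⟶ B') :
    (f ⟶ g) ⊗[F] (f' ⟶ g') ≃ₗ[F] Module.Dual F ((g ⟶ f) ⊗[F] (g' ⟶ f')) :=
  TensorProduct.congr (toDual F f g) (toDual F f' g') ≪≫ₗ TensorProduct.dualDistribEquiv F _ _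

/-- The analogous identification for three tensor factors. -/
def toDual₃ {A B A' B' A'' B'' : C} (f g : A ⟶ B) (f' g' : A' ⟶ B') (f'' g'' : A'' ⟶ B'') :
    (f ⟶ g) ⊗[F] ((f' ⟶ g') ⊗[F] (f'' ⟶ g'')) ≃ₗ[F]
      Module.Dual F ((g ⟶ f) ⊗[F] ((g' ⟶ f') ⊗[F] (g'' ⟶ f''))) :=
  TensorProduct.congr (toDual F f g) (toDual₂ F f' g' f'' g'') ≪≫ₗ
    TensorProduct.dualDistribEquiv F _ _

/-- `Z(+(ijklm)) : 2H(iklm) ⊗ 2H(ijkm) → 2H(jklm) ⊗ 2H(ijlm) ⊗ 2H(ijkl)`, determined by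
`⟨Z(+(ijklm))(β ⊗ δ), α ⊗ γ ⊗ ϵ⟩ = ⟨βδ, αγϵ⟩`. -/
def Zpos : twoH fikl fikm film fklm ⊗[F] twoH fijk fijm fikm fjkm →ₗ[F]
    twoH fjkl fjkm fjlm fklm ⊗[F] (twoH fijl fijm film fjlm ⊗[F] twoH fijk fijl fikl fjkl) :=
  (toDual₃ F _ _ _ _ _ _).symm.toLinearMap ∘ₗ
    (pairing F (fLL fijk fikl film) (fRR fijm fjkm fklm)).compl₁₂
      (betaDelta F fijk fijm fikl fikm film fjkm fklm)
      (alphaGammaEps F fijk fijl fijm fikl film fjkl fjkm fjlm fklm)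

/-- `Z(-(ijklm)) : 2H(jklm) ⊗ 2H(ijlm) ⊗ 2H(ijkl) → 2H(iklm) ⊗ 2H(ijkm)`, determined by
`⟨Z(-(ijklm))(α ⊗ γ ⊗ ϵ), β ⊗ δ⟩ = ⟨δβ, ϵγα⟩`. -/
def Zneg : twoH fjkl fjkm fjlm fklm ⊗[F]
      (twoH fijl fijm film fjlm ⊗[F] twoH fijk fijl fikl fjkl) →ₗ[F]
    twoH fikl fikm film fklm ⊗[F] twoH fijk fijm fikm fjkm :=
  (toDual₂ F _ _ _ _).symm.toLinearMap ∘ₗ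
    ((pairing F (fRR fijm fjkm fklm) (fLL fijk fikl film)).compl₁₂
      (deltaBeta F fijk fijm fikl fikm film fjkm fklm)
      (epsGammaAlpha F fijk fijl fijm fikl film fjkl fjkm fjlm fklm)).flip

end

/-! ### Partial traces and the composite over the five 4-simplices containing the vertex 4 -/

section LinearAlgebra

variable {F}
variable {U V W X Y : Type*} [AddCommGroup U] [Module F U] [AddCommGroup V] [Module F V]
  [AddCommGroup W] [Module F W] [AddCommGroup X] [Module F X] [AddCommGroup Y] [Module F Y]

/-- The partial trace over the first factor `V` of a linear map `V ⊗ W → V ⊗ U`. -/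
def partialTrace [Module.Finite F V] (T : V ⊗[F] W →ₗ[F] V ⊗[F] U) : W →ₗ[F] U :=
  ∑ a, (TensorProduct.lid F U).toLinearMap ∘ₗ
    LinearMap.rTensor U ((Module.finBasis F V).coord a) ∘ₗ T ∘ₗ
      TensorProduct.mk F V W (Module.finBasis F V a)

/-- `Z ⊗ 1` for `Z : U ⊗ V → W ⊗ X ⊗ Y`, with tensor products associated to the right. -/
def tensorOne₂₃ {M : Type*} [AddCommGroup M] [Module F M]
    (Z : U ⊗[F] V →ₗ[F] W ⊗[F] (X ⊗[F] Y)) :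
    U ⊗[F] (V ⊗[F] M) →ₗ[F] W ⊗[F] (X ⊗[F] (Y ⊗[F] M)) :=
  LinearMap.lTensor W (TensorProduct.assoc F X Y M).toLinearMap ∘ₗ
    (TensorProduct.assoc F W (X ⊗[F] Y) M).toLinearMap ∘ₗ LinearMap.rTensor M Z ∘ₗ
      (TensorProduct.assoc F U V M).symm.toLinearMap

/-- `Z ⊗ 1` for `Z : W ⊗ X ⊗ Y → U ⊗ V`, with tensor products associated to the right. -/
def tensorOne₃₂ {M : Type*} [AddCommGroup M] [Module F M]
    (Z : W ⊗[F] (X ⊗[F] Y) →ₗ[F] U ⊗[F] V) :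
    W ⊗[F] (X ⊗[F] (Y ⊗[F] M)) →ₗ[F] U ⊗[F] (V ⊗[F] M) :=
  (TensorProduct.assoc F U V M).toLinearMap ∘ₗ LinearMap.rTensor M Z ∘ₗ
    (TensorProduct.assoc F W (X ⊗[F] Y) M).symm.toLinearMap ∘ₗ
      LinearMap.lTensor W (TensorProduct.assoc F X Y M).symm.toLinearMap

variable (F) in
/-- The permutation `P` of the first two of several tensor factors. -/
abbrev swap₁₂ (U V W : Type*) [AddCommGroup U] [Module F U] [AddCommGroup V] [Module F V]
    [AddCommGroup W] [Module F W] : U ⊗[F] (V ⊗[F] W) →ₗ[F] V ⊗[F] (U ⊗[F] W) :=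
  (TensorProduct.leftComm F U V W).toLinearMap

end LinearAlgebra

section

variable [DualStructure C] [NonDegenerate F C]
  {e01 e02 e03 e04 e05 e12 e13 e14 e15 e23 e24 e25 e34 e35 e45 : C}
  (f012 : e02 ⟶ e12 * e01) (f013 : e03 ⟶ e13 * e01) (f014 : e04 ⟶ e14 * e01)
  (f015 : e05 ⟶ e15 * e01) (f023 : e03 ⟶ e23 * e02) (f024 : e04 ⟶ e24 * e02)
  (f025 : e05 ⟶ e25 * e02) (f034 : e04 ⟶ e34 * e03) (f035 : e05 ⟶ e35 * e03)
  (f045 : e05 ⟶ e45 * e04) (f123 : e13 ⟶ e23 * e12) (f124 : e14 ⟶ e24 * e12)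
  (f125 : e15 ⟶ e25 * e12) (f134 : e14 ⟶ e34 * e13) (f135 : e15 ⟶ e35 * e13)
  (f145 : e15 ⟶ e45 * e14) (f234 : e24 ⟶ e34 * e23) (f235 : e25 ⟶ e35 * e23)
  (f245 : e25 ⟶ e45 * e24) (f345 : e35 ⟶ e45 * e34)

/-- The composite (in this order)
`(Z(+(02345)) ⊗ 1) (1 ⊗ 1 ⊗ P) (1 ⊗ Z(+(01245)) ⊗ 1) (1 ⊗ 1 ⊗ 1 ⊗ P) (1 ⊗ 1 ⊗ 1 ⊗ Z(+(01234)))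
(1 ⊗ 1 ⊗ P ⊗ 1 ⊗ 1) (Z(-(12345)) ⊗ 1 ⊗ 1 ⊗ 1) (P ⊗ 1 ⊗ 1 ⊗ 1) (1 ⊗ Z(-(01345)) ⊗ 1)
(P ⊗ 1 ⊗ 1)`, from `2H(0345) ⊗ 2H(0235) ⊗ 2H(0125)` to `2H(0345) ⊗ 2H(1235) ⊗ 2H(0135) ⊗ 2H(0123)`. -/
def composite :
    twoH f034 f035 f045 f345 ⊗[F] (twoH f023 f025 f035 f235 ⊗[F] twoH f012 f015 f025 f125) →ₗ[F]
    twoH f034 f035 f045 f345 ⊗[F] (twoH f123 f125 f135 f235 ⊗[F]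
      (twoH f013 f015 f035 f135 ⊗[F] twoH f012 f013 f023 f123)) :=
  swap₁₂ F (twoH f123 f125 f135 f235) (twoH f034 f035 f045 f345)
      (twoH f013 f015 f035 f135 ⊗[F] twoH f012 f013 f023 f123) ∘ₗ
  LinearMap.lTensor (twoH f123 f125 f135 f235)
    (tensorOne₃₂ (M := twoH f012 f013 f023 f123)
      (Zneg F f013 f014 f015 f034 f035 f045 f134 f135 f145 f345)) ∘ₗ
  swap₁₂ F (twoH f134 f135 f145 f345) (twoH f123 f125 f135 f235)
      (twoH f014 f015 f045 f145 ⊗[F]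
        (twoH f013 f014 f034 f134 ⊗[F] twoH f012 f013 f023 f123)) ∘ₗ
  tensorOne₃₂ (Zneg F f123 f124 f125 f134 f135 f145 f234 f235 f245 f345) ∘ₗ
  LinearMap.lTensor (twoH f234 f235 f245 f345) (LinearMap.lTensor (twoH f124 f125 f145 f245)
    (swap₁₂ F (twoH f014 f015 f045 f145) (twoH f123 f124 f134 f234)
      (twoH f013 f014 f034 f134 ⊗[F] twoH f012 f013 f023 f123))) ∘ₗ
  LinearMap.lTensor (twoH f234 f235 f245 f345) (LinearMap.lTensor (twoH f124 f125 f145 f245)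
    (LinearMap.lTensor (twoH f014 f015 f045 f145)
      (Zpos F f012 f013 f014 f023 f024 f034 f123 f124 f134 f234))) ∘ₗ
  LinearMap.lTensor (twoH f234 f235 f245 f345) (LinearMap.lTensor (twoH f124 f125 f145 f245)
    (LinearMap.lTensor (twoH f014 f015 f045 f145)
      (TensorProduct.comm F (twoH f012 f014 f024 f124) (twoH f023 f024 f034 f234)).toLinearMap)) ∘ₗ
  LinearMap.lTensor (twoH f234 f235 f245 f345)
    (tensorOne₂₃ (M := twoH f023 f024 f034 f234)
      (Zpos F f012 f014 f015 f024 f025 f045 f124 f125 f145 f245)) ∘ₗ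
  LinearMap.lTensor (twoH f234 f235 f245 f345) (LinearMap.lTensor (twoH f024 f025 f045 f245)
    (TensorProduct.comm F (twoH f023 f024 f034 f234) (twoH f012 f015 f025 f125)).toLinearMap) ∘ₗ
  tensorOne₂₃ (Zpos F f023 f024 f025 f034 f035 f045 f234 f235 f245 f345)

end
end Simplex
end Spherical

end

open Spherical

open CategoryTheory Bicategory
open scoped TensorProduct

noncomputable section

set_option linter.unusedSectionVars false

/-! Label by label, the assertion is an identity between scalars. Call a 1-morphism scalar if its
2-endomorphisms are `F` (`EndScalar`). The two 1-morphisms attached to a tetrahedron with basis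
labels are scalar, and by non-degeneracy a non-zero 2-cell between scalar 1-morphisms is invertible.
So every `2H(ijkl)` is either zero or a line spanned by an isomorphism; in the second case the
tetrahedron is admissible (`Tet`). Once generators of these lines are chosen, the two sides of a
4-simplex differ by a non-zero number `z` (`hexL = z • hexR`), and `Zpos`, `Zneg` multiply
generators by `z`, respectively `z⁻¹`, times a quotient of quantum dimensions (`Zpos_hom_tmul_hom`,
`Zneg_hom_tmul_hom`).

Cocycle identity. Let `z0, ..., z5` belong to the 4-simplices opposite the vertices `0, ..., 5`. One
cell from the left comb to the right comb of the 5-simplex can be rewritten in two ways into the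
same invertible cell, with the factor `z1 * z3 * z5` or with the factor `z0 * z2 * z4`
(`smul_sixfold_eq`). Hence `z4`, the scalar of `(01235)`, is the product of the scalars of the other
five 4-simplices with their signs.

Dimensions. Almost all dimensions cancel between the weight and the five 4-simplices, and the
partial trace over a line adds no factor. An admissible summand is `dim_q(f345)^2 / (dim_q(e34)
dim_q(e45) dim_q(e35))` times `Z(+(01235))` (`weight_smul_partialTrace_composite`).

Labels. A scalar 1-morphism `X ⟶ A ⊗ B` factors, uniquely up to isomorphism, as a basis element `X ⟶
A ⊗ Y` followed by `A ⊗ (Y ⟶ B)` with `Y` in `ℰ`. So, if the tetrahedra of `(01235)` are admissible,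
each triple `(e34, e45, f345)` extends to exactly one admissible labelling (`exists_coneLabels`,
`coneLabels_unique`), and all other summands vanish. If an outer tetrahedron is not admissible, both
sides are maps from or to the zero space.

It remains to see that the coefficients add up to `K` (`sum_dimMor_sq_div`). This follows from
`dim_q(B) = ∑ dim_q(q)^2 / dim_q(X)`, over the basis elements `q : X ⟶ B` with `X` in `ℰ`
(`dimObj_eq_sum`), applied to `Z ⊗ Y*` and transported by bending the leg `Y`. The consistent
pivotal structure gives `dim_q(f*) = dim_q(f)`, the spherical structure `dim_q(Y*) = dim_q(Y)`.

The foundation is a rank count. Semi-simplicity forces `End(X)` to be generated by `𝟙 X` for `X` in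
`ℰ` and leaves no non-zero 1-morphisms between different members. For a scalar `q : X ⟶ B` the unit
of `q` is therefore unitary up to the factor `dim_q(q) / dim_q(X)` (`Coiso`), so that whiskering by
`q` is full and preserves scalar 1-morphisms. The same argument identifies `K` with the size of `ℰ`.
-/

namespace Spherical

open SemiStrictMonoidal DualStructure

/-! ### 2-cells with forgotten boundaries -/

section Cells

variable {C : Type u} [Bicategory.{w, v} C]

/-- A 1-morphism together with its source and target. -/
abbrev Arr {A B : C} (f : A ⟶ B) : Σ (A B : C), A ⟶ B := ⟨A, B, f⟩

/-- A 2-morphism together with its boundary. -/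
abbrev Cell {A B : C} {f g : A ⟶ B} (α : f ⟶ g) : Σ (A B : C) (f g : A ⟶ B), f ⟶ g :=
  ⟨A, B, f, g, α⟩

/-- Equations whose boundaries agree only propositionally are proved for `Cell`s, where every
`eqToHom` disappears; this is the way back to an equation of 2-morphisms. -/
lemma eq_of_cell {A B : C} {f g : A ⟶ B} {α β : f ⟶ g} (h : Cell α = Cell β) : α = β := by
  simpa using h

/-- The equalities of boundaries are needed besides `≍`, since equal hom types do not determine
their endpoints. -/
lemma cell_of_heq {A B : C} {f g f' g' : A ⟶ B} {α : f ⟶ g} {β : f' ⟶ g'} (hf : f = f')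
    (hg : g = g') (h : α ≍ β) : Cell α = Cell β := by
  subst hf hg; rw [eq_of_heq h]

lemma Cell.comp_congr {A B A' B' : C} {f g h : A ⟶ B} {f' g' h' : A' ⟶ B'}
    {α : f ⟶ g} {β : g ⟶ h} {α' : f' ⟶ g'} {β' : g' ⟶ h'}
    (hα : Cell α = Cell α') (hβ : Cell β = Cell β') : Cell (α ≫ β) = Cell (α' ≫ β') := by
  cases hα; cases hβ; rfl

lemma Arr.comp_congr {A B D A' B' D' : C} {f : A ⟶ B} {g : B ⟶ D} {f' : A' ⟶ B'} {g' : B' ⟶ D'}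
    (hf : Arr f = Arr f') (hg : Arr g = Arr g') : Arr (f ≫ g) = Arr (f' ≫ g') := by
  cases hf; cases hg; rfl

lemma Cell.whiskerLeft_congr {A B D A' B' D' : C} {f : A ⟶ B} {f' : A' ⟶ B'} {g h : B ⟶ D}
    {g' h' : B' ⟶ D'} {α : g ⟶ h} {α' : g' ⟶ h'} (hf : Arr f = Arr f') (hα : Cell α = Cell α') :
    Cell (f ◁ α) = Cell (f' ◁ α') := by
  cases hf; cases hα; rfl

lemma Cell.whiskerRight_congr {A B D A' B' D' : C} {f : B ⟶ D} {f' : B' ⟶ D'} {g h : A ⟶ B}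
    {g' h' : A' ⟶ B'} {α : g ⟶ h} {α' : g' ⟶ h'} (hα : Cell α = Cell α') (hf : Arr f = Arr f') :
    Cell (α ▷ f) = Cell (α' ▷ f') := by
  cases hα; cases hf; rfl

lemma Cell.id_congr {A B A' B' : C} {f : A ⟶ B} {f' : A' ⟶ B'} (hf : Arr f = Arr f') :
    Cell (𝟙 f) = Cell (𝟙 f') := by
  cases hf; rfl

@[simp] lemma cell_eqToHom_comp {A B : C} {f g h : A ⟶ B} (e : f = g) (α : g ⟶ h) :
    Cell (eqToHom e ≫ α) = Cell α := by
  subst e; simp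

@[simp] lemma cell_comp_eqToHom {A B : C} {f g h : A ⟶ B} (α : f ⟶ g) (e : g = h) :
    Cell (α ≫ eqToHom e) = Cell α := by
  subst e; simp

@[simp] lemma cell_eqToHom {A B : C} {f g : A ⟶ B} (e : f = g) :
    Cell (eqToHom e) = Cell (𝟙 f) := by
  subst e; simp

variable [Bicategory.Strict C]

lemma Cell.vcomp_congr {A B A' B' : C} {f g k h : A ⟶ B} {f' g' k' h' : A' ⟶ B'}
    {α : f ⟶ g} {β : k ⟶ h} {α' : f' ⟶ g'} {β' : k' ⟶ h'} (e : g = k) (e' : g' = k')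
    (hα : Cell α = Cell α') (hβ : Cell β = Cell β') :
    Cell (α ≫ eqToHom e ≫ β) = Cell (α' ≫ eqToHom e' ≫ β') := by
  subst e e'
  simpa using Cell.comp_congr hα hβ

lemma cell_vcomp {A B A' B' : C} {f g g' h : A ⟶ B} {f₁ g₁ h₁ : A' ⟶ B'}
    {α : f ⟶ g} {β : g' ⟶ h} {α' : f₁ ⟶ g₁} {β' : g₁ ⟶ h₁} (e : g = g')
    (hα : Cell α = Cell α') (hβ : Cell β = Cell β') : Cell (vcomp α β e) = Cell (α' ≫ β') := by
  subst e
  simpa [vcomp] using Cell.comp_congr hα hβ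

@[simp] lemma arr_comp_eqToHom {A B D : C} (f : A ⟶ B) (h : B = D) :
    Arr (f ≫ eqToHom h) = Arr f := by
  subst h; simp

@[simp] lemma arr_eqToHom_comp {A B D : C} (h : A = B) (f : B ⟶ D) :
    Arr (eqToHom h ≫ f) = Arr f := by
  subst h; simp

lemma associator_hom_eq {A B D E : C} (f : A ⟶ B) (g : B ⟶ D) (h : D ⟶ E) :
    (α_ f g h).hom = eqToHom (Category.assoc f g h) := by
  rw [Bicategory.Strict.associator_eqToIso]; rfl

lemma associator_inv_eq {A B D E : C} (f : A ⟶ B) (g : B ⟶ D) (h : D ⟶ E) :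
    (α_ f g h).inv = eqToHom (Category.assoc f g h).symm := by
  rw [Bicategory.Strict.associator_eqToIso]; rfl

lemma leftUnitor_hom_eq {A B : C} (f : A ⟶ B) :
    (λ_ f).hom = eqToHom (Category.id_comp f) := by
  rw [Bicategory.Strict.leftUnitor_eqToIso]; rfl

lemma leftUnitor_inv_eq {A B : C} (f : A ⟶ B) :
    (λ_ f).inv = eqToHom (Category.id_comp f).symm := by
  rw [Bicategory.Strict.leftUnitor_eqToIso]; rfl

lemma rightUnitor_hom_eq {A B : C} (f : A ⟶ B) :
    (ρ_ f).hom = eqToHom (Category.comp_id f) := by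
  rw [Bicategory.Strict.rightUnitor_eqToIso]; rfl

lemma rightUnitor_inv_eq {A B : C} (f : A ⟶ B) :
    (ρ_ f).inv = eqToHom (Category.comp_id f).symm := by
  rw [Bicategory.Strict.rightUnitor_eqToIso]; rfl

@[simp] lemma cell_whiskerRight_eqToHom {A B D : C} {f g : A ⟶ B} (α : f ⟶ g) (h : B = D) :
    Cell (α ▷ eqToHom h) = Cell α := by
  subst h
  simp [rightUnitor_hom_eq, rightUnitor_inv_eq]

@[simp] lemma cell_eqToHom_whiskerLeft {A B D : C} (h : A = B) {f g : B ⟶ D} (α : f ⟶ g) :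
    Cell (eqToHom h ◁ α) = Cell α := by
  subst h
  simp [leftUnitor_hom_eq, leftUnitor_inv_eq]

lemma cell_id_whiskerLeft {A D : C} {f g : A ⟶ D} (α : f ⟶ g) :
    Cell (𝟙 A ◁ α) = Cell α := cell_eqToHom_whiskerLeft rfl α

lemma cell_whiskerRight_id {A D : C} {f g : A ⟶ D} (α : f ⟶ g) :
    Cell (α ▷ 𝟙 D) = Cell α := cell_whiskerRight_eqToHom α rfl

lemma cell_whiskerRight_comp {A B D E : C} {h k : A ⟶ B} (α : h ⟶ k) (f : B ⟶ D) (g : D ⟶ E) :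
    Cell (α ▷ (f ≫ g)) = Cell ((α ▷ f) ▷ g) := by
  rw [Bicategory.whiskerRight_comp, associator_hom_eq, associator_inv_eq]; simp

lemma cell_whisker_assoc {A B D E : C} (f : A ⟶ B) {g h : B ⟶ D} (α : g ⟶ h) (k : D ⟶ E) :
    Cell ((f ◁ α) ▷ k) = Cell (f ◁ (α ▷ k)) := by
  rw [Bicategory.whisker_assoc, associator_hom_eq, associator_inv_eq]; simp

lemma cell_whisk {P Q Q' R R' S : C} (X : P ⟶ Q) {f g : Q' ⟶ R} (α : f ⟶ g) (Y : R' ⟶ S)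
    (hQ : Q = Q') (hR : R = R') {P₁ Q₁ R₁ S₁ : C} {X₁ : P₁ ⟶ Q₁} {f₁ g₁ : Q₁ ⟶ R₁} {α₁ : f₁ ⟶ g₁}
    {Y₁ : R₁ ⟶ S₁} (hX : Arr X = Arr X₁) (hα : Cell α = Cell α₁) (hY : Arr Y = Arr Y₁) :
    Cell (whisk X α Y hQ hR) = Cell (X₁ ◁ (α₁ ▷ Y₁)) := by
  subst hQ hR
  refine Cell.whiskerLeft_congr hX ?_
  rw [cell_eqToHom_whiskerLeft]
  exact Cell.whiskerRight_congr hα (by simpa using hY)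

end Cells

/-! ### Tensoring cells with objects -/

section Tensor

variable {C : Type u} [Bicategory.{w, v} C] [Bicategory.Strict C] [SemiStrictMonoidal C]

lemma Arr.lT_congr {A A' X Y X' Y' : C} {f : X ⟶ Y} {f' : X' ⟶ Y'} (hA : A = A')
    (hf : Arr f = Arr f') : Arr (A ⊳ f) = Arr (A' ⊳ f') := by
  cases hA; cases hf; rfl

lemma Arr.rT_congr {A A' X Y X' Y' : C} {f : X ⟶ Y} {f' : X' ⟶ Y'}
    (hf : Arr f = Arr f') (hA : A = A') : Arr (f ⊲ A) = Arr (f' ⊲ A') := by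
  cases hA; cases hf; rfl

lemma Cell.lT_congr {A A' X Y X' Y' : C} {f g : X ⟶ Y} {f' g' : X' ⟶ Y'} {α : f ⟶ g}
    {α' : f' ⟶ g'} (hA : A = A') (hα : Cell α = Cell α') : Cell (A ⊳₂ α) = Cell (A' ⊳₂ α') := by
  cases hA; cases hα; rfl

lemma Cell.rT_congr {A A' X Y X' Y' : C} {f g : X ⟶ Y} {f' g' : X' ⟶ Y'} {α : f ⟶ g}
    {α' : f' ⟶ g'} (hα : Cell α = Cell α') (hA : A = A') : Cell (α ⊲₂ A) = Cell (α' ⊲₂ A') := by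
  cases hA; cases hα; rfl

lemma Cell.ten_congr {A B X Y A' B' X' Y' : C} {f : A ⟶ B} {g : X ⟶ Y} {f' : A' ⟶ B'}
    {g' : X' ⟶ Y'} (hf : Arr f = Arr f') (hg : Arr g = Arr g') :
    Cell (ten f g).hom = Cell (ten f' g').hom := by
  cases hf; cases hg; rfl

lemma arr_mul_lT (A B : C) {X Y : C} (f : X ⟶ Y) : Arr ((A * B) ⊳ f) = Arr (A ⊳ (B ⊳ f)) := by
  rw [mul_lT']; simp

lemma arr_rT_mul {X Y : C} (f : X ⟶ Y) (A B : C) : Arr (f ⊲ (A * B)) = Arr ((f ⊲ A) ⊲ B) := by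
  rw [rT_mul']; simp

lemma arr_lT_rT (A : C) {X Y : C} (f : X ⟶ Y) (B : C) :
    Arr ((A ⊳ f) ⊲ B) = Arr (A ⊳ (f ⊲ B)) := by
  rw [lT_rT']; simp

lemma arr_rT_one {X Y : C} (f : X ⟶ Y) : Arr (f ⊲ (1 : C)) = Arr f := by
  rw [rT_one']; simp

lemma cell_of_heq' {A B A' B' : C} {f g : A ⟶ B} {f' g' : A' ⟶ B'} {α : f ⟶ g} {β : f' ⟶ g'}
    (hf : Arr f = Arr f') (hg : Arr g = Arr g') (h : α ≍ β) : Cell α = Cell β := by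
  cases hf; cases hg; rw [eq_of_heq h]

lemma cell_mul_lT (A B : C) {X Y : C} {f g : X ⟶ Y} (α : f ⟶ g) :
    Cell ((A * B) ⊳₂ α) = Cell (A ⊳₂ (B ⊳₂ α)) :=
  cell_of_heq' (arr_mul_lT A B f) (arr_mul_lT A B g) (mul_lT₂ A B α)

lemma cell_rT_mul {X Y : C} {f g : X ⟶ Y} (α : f ⟶ g) (A B : C) :
    Cell (α ⊲₂ (A * B)) = Cell ((α ⊲₂ A) ⊲₂ B) :=
  cell_of_heq' (arr_rT_mul f A B) (arr_rT_mul g A B) (rT₂_mul α A B)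

lemma cell_lT_rT (A : C) {X Y : C} {f g : X ⟶ Y} (α : f ⟶ g) (B : C) :
    Cell ((A ⊳₂ α) ⊲₂ B) = Cell (A ⊳₂ (α ⊲₂ B)) :=
  cell_of_heq' (arr_lT_rT A f B) (arr_lT_rT A g B) (lT₂_rT₂ A α B)

lemma cell_rT_one {X Y : C} {f g : X ⟶ Y} (α : f ⟶ g) : Cell (α ⊲₂ (1 : C)) = Cell α :=
  cell_of_heq' (arr_rT_one f) (arr_rT_one g) (rT₂_one α)

lemma hcomp₂_id_left {A B D : C} (f : A ⟶ B) {g g' : B ⟶ D} (β : g ⟶ g') :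
    hcomp₂ (𝟙 f) β = f ◁ β := by simp [hcomp₂]

lemma hcomp₂_id_right {A B D : C} {f f' : A ⟶ B} (α : f ⟶ f') (g : B ⟶ D) :
    hcomp₂ α (𝟙 g) = α ▷ g := by simp [hcomp₂]

/-- Functoriality is given for horizontal composites `hcomp₂`; an identity cell in one slot
specialises it to whiskering. -/
lemma cell_lT_whiskerLeft (A : C) {X Y Z : C} (f : X ⟶ Y) {g g' : Y ⟶ Z} (β : g ⟶ g') :
    Cell (A ⊳₂ (f ◁ β)) = Cell ((A ⊳ f) ◁ (A ⊳₂ β)) := by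
  have h := lT₂_hcomp A (𝟙 f) β
  rw [lT₂_id, hcomp₂_id_left, hcomp₂_id_left] at h
  exact cell_of_heq (lT_comp ..) (lT_comp ..) h

lemma cell_lT_whiskerRight (A : C) {X Y Z : C} {f f' : X ⟶ Y} (α : f ⟶ f') (g : Y ⟶ Z) :
    Cell (A ⊳₂ (α ▷ g)) = Cell ((A ⊳₂ α) ▷ (A ⊳ g)) := by
  have h := lT₂_hcomp A α (𝟙 g)
  rw [lT₂_id, hcomp₂_id_right, hcomp₂_id_right] at h
  exact cell_of_heq (lT_comp ..) (lT_comp ..) h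

lemma cell_rT_whiskerLeft {X Y Z : C} (f : X ⟶ Y) {g g' : Y ⟶ Z} (β : g ⟶ g') (A : C) :
    Cell ((f ◁ β) ⊲₂ A) = Cell ((f ⊲ A) ◁ (β ⊲₂ A)) := by
  have h := rT₂_hcomp (𝟙 f) β A
  rw [rT₂_id, hcomp₂_id_left, hcomp₂_id_left] at h
  exact cell_of_heq (rT_comp ..) (rT_comp ..) h

lemma cell_rT_whiskerRight {X Y Z : C} {f f' : X ⟶ Y} (α : f ⟶ f') (g : Y ⟶ Z) (A : C) :
    Cell ((α ▷ g) ⊲₂ A) = Cell ((α ⊲₂ A) ▷ (g ⊲ A)) := by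
  have h := rT₂_hcomp α (𝟙 g) A
  rw [rT₂_id, hcomp₂_id_right, hcomp₂_id_right] at h
  exact cell_of_heq (rT_comp ..) (rT_comp ..) h

end Tensor

/-! ### Adjunctions and traces in a strict 2-category with duals -/

section Duals

variable {C : Type u} [Bicategory.{w, v} C] [Bicategory.Strict C] [SemiStrictMonoidal C]
  [DualStructure C]

lemma Cell.dual_congr {A B A' B' : C} {f g : A ⟶ B} {f' g' : A' ⟶ B'} {α : f ⟶ g} {α' : f' ⟶ g'}
    (h : Cell α = Cell α') : Cell (dual₂ α) = Cell (dual₂ α') := by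
  cases h; rfl

lemma Cell.iota_congr {A B A' B' : C} {f : A ⟶ B} {f' : A' ⟶ B'} (h : Arr f = Arr f') :
    Cell (iota f) = Cell (iota f') := by
  cases h; rfl

/-- The dual of the unit of a 1-morphism. -/
abbrev iotaD {A B : C} (f : A ⟶ B) : f ≫ fᵃ ⟶ 𝟙 A := dual₂ (iota f)

/-- The dual of the counit of a 1-morphism. -/
abbrev epsD {A B : C} (f : A ⟶ B) : 𝟙 B ⟶ fᵃ ≫ f := dual₂ (eps f)

/-- The trace of a 2-endomorphism with values in the endomorphisms of an identity. -/
def trB {A B : C} (f : A ⟶ B) (x : f ⟶ f) : 𝟙 A ⟶ 𝟙 A := iota f ≫ (x ▷ fᵃ) ≫ iotaD f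

variable [HasDuals C]
open HasDuals

lemma dual₂_whiskerLeft {A B D : C} (f : A ⟶ B) {g g' : B ⟶ D} (β : g ⟶ g') :
    dual₂ (f ◁ β) = f ◁ dual₂ β := by
  have h := dual₂_hcomp (𝟙 f) β
  rwa [dual₂_id, hcomp₂_id_left, hcomp₂_id_left] at h

lemma dual₂_whiskerRight {A B D : C} {f f' : A ⟶ B} (α : f ⟶ f') (g : B ⟶ D) :
    dual₂ (α ▷ g) = dual₂ α ▷ g := by
  have h := dual₂_hcomp α (𝟙 g)
  rwa [dual₂_id, hcomp₂_id_right, hcomp₂_id_right] at h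

lemma dual₂_eqToHom {A B : C} {f g : A ⟶ B} (h : f = g) :
    dual₂ (eqToHom h) = eqToHom h.symm := by
  subst h; simp [dual₂_id]

lemma dual₂_inj {A B : C} {f g : A ⟶ B} {α β : f ⟶ g} (h : dual₂ α = dual₂ β) : α = β := by
  rw [← dual₂_dual₂ α, h, dual₂_dual₂]

/-- `zigzag_left` with associators and unitors. -/
lemma zigzag_left' {A B : C} (f : A ⟶ B) :
    iota f ▷ f ≫ (α_ _ _ _).hom ≫ f ◁ eps f = (λ_ f).hom ≫ (ρ_ f).inv := by
  refine eq_of_cell ?_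
  have h : Cell _ = Cell _ := cell_of_heq (by simp) (by simp) (zigzag_left f)
  rw [leftUnitor_hom_eq, rightUnitor_inv_eq, cell_eqToHom_comp, cell_eqToHom]
  rw [associator_hom_eq]
  refine Eq.trans ?_ (h.trans (Cell.id_congr (by simp)))
  simp [vcomp]

lemma zigzag_right' {A B : C} (f : A ⟶ B) :
    fᵃ ◁ iota f ≫ (α_ _ _ _).inv ≫ eps f ▷ fᵃ = (ρ_ fᵃ).hom ≫ (λ_ fᵃ).inv := by
  refine eq_of_cell ?_
  have h : Cell _ = Cell _ := cell_of_heq (by simp) (by simp) (zigzag_right f)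
  rw [rightUnitor_hom_eq, leftUnitor_inv_eq, cell_eqToHom_comp, cell_eqToHom]
  rw [associator_inv_eq]
  refine Eq.trans ?_ (h.trans (Cell.id_congr (by simp)))
  simp [vcomp]

/-- The duality adjunction `f ⊣ f*`. -/
def adj {A B : C} (f : A ⟶ B) : f ⊣ fᵃ where
  unit := iota f
  counit := eps f
  left_triangle := by
    simp only [leftZigzag, bicategoricalComp, BicategoricalCoherence.assoc_iso]
    simpa using zigzag_left' f
  right_triangle := by
    simpa [rightZigzag, bicategoricalComp] using zigzag_right' f

lemma dual₂_associator_hom {A B D E : C} (f : A ⟶ B) (g : B ⟶ D) (h : D ⟶ E) :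
    dual₂ (α_ f g h).hom = (α_ f g h).inv := by
  rw [associator_hom_eq, associator_inv_eq, dual₂_eqToHom]

lemma dual₂_associator_inv {A B D E : C} (f : A ⟶ B) (g : B ⟶ D) (h : D ⟶ E) :
    dual₂ (α_ f g h).inv = (α_ f g h).hom := by
  rw [associator_hom_eq, associator_inv_eq, dual₂_eqToHom]

lemma dual₂_unitors {A B : C} (f : A ⟶ B) : dual₂ (λ_ f).hom = (λ_ f).inv ∧
    dual₂ (λ_ f).inv = (λ_ f).hom ∧ dual₂ (ρ_ f).hom = (ρ_ f).inv ∧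
    dual₂ (ρ_ f).inv = (ρ_ f).hom := by
  simp only [leftUnitor_hom_eq, leftUnitor_inv_eq, rightUnitor_hom_eq, rightUnitor_inv_eq,
    dual₂_eqToHom, and_self]

/-- The opposite duality adjunction `f* ⊣ f`. -/
def adjD {A B : C} (f : A ⟶ B) : fᵃ ⊣ f where
  unit := epsD f
  counit := iotaD f
  left_triangle := by
    have h := congrArg dual₂ (zigzag_right' f)
    simp only [dual₂_comp, dual₂_whiskerLeft, dual₂_whiskerRight, dual₂_associator_inv,
      (dual₂_unitors _).2.1, (dual₂_unitors _).2.2.1] at h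
    simpa [leftZigzag, bicategoricalComp] using h
  right_triangle := by
    have h := congrArg dual₂ (zigzag_left' f)
    simp only [dual₂_comp, dual₂_whiskerLeft, dual₂_whiskerRight, dual₂_associator_hom,
      (dual₂_unitors _).1, (dual₂_unitors _).2.2.2] at h
    simpa [rightZigzag, bicategoricalComp] using h

lemma dagger_eq {A B : C} {f g : A ⟶ B} (α : f ⟶ g) :
    dagger α = (ρ_ _).inv ≫ gᵃ ◁ iota f ≫ gᵃ ◁ (α ▷ fᵃ) ≫ (α_ _ _ _).inv ≫ eps g ▷ fᵃ ≫ (λ_ _).hom := by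
  simp only [dagger, vcomp, rightUnitor_inv_eq, leftUnitor_hom_eq, associator_inv_eq,
    Category.id_comp, Category.comp_id, eqToHom_refl]

/-- `i_g` is slid past `i_f` and then past `α` by interchange, after which the zigzag identity of
`g` straightens the strand. -/
lemma iota_dagger {A B : C} {f g : A ⟶ B} (α : f ⟶ g) :
    iota g ≫ g ◁ dagger α = iota f ≫ α ▷ fᵃ := by
  rw [dagger_eq]
  calc _ = 𝟙 _ ⊗≫ (iota g ▷ 𝟙 A ≫ (g ≫ gᵃ) ◁ iota f) ⊗≫ g ◁ (gᵃ ◁ (α ▷ fᵃ)) ⊗≫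
        g ◁ (eps g ▷ fᵃ) ⊗≫ 𝟙 _ := by bicategory
    _ = 𝟙 _ ⊗≫ (𝟙 A ◁ iota f ≫ iota g ▷ (f ≫ fᵃ)) ⊗≫ g ◁ (gᵃ ◁ (α ▷ fᵃ)) ⊗≫
        g ◁ (eps g ▷ fᵃ) ⊗≫ 𝟙 _ := by rw [whisker_exchange]
    _ = 𝟙 _ ⊗≫ iota f ⊗≫ (iota g ▷ f ≫ (g ≫ gᵃ) ◁ α) ▷ fᵃ ⊗≫
        g ◁ (eps g ▷ fᵃ) ⊗≫ 𝟙 _ := by bicategory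
    _ = 𝟙 _ ⊗≫ iota f ⊗≫ (𝟙 A ◁ α ≫ iota g ▷ g) ▷ fᵃ ⊗≫
        g ◁ (eps g ▷ fᵃ) ⊗≫ 𝟙 _ := by rw [whisker_exchange]
    _ = 𝟙 _ ⊗≫ iota f ⊗≫ α ▷ fᵃ ⊗≫ (iota g ▷ g ≫ (α_ _ _ _).hom ≫ g ◁ eps g) ▷ fᵃ ⊗≫ 𝟙 _ := by
        bicategory
    _ = _ := by rw [zigzag_left']; bicategory

/-- This is the image of `iota_dagger` under `*`; the axiom `dagger_dual₂` is what lets the same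
mate slide across the opposite cup. -/
lemma dagger_iotaD {A B : C} {f g : A ⟶ B} (α : f ⟶ g) :
    f ◁ dagger α ≫ iotaD f = α ▷ gᵃ ≫ iotaD g := by
  apply dual₂_inj
  rw [dual₂_comp, dual₂_comp, dual₂_whiskerLeft, dual₂_whiskerRight, dagger_dual₂, dual₂_dual₂,
    dual₂_dual₂, iota_dagger]

/-- Cyclicity: `β` is carried around the loop in the form of its mate `dagger β`. -/
lemma trB_comm {A B : C} {f g : A ⟶ B} (α : f ⟶ g) (β : g ⟶ f) :
    trB f (α ≫ β) = trB g (β ≫ α) := by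
  simp only [trB, comp_whiskerRight, Category.assoc]
  rw [← dagger_iotaD, ← whisker_exchange_assoc, ← Category.assoc, iota_dagger, Category.assoc]

lemma cell_iota_comp {A B D : C} (f : A ⟶ B) (g : B ⟶ D) :
    Cell (iota (f ≫ g)) = Cell (iota f ≫ f ◁ ((λ_ _).inv ≫ iota g ▷ fᵃ)) := by
  refine (cell_of_heq rfl (by simp) (iota_comp f g)).trans ?_
  rw [leftUnitor_inv_eq]
  refine cell_vcomp _ rfl ?_
  refine Cell.whiskerLeft_congr rfl ?_
  simp

lemma cell_iotaD_comp {A B D : C} (f : A ⟶ B) (g : B ⟶ D) :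
    Cell (iotaD (f ≫ g)) = Cell (f ◁ (iotaD g ▷ fᵃ ≫ (λ_ _).hom) ≫ iotaD f) := by
  refine (Cell.dual_congr (cell_iota_comp f g)).trans ?_
  rw [dual₂_comp, dual₂_whiskerLeft, dual₂_comp, dual₂_whiskerRight, (dual₂_unitors _).2.1]

/-- The partial trace over the second factor of a composite. -/
def rtr {A B D : C} (f : A ⟶ B) (g : B ⟶ D) (y : f ≫ g ⟶ f ≫ g) : f ⟶ f :=
  (ρ_ f).inv ≫ f ◁ iota g ≫ (α_ _ _ _).inv ≫ y ▷ gᵃ ≫ (α_ _ _ _).hom ≫ f ◁ iotaD g ≫ (ρ_ f).hom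

/-- A loop around a composite is closed strand by strand, the inner strand `g` first. -/
lemma trB_comp {A B D : C} (f : A ⟶ B) (g : B ⟶ D) (y : f ≫ g ⟶ f ≫ g) :
    trB (f ≫ g) y = trB f (rtr f g y) := by
  refine eq_of_cell ?_
  have h : trB f (rtr f g y) = iota f ≫ f ◁ ((λ_ _).inv ≫ iota g ▷ fᵃ) ≫
      eqToHom (by simp) ≫ (y ▷ gᵃ) ▷ fᵃ ≫ eqToHom (by simp) ≫
      f ◁ (iotaD g ▷ fᵃ ≫ (λ_ _).hom) ≫ iotaD f := by
    simp only [trB, rtr]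
    -- In a strict 2-category these transports are composites of associators, the form that
    -- `bicategory` can absorb.
    rw [show eqToHom _ = f ◁ (α_ g gᵃ fᵃ).hom ≫ (α_ f g (gᵃ ≫ fᵃ)).inv ≫
      (α_ (f ≫ g) gᵃ fᵃ).inv by simp [associator_hom_eq, associator_inv_eq],
      show eqToHom _ = (α_ (f ≫ g) gᵃ fᵃ).hom ≫ (α_ f g (gᵃ ≫ fᵃ)).hom ≫ f ◁ (α_ g gᵃ fᵃ).inv 
        by simp [associator_hom_eq, associator_inv_eq]]
    bicategory
  rw [h]
  have e : f ≫ (g ≫ gᵃ) ≫ fᵃ = (f ≫ g) ≫ (f ≫ g)ᵃ := by simp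
  rw [← Category.assoc (iota f), trB]
  refine (?_ : _ = Cell (iota (f ≫ g) ≫ eqToHom rfl ≫ y ▷ (f ≫ g)ᵃ ≫ eqToHom rfl ≫ iotaD (f ≫ g))).trans
    (Cell.vcomp_congr rfl _ (cell_iota_comp f g) (Cell.vcomp_congr rfl _ ?_ (cell_iotaD_comp f g)))
  · simp
  · rw [← cell_whiskerRight_comp]
    exact Cell.whiskerRight_congr rfl (by rw [dual₁_comp])

lemma rtr_whiskerRight {A B D : C} {f : A ⟶ B} (x : f ⟶ f) (g : B ⟶ D) :
    rtr f g (x ▷ g) = x ≫ (ρ_ f).inv ≫ f ◁ (iota g ≫ iotaD g) ≫ (ρ_ f).hom := by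
  rw [rtr]
  calc _ = (ρ_ f).inv ≫ (f ◁ iota g ≫ x ▷ (g ≫ gᵃ)) ≫ f ◁ iotaD g ≫ (ρ_ f).hom := by bicategory
    _ = _ := by rw [whisker_exchange]; bicategory

lemma rtr_whiskerLeft {A B D : C} (f : A ⟶ B) {g : B ⟶ D} (z : g ⟶ g) :
    rtr f g (f ◁ z) = (ρ_ f).inv ≫ f ◁ trB g z ≫ (ρ_ f).hom := by
  rw [rtr, trB]; bicategory

lemma cell_iota_lT (A : C) {X Y : C} (f : X ⟶ Y) : Cell (iota (A ⊳ f)) = Cell (A ⊳₂ iota f) :=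
  cell_of_heq (lT_id A X).symm (by simp) (iota_lT A f)

lemma cell_iota_rT {X Y : C} (f : X ⟶ Y) (A : C) : Cell (iota (f ⊲ A)) = Cell (iota f ⊲₂ A) :=
  cell_of_heq (rT_id X A).symm (by simp) (iota_rT f A)

lemma cell_iotaD_lT (A : C) {X Y : C} (f : X ⟶ Y) :
    Cell (iotaD (A ⊳ f)) = Cell (A ⊳₂ iotaD f) := by
  rw [iotaD, ← dual₂_lT]; exact Cell.dual_congr (cell_iota_lT A f)

lemma cell_iotaD_rT {X Y : C} (f : X ⟶ Y) (A : C) :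
    Cell (iotaD (f ⊲ A)) = Cell (iotaD f ⊲₂ A) := by
  rw [iotaD, ← dual₂_rT]; exact Cell.dual_congr (cell_iota_rT f A)

lemma cell_trB_rT {X Y : C} {f : X ⟶ Y} (x : f ⟶ f) (A : C) :
    Cell (trB (f ⊲ A) (x ⊲₂ A)) = Cell (trB f x ⊲₂ A) := by
  rw [trB, trB, rT₂_comp, rT₂_comp]
  refine Cell.comp_congr (cell_iota_rT f A) (Cell.comp_congr ?_ (cell_iotaD_rT f A))
  rw [cell_rT_whiskerRight]
  exact Cell.whiskerRight_congr rfl (by rw [dual₁_rT])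

/-- Multiplicativity of units makes `i` idempotent, and the zigzag identity of `𝟙 A` gives it a
right inverse; an idempotent with a right inverse is an identity. -/
lemma cell_iota_id (A : C) : Cell (iota (𝟙 A)) = Cell (𝟙 (𝟙 A)) := by
  have h1 : 𝟙 A ≫ (𝟙 A)ᵃ = 𝟙 A := by simp
  have h2 : (𝟙 A)ᵃ ≫ 𝟙 A = 𝟙 A := by simp
  set i : 𝟙 A ⟶ 𝟙 A := iota (𝟙 A) ≫ eqToHom h1 with hi
  set e : 𝟙 A ⟶ 𝟙 A := eqToHom h2.symm ≫ eps (𝟙 A) with he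
  have ci : Cell (iota (𝟙 A)) = Cell i := by rw [hi, cell_comp_eqToHom]
  have ce : Cell (eps (𝟙 A)) = Cell e := by rw [he, cell_eqToHom_comp]
  have hid : Arr (𝟙 A ≫ 𝟙 A) = Arr (𝟙 A) := by simp
  have hii : i = i ≫ i := by
    refine eq_of_cell (ci.symm.trans ((Cell.iota_congr hid.symm).trans
      ((cell_iota_comp _ _).trans (Cell.comp_congr ci ?_))))
    rw [cell_id_whiskerLeft, leftUnitor_inv_eq, cell_eqToHom_comp]
    refine Eq.trans ?_ ci
    exact (Cell.whiskerRight_congr rfl (by rw [dual₁_id])).trans (cell_whiskerRight_id _)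
  have hie : i ≫ e = 𝟙 _ := by
    have h : Cell _ = Cell _ := cell_of_heq (by simp) (by simp) (zigzag_left (𝟙 A))
    refine eq_of_cell (Eq.trans (Eq.symm ?_) h)
    refine cell_vcomp _ ?_ ?_
    · rw [cell_whiskerRight_id, ci]
    · rw [cell_id_whiskerLeft, ce]
  rw [ci]
  congr 1
  calc i = i ≫ i ≫ e := by rw [hie, Category.comp_id]
    _ = 𝟙 _ := by rw [← Category.assoc, ← hii, hie]

lemma cell_iotaD_id (A : C) : Cell (iotaD (𝟙 A)) = Cell (𝟙 (𝟙 A)) := by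
  refine (Cell.dual_congr (cell_iota_id A)).trans ?_
  rw [dual₂_id]

lemma trB_id {A : C} (x : 𝟙 A ⟶ 𝟙 A) : trB (𝟙 A) x = x := by
  refine eq_of_cell ?_
  refine (Cell.comp_congr (cell_iota_id A) (Cell.comp_congr (α' := x) ?_ (cell_iotaD_id A))).trans ?_
  · exact (Cell.whiskerRight_congr rfl (by rw [dual₁_id])).trans (cell_whiskerRight_id x)
  · simp

/-- Cap, right trace and cup together form a single loop, so cyclicity and strandwise closing become
available for the pairing. -/
lemma pairing₀_eq {A B : C} {f g : A ⟶ B} (α : f ⟶ g) (β : g ⟶ f) :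
    pairing₀ α β = trB (coev A ≫ f ⊲ Aᵛ) (coev A ◁ ((α ≫ β) ⊲₂ Aᵛ)) := by
  refine eq_of_cell ?_
  rw [pairing₀, trB]
  refine Cell.comp_congr ?_ (Cell.comp_congr ?_ ?_)
  · rw [capR, vcomp]; simp
  · rw [TrR₂]
    refine Eq.trans ?_ (cell_whisker_assoc _ _ _).symm
    refine Cell.whiskerLeft_congr rfl ?_
    refine (Cell.whiskerRight_congr (cell_rT_whiskerRight _ _ _) rfl).trans ?_
    rw [← cell_whiskerRight_comp]
    refine Cell.whiskerRight_congr rfl ?_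
    simp
  · rw [cupR, vcomp]; simp

end Duals

/-! ### Scalar objects and splittings in linear categories -/

section LinearCategory

variable (F : Type*) [Field F] {H : Type*} [Category H] [Preadditive H] [Linear F H]

/-- The endomorphism ring of `s` is `F`. -/
def EndScalar (s : H) : Prop := ∀ φ : s ⟶ s, ∃! r : F, φ = r • 𝟙 s

variable {F}

lemma EndScalar.id_ne_zero {s : H} (h : EndScalar F s) : 𝟙 s ≠ 0 := by
  intro h0
  obtain ⟨r, -, hr⟩ := h 0
  have h1 := hr 0 (by simp)
  have h2 := hr 1 (by simp [h0])
  exact one_ne_zero (h2.trans h1.symm)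

lemma EndScalar.exists_smul {s : H} (h : EndScalar F s) (φ : s ⟶ s) : ∃ r : F, φ = r • 𝟙 s :=
  (h φ).exists

lemma EndScalar.of {s : H} (h : ∀ φ : s ⟶ s, ∃ r : F, φ = r • 𝟙 s) (h0 : 𝟙 s ≠ 0) :
    EndScalar F s := by
  intro φ
  obtain ⟨r, hr⟩ := h φ
  refine ⟨r, hr, fun r' hr' => ?_⟩
  have : (r' - r) • 𝟙 s = 0 := by rw [sub_smul, ← hr, ← hr', sub_self]
  rcases smul_eq_zero.1 this with h | h
  · exact sub_eq_zero.1 h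
  · exact absurd h h0

/-- Evaluating `a ≫ b ≫ a` in two ways shows that `a ≫ b` and `b ≫ a` are the same non-zero scalar.
-/
lemma EndScalar.iso {s t : H} (hs : EndScalar F s) (ht : EndScalar F t) {a : s ⟶ t} {b : t ⟶ s}
    (h : a ≫ b ≠ 0) : ∃ e : s ≅ t, e.hom = a := by
  obtain ⟨r, hr⟩ := hs.exists_smul (a ≫ b)
  obtain ⟨r', hr'⟩ := ht.exists_smul (b ≫ a)
  have hr0 : r ≠ 0 := by rintro rfl; exact h (by simpa using hr)
  have e : r • a = r' • a := by
    calc r • a = (a ≫ b) ≫ a := by rw [hr]; simp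
      _ = a ≫ (b ≫ a) := Category.assoc ..
      _ = r' • a := by rw [hr']; simp
  have ha : a ≠ 0 := by rintro rfl; simp at h
  have hrr : r = r' := by
    have : (r - r') • a = 0 := by rw [sub_smul, e, sub_self]
    rcases smul_eq_zero.1 this with h | h
    · exact sub_eq_zero.1 h
    · exact absurd h ha
  refine ⟨⟨a, r⁻¹ • b, ?_, ?_⟩, rfl⟩
  · rw [Linear.comp_smul, hr, smul_smul, inv_mul_cancel₀ hr0, one_smul]
  · rw [Linear.smul_comp, hr', ← hrr, smul_smul, inv_mul_cancel₀ hr0, one_smul]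

lemma EndScalar.of_iso {s t : H} (hs : EndScalar F s) (e : s ≅ t) : EndScalar F t := by
  refine EndScalar.of (fun φ => ?_) (fun h0 => hs.id_ne_zero ?_)
  · obtain ⟨r, hr⟩ := hs.exists_smul (e.hom ≫ φ ≫ e.inv)
    refine ⟨r, ?_⟩
    calc φ = e.inv ≫ (e.hom ≫ φ ≫ e.inv) ≫ e.hom := by simp
      _ = _ := by rw [hr]; simp
  · calc 𝟙 s = e.hom ≫ 𝟙 t ≫ e.inv := by simp
      _ = 0 := by rw [h0]; simp

/-- The identity of `u` is a sum of morphisms factoring through members of the family `s`. -/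
def SplitsThrough {ι : Type*} (s : ι → H) (u : H) : Prop :=
  ∃ (n : ℕ) (k : Fin n → ι) (a : ∀ j, u ⟶ s (k j)) (b : ∀ j, s (k j) ⟶ u), ∑ j, a j ≫ b j = 𝟙 u

lemma IsBasis.endScalar {ι : Type*} {s : ι → H} (h : IsBasis F s) (i : ι) : EndScalar F (s i) :=
  h.1 i

lemma IsBasis.splits {ι : Type*} {s : ι → H} (h : IsBasis F s) (u : H) : SplitsThrough s u := by
  obtain ⟨n, k, b, rfl, ⟨hb⟩⟩ := h.2.2 u
  refine ⟨n, k, fun j => b.π j, fun j => b.ι j, ?_⟩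
  exact Limits.IsBilimit.total hb

lemma SplitsThrough.id_eq_zero {ι : Type*} {s : ι → H} {u : H} (h : SplitsThrough s u)
    (h0 : ∀ i (a : u ⟶ s i), a = 0) : 𝟙 u = 0 := by
  obtain ⟨n, k, a, b, hab⟩ := h
  rw [← hab]
  exact Finset.sum_eq_zero fun j _ => by rw [h0 _ (a j), Limits.zero_comp]

lemma SplitsThrough.exists_ne_zero {ι : Type*} {s : ι → H} {u : H} (h : SplitsThrough s u)
    (h0 : 𝟙 u ≠ 0) : ∃ (i : ι) (a : u ⟶ s i) (b : s i ⟶ u), a ≫ b ≠ 0 := by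
  obtain ⟨n, k, a, b, hab⟩ := h
  rw [← hab] at h0
  obtain ⟨j, -, hj⟩ := Finset.exists_ne_zero_of_sum_ne_zero h0
  exact ⟨k j, a j, b j, hj⟩

lemma SplitsThrough.exists_iso {ι : Type*} {s : ι → H} {u : H} (h : SplitsThrough s u)
    (hs : ∀ i, EndScalar F (s i)) (hu : EndScalar F u) : ∃ i, Nonempty (u ≅ s i) := by
  obtain ⟨i, a, b, hab⟩ := h.exists_ne_zero hu.id_ne_zero
  exact ⟨i, ⟨(hu.iso (hs i) hab).choose⟩⟩

lemma IsBasis.eq_of_iso {ι : Type*} {s : ι → H} (h : IsBasis F s) {i j : ι} (e : s i ≅ s j) :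
    i = j := by
  by_contra hij
  have := h.2.1 i j hij e.hom
  refine (h.endScalar i).id_ne_zero ?_
  rw [← e.hom_inv_id, this, Limits.zero_comp]

/-- Each member of one basis is isomorphic to a member of the other, and different members to
different ones. The rank of a 2-vector space is thus well defined. -/
lemma IsBasis.card_le {ι κ : Type*} [Fintype ι] [Fintype κ] {s : ι → H} {t : κ → H}
    (hs : IsBasis F s) (ht : IsBasis F t) : Fintype.card ι ≤ Fintype.card κ := by
  choose f hf using fun i => (ht.splits (s i)).exists_iso ht.endScalar (hs.endScalar i)
  refine Fintype.card_le_of_injective f fun i j hij => ?_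
  obtain ⟨e⟩ := hf i
  obtain ⟨e'⟩ := hf j
  exact hs.eq_of_iso (e ≪≫ eqToIso (by rw [hij]) ≪≫ e'.symm)

lemma IsBasis.card_eq {ι κ : Type*} [Fintype ι] [Fintype κ] {s : ι → H} {t : κ → H}
    (hs : IsBasis F s) (ht : IsBasis F t) : Fintype.card ι = Fintype.card κ :=
  le_antisymm (hs.card_le ht) (ht.card_le hs)

end LinearCategory

/-! ### Mates, and 1-morphisms whose unit is unitary up to a scalar -/

section VectLin

variable (F : Type*) [Field F] {C : Type u} [Bicategory.{w, v} C] [Bicategory.Strict C]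
  [SemiStrictMonoidal C] [∀ A B : C, Preadditive (A ⟶ B)] [∀ A B : C, Linear F (A ⟶ B)]
  [VectLinear F C]

include F in
lemma whiskerLeft_zero' {A B D : C} (f : A ⟶ B) (g h : B ⟶ D) : f ◁ (0 : g ⟶ h) = 0 := by
  simpa using VectLinear.whiskerLeft_smul (F := F) f (0 : F) (0 : g ⟶ h)

include F in
lemma zero_whiskerRight' {A B D : C} (f g : A ⟶ B) (h : B ⟶ D) : (0 : f ⟶ g) ▷ h = 0 := by
  simpa using VectLinear.whiskerRight_smul (F := F) (0 : F) (0 : f ⟶ g) h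

include F in
lemma whiskerLeft_sum' {A B D : C} (f : A ⟶ B) {g h : B ⟶ D} {ι : Type*} (s : Finset ι)
    (α : ι → (g ⟶ h)) : f ◁ ∑ i ∈ s, α i = ∑ i ∈ s, f ◁ α i :=
  map_sum (AddMonoidHom.mk' (fun x : g ⟶ h => f ◁ x)
    (VectLinear.whiskerLeft_add (F := F) f)) α s

include F in
lemma sum_whiskerRight' {A B D : C} {f g : A ⟶ B} {ι : Type*} (s : Finset ι)
    (α : ι → (f ⟶ g)) (h : B ⟶ D) : (∑ i ∈ s, α i) ▷ h = ∑ i ∈ s, α i ▷ h :=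
  map_sum (AddMonoidHom.mk' (fun x : f ⟶ g => x ▷ h)
    (fun x y => VectLinear.whiskerRight_add (F := F) x y h)) α s

include F in
lemma lT_zero' (A : C) {X Y : C} (f g : X ⟶ Y) : A ⊳₂ (0 : f ⟶ g) = 0 := by
  simpa using VectLinear.lT₂_smul (F := F) A (0 : F) (0 : f ⟶ g)

include F in
lemma zero_rT' {X Y : C} (f g : X ⟶ Y) (A : C) : (0 : f ⟶ g) ⊲₂ A = 0 := by
  simpa using VectLinear.rT₂_smul (F := F) (0 : F) (0 : f ⟶ g) A

include F in
lemma lT_sum' (A : C) {X Y : C} {f g : X ⟶ Y} {ι : Type*} (s : Finset ι)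
    (α : ι → (f ⟶ g)) : A ⊳₂ ∑ i ∈ s, α i = ∑ i ∈ s, A ⊳₂ α i :=
  map_sum (AddMonoidHom.mk' (fun x : f ⟶ g => A ⊳₂ x)
    (VectLinear.lT₂_add (F := F) A)) α s

variable {F}

lemma Cell.smul_congr {A B A' B' : C} {f g : A ⟶ B} {f' g' : A' ⟶ B'} {α : f ⟶ g} {α' : f' ⟶ g'}
    (r : F) (h : Cell α = Cell α') : Cell (r • α) = Cell (r • α') := by
  cases h; rfl

lemma whiskerLeft_smul_id {A B D : C} (f : A ⟶ B) (g : B ⟶ D) (r : F) :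
    f ◁ (r • 𝟙 g) = r • 𝟙 (f ≫ g) := by
  rw [VectLinear.whiskerLeft_smul, whiskerLeft_id]

lemma smul_id_whiskerRight {A B D : C} (f : A ⟶ B) (g : B ⟶ D) (r : F) :
    (r • 𝟙 f) ▷ g = r • 𝟙 (f ≫ g) := by
  rw [VectLinear.whiskerRight_smul, id_whiskerRight]

variable [DualStructure C] [HasDuals C]
open HasDuals

/-- The witness is the transpose of `a` under `l ⊣ r`; the left triangle identity recovers `a` from
it. -/
lemma exists_eq_counit {Y B : C} {f r : Y ⟶ B} {l : B ⟶ Y} (ad : l ⊣ r) (a : f ≫ l ⟶ 𝟙 Y) :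
    ∃ a' : f ⟶ r, a = a' ▷ l ≫ ad.counit := by
  refine ⟨(ρ_ f).inv ≫ f ◁ ad.unit ≫ (α_ _ _ _).inv ≫ a ▷ r ≫ (λ_ r).hom, ?_⟩
  have h := ad.left_triangle
  simp only [leftZigzag] at h
  symm
  calc _ = 𝟙 _ ⊗≫ f ◁ (ad.unit ▷ l) ⊗≫ (a ▷ (r ≫ l) ≫ 𝟙 Y ◁ ad.counit) ⊗≫ 𝟙 _ := by bicategory
    _ = 𝟙 _ ⊗≫ f ◁ (ad.unit ▷ l) ⊗≫ ((f ≫ l) ◁ ad.counit ≫ a ▷ 𝟙 Y) ⊗≫ 𝟙 _ := by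
      rw [whisker_exchange]
    _ = 𝟙 _ ⊗≫ f ◁ (ad.unit ▷ l ⊗≫ l ◁ ad.counit) ⊗≫ a ⊗≫ 𝟙 _ := by bicategory
    _ = _ := by rw [h]; bicategory

lemma exists_eq_iotaD {Y B : C} {f g : Y ⟶ B} (a : f ≫ gᵃ ⟶ 𝟙 Y) :
    ∃ a' : f ⟶ g, a = a' ▷ gᵃ ≫ iotaD g := exists_eq_counit (adjD g) a

lemma exists_eq_epsD {Y B : C} {f : B ⟶ Y} {g : Y ⟶ B} (b : 𝟙 B ⟶ f ≫ g) :
    ∃ b' : gᵃ ⟶ f, b = epsD g ≫ b' ▷ g := by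
  obtain ⟨a, ha⟩ := exists_eq_counit (adj g) (dual₂ b)
  refine ⟨dual₂ a, dual₂_inj ?_⟩
  rw [ha, dual₂_comp, dual₂_whiskerRight, dual₂_dual₂, dual₂_dual₂]
  rfl

lemma exists_eq_iota {Y B : C} {f g : Y ⟶ B} (b : 𝟙 Y ⟶ f ≫ gᵃ) :
    ∃ b' : g ⟶ f, b = iota g ≫ b' ▷ gᵃ := by
  obtain ⟨a, ha⟩ := exists_eq_iotaD (dual₂ b)
  refine ⟨dual₂ a, dual₂_inj ?_⟩
  rw [ha, dual₂_comp, dual₂_whiskerRight, dual₂_dual₂]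

variable (F) in
/-- `1_Y` has scalar endomorphisms and every endomorphism of `Y` is a sum of copies of `1_Y`. -/
structure UnitSplit (Y : C) : Prop where
  scalar : EndScalar F (𝟙 Y)
  split (u : Y ⟶ Y) : SplitsThrough (fun _ : Unit => 𝟙 Y) u

variable (F) in
/-- The composite of the unit of `h` and its dual is `c`. -/
def NormIota {A B : C} (h : A ⟶ B) (c : F) : Prop := iota h ≫ iotaD h = c • 𝟙 (𝟙 A)

variable (F) in
/-- The unit of `h` is, up to the factor `c`, unitary. -/
structure Coiso {A B : C} (h : A ⟶ B) (c : F) : Prop where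
  ne_zero : c ≠ 0
  norm : NormIota F h c
  conorm : iotaD h ≫ iota h = c • 𝟙 (h ≫ hᵃ)

/-- The identity of `f ≫ gᵃ` splits through copies of `𝟙 Y`, and a cell `f ≫ gᵃ ⟶ 𝟙 Y` is the mate
of a cell `f ⟶ g`. -/
lemma id_comp_dual_eq_zero {Y B : C} (hY : UnitSplit F Y) {f g : Y ⟶ B}
    (h : ∀ a : f ⟶ g, a = 0) : 𝟙 (f ≫ gᵃ) = 0 := by
  refine (hY.split _).id_eq_zero fun _ a => ?_
  obtain ⟨a', rfl⟩ := exists_eq_iotaD a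
  rw [h a', zero_whiskerRight' F, Limits.zero_comp]

-- If `f ≫ fᵃ` is zero then `iota f` vanishes, and the zigzag identity kills `𝟙 f`.
variable (F) in
include F in
lemma id_eq_zero_of_comp_dual {Y B : C} (f : Y ⟶ B) (h : 𝟙 (f ≫ fᵃ) = 0) : 𝟙 f = 0 := by
  have h1 : iota f = 0 := by rw [← Category.comp_id (iota f), h, Limits.comp_zero]
  have h2 := zigzag_left' f
  rw [h1, zero_whiskerRight' F, Limits.zero_comp] at h2
  calc 𝟙 f = (λ_ f).inv ≫ ((λ_ f).hom ≫ (ρ_ f).inv) ≫ (ρ_ f).hom := by simp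
    _ = 0 := by rw [← h2]; simp

/-- Cells between `g ≫ gᵃ` and `𝟙 Y` are mates of endomorphisms of `g`, hence multiples of `iotaD g`
and `iota g`. Since `g ≫ gᵃ` splits through copies of `𝟙 Y`, its identity is a multiple of `iotaD g
≫ iota g`. -/
lemma exists_coiso {Y B : C} (hY : UnitSplit F Y) {g : Y ⟶ B} (hg : EndScalar F g) :
    ∃ c : F, Coiso F g c := by
  obtain ⟨c, hc⟩ := hY.scalar.exists_smul (iota g ≫ iotaD g)
  have h0 : 𝟙 (g ≫ gᵃ) ≠ 0 := fun h => hg.id_ne_zero (id_eq_zero_of_comp_dual F g h)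
  obtain ⟨r, hr⟩ : ∃ r : F, 𝟙 (g ≫ gᵃ) = r • (iotaD g ≫ iota g) := by
    obtain ⟨n, k, a, b, hab⟩ := hY.split (g ≫ gᵃ)
    have ha : ∀ j, ∃ s : F, a j = s • iotaD g := fun j => by
      obtain ⟨a', ha'⟩ := exists_eq_iotaD (a j)
      obtain ⟨s, rfl⟩ := hg.exists_smul a'
      exact ⟨s, by rw [ha', smul_id_whiskerRight, Linear.smul_comp, Category.id_comp]⟩
    have hb : ∀ j, ∃ s : F, b j = s • iota g := fun j => by
      obtain ⟨a', ha'⟩ := exists_eq_iota (b j)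
      obtain ⟨s, rfl⟩ := hg.exists_smul a'
      exact ⟨s, by rw [ha', smul_id_whiskerRight, Linear.comp_smul, Category.comp_id]⟩
    choose s hs using ha
    choose t ht using hb
    refine ⟨∑ j, t j * s j, ?_⟩
    rw [← hab, Finset.sum_smul]
    refine Finset.sum_congr rfl fun j _ => ?_
    rw [hs, ht, Linear.smul_comp, Linear.comp_smul, smul_smul, mul_comm]
  -- `iotaD g ≫ iota g` squares to `c` times itself, while `r` times it is the identity; this forces
  -- `r * c = 1`.
  have hrc : (r * c) • (iotaD g ≫ iota g) = iotaD g ≫ iota g := by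
    calc _ = r • (iotaD g ≫ (iota g ≫ iotaD g) ≫ iota g) := by
            rw [hc]; simp [smul_smul]
      _ = (r • (iotaD g ≫ iota g)) ≫ (iotaD g ≫ iota g) := by simp
      _ = _ := by rw [← hr, Category.id_comp]
  have hne : iotaD g ≫ iota g ≠ 0 := fun h => h0 (by rw [hr, h, smul_zero])
  have hrc1 : r * c = 1 := by
    have : (r * c - 1) • (iotaD g ≫ iota g) = 0 := by rw [sub_smul, hrc, one_smul, sub_self]
    rcases smul_eq_zero.1 this with h | h
    · exact sub_eq_zero.1 h
    · exact absurd h hne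
  refine ⟨c, right_ne_zero_of_mul_eq_one hrc1, hc, ?_⟩
  rw [hr, smul_smul, mul_comm, hrc1, one_smul]

lemma Coiso.whiskerLeft_eps {Y B : C} {h : Y ⟶ B} {c : F} (hc : Coiso F h c) :
    c • (h ◁ eps h) = (α_ _ _ _).inv ≫ iotaD h ▷ h ≫ (λ_ h).hom ≫ (ρ_ h).inv := by
  rw [← zigzag_left', ← comp_whiskerRight_assoc, hc.conorm, smul_id_whiskerRight]
  simp

/-- Whiskering by `h` is full: the preimage is the partial trace of `θ` over `h`, divided by the
value `c` of a loop of `h`. -/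
lemma Coiso.exists_whiskerRight {A Y B : C} {h : Y ⟶ B} {c : F} (hc : Coiso F h c)
    {f f' : A ⟶ Y} (θ : f ≫ h ⟶ f' ≫ h) : ∃ θ' : f ⟶ f', θ = θ' ▷ h := by
  have e : f' ◁ (iotaD h ▷ h) = c • (f' ◁ ((α_ _ _ _).hom ≫ h ◁ eps h ≫ (ρ_ h).hom ≫ (λ_ h).inv)) := by
    rw [← VectLinear.whiskerLeft_smul, ← Linear.comp_smul, ← Linear.smul_comp, hc.whiskerLeft_eps]
    simp
  refine ⟨c⁻¹ • ((ρ_ f).inv ≫ f ◁ iota h ≫ (α_ _ _ _).inv ≫ θ ▷ hᵃ ≫ (α_ _ _ _).hom ≫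
    f' ◁ iotaD h ≫ (ρ_ f').hom), ?_⟩
  symm
  calc _ = c⁻¹ • (((ρ_ f).inv ≫ f ◁ iota h ≫ (α_ _ _ _).inv ≫ θ ▷ hᵃ ≫ (α_ _ _ _).hom) ▷ h ≫
        (α_ _ _ _).hom ≫ f' ◁ (iotaD h ▷ h) ≫ f' ◁ (λ_ h).hom) := by
        rw [VectLinear.whiskerRight_smul]; congr 1; bicategory
    _ = ((ρ_ f).inv ≫ f ◁ iota h ≫ (α_ _ _ _).inv ≫ θ ▷ hᵃ ≫ (α_ _ _ _).hom) ▷ h ≫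
        (α_ _ _ _).hom ≫ f' ◁ ((α_ _ _ _).hom ≫ h ◁ eps h ≫ (ρ_ h).hom ≫ (λ_ h).inv) ≫
          f' ◁ (λ_ h).hom := by
        rw [e]; simp only [Linear.smul_comp, Linear.comp_smul, smul_smul,
          inv_mul_cancel₀ hc.ne_zero, one_smul]
    _ = 𝟙 _ ⊗≫ f ◁ (iota h ▷ h) ⊗≫ (θ ▷ (hᵃ ≫ h) ≫ (f' ≫ h) ◁ eps h) ⊗≫ 𝟙 _ := by bicategory
    _ = 𝟙 _ ⊗≫ f ◁ (iota h ▷ h) ⊗≫ ((f ≫ h) ◁ eps h ≫ θ ▷ 𝟙 _) ⊗≫ 𝟙 _ := by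
        rw [whisker_exchange]
    _ = 𝟙 _ ⊗≫ f ◁ (iota h ▷ h ≫ (α_ _ _ _).hom ≫ h ◁ eps h) ⊗≫ θ ⊗≫ 𝟙 _ := by bicategory
    _ = θ := by rw [zigzag_left']; bicategory

lemma Coiso.id_eq_zero {A Y B : C} {h : Y ⟶ B} {c : F} (hc : Coiso F h c)
    {f : A ⟶ Y} (h0 : 𝟙 (f ≫ h) = 0) : 𝟙 f = 0 := by
  have h1 : c • 𝟙 (f ≫ 𝟙 Y) = 0 := by
    calc c • 𝟙 (f ≫ 𝟙 Y) = f ◁ (iota h ≫ iotaD h) := by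
          rw [hc.norm, whiskerLeft_smul_id]
      _ = f ◁ iota h ≫ (α_ _ _ _).inv ≫ 𝟙 (f ≫ h) ▷ hᵃ ≫ (α_ _ _ _).hom ≫ f ◁ iotaD h := by simp
      _ = 0 := by rw [h0, zero_whiskerRight' F]; simp
  have h2 := (smul_eq_zero.1 h1).resolve_left hc.ne_zero
  calc 𝟙 f = (ρ_ f).inv ≫ 𝟙 (f ≫ 𝟙 Y) ≫ (ρ_ f).hom := by simp
    _ = 0 := by rw [h2]; simp

/-- Whiskering by `h` is full and kills no identity except that of a zero 1-morphism. -/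
lemma Coiso.endScalar_comp {A Y B : C} {h : Y ⟶ B} {c : F} (hc : Coiso F h c)
    {f : A ⟶ Y} (hf : EndScalar F f) : EndScalar F (f ≫ h) := by
  refine EndScalar.of (fun θ => ?_) fun h0 => hf.id_ne_zero (hc.id_eq_zero h0)
  obtain ⟨θ', rfl⟩ := hc.exists_whiskerRight θ
  obtain ⟨r, rfl⟩ := hf.exists_smul θ'
  exact ⟨r, smul_id_whiskerRight ..⟩

lemma Coiso.hom_eq_zero {A Y B : C} {h : Y ⟶ B} {c : F} (hc : Coiso F h c)
    {f f' : A ⟶ Y} (h0 : ∀ a : f ⟶ f', a = 0) (θ : f ≫ h ⟶ f' ≫ h) : θ = 0 := by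
  obtain ⟨θ', rfl⟩ := hc.exists_whiskerRight θ
  rw [h0 θ', zero_whiskerRight' F]

-- By the zigzag identity of `h` the cell `θ` factors through `f' ≫ h' ≫ hᵃ ≫ h`, which is zero.
variable (F) in
include F in
lemma hom_eq_zero_of_comp_dual {A Y Y' B : C} {h : Y ⟶ B} {h' : Y' ⟶ B} (h0 : 𝟙 (h' ≫ hᵃ) = 0)
    {f : A ⟶ Y} {f' : A ⟶ Y'} (θ : f ≫ h ⟶ f' ≫ h') : θ = 0 := by
  have e : (h' ≫ hᵃ) ◁ 𝟙 h = 0 := by rw [whiskerLeft_id, ← id_whiskerRight, h0, zero_whiskerRight' F]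
  symm
  calc 0 = 𝟙 _ ⊗≫ f ◁ (iota h ▷ h) ⊗≫ θ ▷ (hᵃ ≫ h) ⊗≫ f' ◁ ((h' ≫ hᵃ) ◁ 𝟙 h) ⊗≫
      (f' ≫ h') ◁ eps h ⊗≫ 𝟙 _ := by
        rw [e, whiskerLeft_zero' F]; simp [bicategoricalComp]
    _ = 𝟙 _ ⊗≫ f ◁ (iota h ▷ h) ⊗≫ (θ ▷ (hᵃ ≫ h) ≫ (f' ≫ h') ◁ eps h) ⊗≫ 𝟙 _ := by bicategory
    _ = 𝟙 _ ⊗≫ f ◁ (iota h ▷ h) ⊗≫ ((f ≫ h) ◁ eps h ≫ θ ▷ 𝟙 _) ⊗≫ 𝟙 _ := by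
        rw [whisker_exchange]
    _ = 𝟙 _ ⊗≫ f ◁ (iota h ▷ h ≫ (α_ _ _ _).hom ≫ h ◁ eps h) ⊗≫ θ ⊗≫ 𝟙 _ := by bicategory
    _ = θ := by rw [zigzag_left']; bicategory

/-! ### Stability of the unit conditions -/

lemma NormIota.congr {A B A' B' : C} {h : A ⟶ B} {h' : A' ⟶ B'} {c : F} (e : Arr h = Arr h')
    (hc : NormIota F h c) : NormIota F h' c := by
  cases e; exact hc

lemma Coiso.congr {A B A' B' : C} {h : A ⟶ B} {h' : A' ⟶ B'} {c : F} (e : Arr h = Arr h')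
    (hc : Coiso F h c) : Coiso F h' c := by
  cases e; exact hc

lemma NormIota.lT {X Y : C} {h : X ⟶ Y} {c : F} (hc : NormIota F h c) (A : C) :
    NormIota F (A ⊳ h) c := by
  refine eq_of_cell ((Cell.comp_congr (cell_iota_lT A h) (cell_iotaD_lT A h)).trans ?_)
  rw [← lT₂_comp, hc, VectLinear.lT₂_smul, lT₂_id]
  exact Cell.smul_congr c (Cell.id_congr (by rw [lT_id]))

lemma NormIota.rT {X Y : C} {h : X ⟶ Y} {c : F} (hc : NormIota F h c) (A : C) :
    NormIota F (h ⊲ A) c := by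
  refine eq_of_cell ((Cell.comp_congr (cell_iota_rT h A) (cell_iotaD_rT h A)).trans ?_)
  rw [← rT₂_comp, hc, VectLinear.rT₂_smul, rT₂_id]
  exact Cell.smul_congr c (Cell.id_congr (by rw [rT_id]))

lemma Coiso.lT {X Y : C} {h : X ⟶ Y} {c : F} (hc : Coiso F h c) (A : C) :
    Coiso F (A ⊳ h) c := by
  refine ⟨hc.ne_zero, hc.norm.lT A, ?_⟩
  refine eq_of_cell ((Cell.comp_congr (cell_iotaD_lT A h) (cell_iota_lT A h)).trans ?_)
  rw [← lT₂_comp, hc.conorm, VectLinear.lT₂_smul, lT₂_id]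
  exact Cell.smul_congr c (Cell.id_congr (by simp))

lemma Coiso.rT {X Y : C} {h : X ⟶ Y} {c : F} (hc : Coiso F h c) (A : C) :
    Coiso F (h ⊲ A) c := by
  refine ⟨hc.ne_zero, hc.norm.rT A, ?_⟩
  refine eq_of_cell ((Cell.comp_congr (cell_iotaD_rT h A) (cell_iota_rT h A)).trans ?_)
  rw [← rT₂_comp, hc.conorm, VectLinear.rT₂_smul, rT₂_id]
  exact Cell.smul_congr c (Cell.id_congr (by simp))

lemma trB_smul {A B : C} (f : A ⟶ B) (r : F) (x : f ⟶ f) : trB f (r • x) = r • trB f x := by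
  simp only [trB, VectLinear.whiskerRight_smul, Linear.smul_comp, Linear.comp_smul]

lemma normIota_iff {A B : C} {h : A ⟶ B} {c : F} :
    NormIota F h c ↔ trB h (𝟙 h) = c • 𝟙 (𝟙 A) := by
  rw [trB, id_whiskerRight, Category.id_comp]; rfl

/-- The inner loop of `g` encloses nothing and contributes its value `d`. -/
lemma NormIota.trB_whiskerRight {A B D : C} {g : B ⟶ D} {d : F} (hg : NormIota F g d)
    {f : A ⟶ B} (x : f ⟶ f) : trB (f ≫ g) (x ▷ g) = d • trB f x := by
  have hg' : iota g ≫ iotaD g = d • 𝟙 (𝟙 B) := hg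
  rw [trB_comp, rtr_whiskerRight, hg', whiskerLeft_smul_id, ← trB_smul]
  simp

lemma NormIota.comp {A B D : C} {f : A ⟶ B} {g : B ⟶ D} {c d : F} (hf : NormIota F f c)
    (hg : NormIota F g d) : NormIota F (f ≫ g) (c * d) := by
  rw [normIota_iff] at hf ⊢
  rw [← id_whiskerRight, hg.trB_whiskerRight, hf, smul_smul, mul_comm]

lemma Coiso.comp {A B D : C} {f : A ⟶ B} {g : B ⟶ D} {c d : F} (hf : Coiso F f c)
    (hg : Coiso F g d) : Coiso F (f ≫ g) (c * d) := by
  refine ⟨mul_ne_zero hf.ne_zero hg.ne_zero, hf.norm.comp hg.norm, ?_⟩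
  refine eq_of_cell ((Cell.comp_congr (cell_iotaD_comp f g) (cell_iota_comp f g)).trans ?_)
  have e : (f ◁ (iotaD g ▷ fᵃ ≫ (λ_ fᵃ).hom) ≫ iotaD f) ≫ iota f ≫ f ◁ ((λ_ fᵃ).inv ≫ iota g ▷ fᵃ) =
      (c * d) • 𝟙 (f ≫ (g ≫ gᵃ) ≫ fᵃ) := by
    calc _ = f ◁ (iotaD g ▷ fᵃ ≫ (λ_ fᵃ).hom) ≫ (iotaD f ≫ iota f) ≫
          f ◁ ((λ_ fᵃ).inv ≫ iota g ▷ fᵃ) := by simp only [Category.assoc]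
      _ = c • (f ◁ ((iotaD g ≫ iota g) ▷ fᵃ)) := by
        rw [hf.conorm]; simp [← whiskerLeft_comp]
      _ = _ := by rw [hg.conorm, smul_id_whiskerRight, whiskerLeft_smul_id, smul_smul]
  rw [e]
  exact Cell.smul_congr _ (Cell.id_congr (by simp))

end VectLin

section LinearCategory

variable {F : Type*} [Field F] {H : Type*} [Category H] [Preadditive H] [Linear F H]

lemma SplitsThrough.of_iso {ι κ : Type*} {s : ι → H} {t : κ → H} {u : H}
    (h : SplitsThrough s u) (e : ∀ i, ∃ j, Nonempty (s i ≅ t j)) : SplitsThrough t u := by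
  obtain ⟨n, k, a, b, hab⟩ := h
  choose f hf using e
  refine ⟨n, fun j => f (k j), fun j => a j ≫ (hf (k j)).some.hom,
    fun j => (hf (k j)).some.inv ≫ b j, ?_⟩
  simpa using hab

lemma SplitsThrough.congr_iso {ι : Type*} {s : ι → H} {u v : H}
    (h : SplitsThrough s u) (e : u ≅ v) : SplitsThrough s v := by
  obtain ⟨n, k, a, b, hab⟩ := h
  refine ⟨n, k, fun j => e.inv ≫ a j, fun j => b j ≫ e.hom, ?_⟩
  calc _ = e.inv ≫ (∑ j, a j ≫ b j) ≫ e.hom := by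
        simp [Preadditive.sum_comp, Preadditive.comp_sum]
    _ = _ := by rw [hab]; simp

/-- A retract of an object with scalar endomorphisms is isomorphic to it or zero. -/
lemma EndScalar.retract_iso {s u : H} (hs : EndScalar F s) {a : u ⟶ s} {b : s ⟶ u}
    (hab : a ≫ b = 𝟙 u) (hu : 𝟙 u ≠ 0) : Nonempty (u ≅ s) := by
  obtain ⟨r, hr⟩ := hs.exists_smul (b ≫ a)
  have hb : b ≠ 0 := by rintro rfl; exact hu (by simpa using hab.symm)
  have h1 : r • b = b := by
    calc r • b = (b ≫ a) ≫ b := by rw [hr]; simp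
      _ = b := by rw [Category.assoc, hab, Category.comp_id]
  have hr1 : r = 1 := by
    have : (r - 1) • b = 0 := by rw [sub_smul, h1, one_smul, sub_self]
    rcases smul_eq_zero.1 this with h | h
    · exact sub_eq_zero.1 h
    · exact absurd h hb
  exact ⟨⟨a, b, hab, by rw [hr, hr1, one_smul]⟩⟩

end LinearCategory

/-! ### Rank counts: the 1-morphisms between members of `ℰ` -/

section Structure

variable {F : Type*} [Field F] {C : Type u} [Bicategory.{w, v} C] [Bicategory.Strict C]
  [SemiStrictMonoidal C] [∀ A B : C, Preadditive (A ⟶ B)] [∀ A B : C, Linear F (A ⟶ B)]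
  [VectLinear F C]

/-- Since `s ≫ s ≅ s`, whiskering by `s` turns the cells of a splitting of `𝟙 X` through `s` into
numbers. The matrix of the products `b i ≫ a j` therefore has rank one, all `a j` are multiples of
one cell, and `𝟙 X` is a retract of `s`. -/
lemma unit_iso {X : C} {s : X ⟶ X} (hs : EndScalar F s) (θ : s ≫ s ≅ s)
    (h : SplitsThrough (fun _ : Unit => s) (𝟙 X)) : Nonempty (𝟙 X ≅ s) := by
  have h1 : 𝟙 (𝟙 X) ≠ 0 := fun h0 => hs.id_ne_zero (by
    calc 𝟙 s = (ρ_ s).inv ≫ s ◁ 𝟙 (𝟙 X) ≫ (ρ_ s).hom := by simp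
      _ = 0 := by rw [h0, whiskerLeft_zero' F]; simp)
  have h2 : 𝟙 (s ≫ s) ≠ 0 := (hs.of_iso θ.symm).id_ne_zero
  obtain ⟨n, k, a, b, hab⟩ := h
  choose x hx using fun j => hs.exists_smul ((ρ_ s).inv ≫ s ◁ a j ≫ θ.hom)
  choose y hy using fun j => hs.exists_smul (θ.inv ≫ s ◁ b j ≫ (ρ_ s).hom)
  choose r hr using fun i j => hs.exists_smul (b i ≫ a j)
  have hrxy : ∀ i j, r i j = y i * x j := fun i j => by
    have e1 : s ◁ (b i ≫ a j) = r i j • 𝟙 (s ≫ s) := by rw [hr, whiskerLeft_smul_id]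
    have e2 : s ◁ (b i ≫ a j) = (y i * x j) • 𝟙 (s ≫ s) := by
      calc _ = θ.hom ≫ (θ.inv ≫ s ◁ b i ≫ (ρ_ s).hom) ≫ ((ρ_ s).inv ≫ s ◁ a j ≫ θ.hom) ≫ θ.inv := by
            simp
        _ = _ := by rw [hx, hy]; simp [smul_smul, mul_comm]
    have : (r i j - y i * x j) • 𝟙 (s ≫ s) = 0 := by rw [sub_smul, ← e1, ← e2, sub_self]
    rcases smul_eq_zero.1 this with h | h
    · exact sub_eq_zero.1 h
    · exact absurd h h2
  -- Inserting the splitting in front of `a j` and using the rank-one form of `r` makes the sum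
  -- independent of `j`.
  have ha : ∀ j, a j = x j • ∑ i, y i • a i := fun j => by
    calc a j = (∑ i, a i ≫ b i) ≫ a j := by rw [hab, Category.id_comp]
      _ = ∑ i, r i j • a i := by
        rw [Preadditive.sum_comp]
        refine Finset.sum_congr rfl fun i _ => ?_
        rw [Category.assoc, hr, Linear.comp_smul, Category.comp_id]
      _ = _ := by
        rw [Finset.smul_sum]
        refine Finset.sum_congr rfl fun i _ => ?_
        rw [hrxy, smul_smul, mul_comm]
  refine hs.retract_iso (a := ∑ i, y i • a i) (b := ∑ j, x j • b j) ?_ h1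
  rw [← hab, Preadditive.comp_sum]
  refine Finset.sum_congr rfl fun j _ => ?_
  rw [Linear.comp_smul, ← Linear.smul_comp, ← ha]

lemma isZero_iff_id {A B : C} (f : A ⟶ B) : Limits.IsZero f ↔ 𝟙 f = 0 := 
  Limits.IsZero.iff_id_eq_zero f

variable [DualStructure C] [HasDuals C]

variable (F) in
include F in
lemma id_dual_eq_zero {A B : C} {f : A ⟶ B} (h : 𝟙 fᵃ = 0) : 𝟙 f = 0 := by
  refine id_eq_zero_of_comp_dual F f ?_
  rw [← whiskerLeft_id, h, whiskerLeft_zero' F]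

lemma eq_of_iota_whiskerLeft {A B : C} {f g : A ⟶ B} {φ ψ : gᵃ ⟶ fᵃ}
    (h : iota g ≫ g ◁ φ = iota g ≫ g ◁ ψ) : φ = ψ := by
  have key : ∀ χ : gᵃ ⟶ fᵃ, χ = (ρ_ _).inv ≫ gᵃ ◁ (iota g ≫ g ◁ χ) ≫ (α_ _ _ _).inv ≫
      eps g ▷ fᵃ ≫ (λ_ _).hom := fun χ => by
    symm
    calc _ = 𝟙 _ ⊗≫ gᵃ ◁ iota g ⊗≫ ((gᵃ ≫ g) ◁ χ ≫ eps g ▷ fᵃ) ⊗≫ 𝟙 _ := by bicategory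
      _ = 𝟙 _ ⊗≫ gᵃ ◁ iota g ⊗≫ (eps g ▷ gᵃ ≫ 𝟙 B ◁ χ) ⊗≫ 𝟙 _ := by rw [whisker_exchange]
      _ = (ρ_ _).inv ≫ (gᵃ ◁ iota g ≫ (α_ _ _ _).inv ≫ eps g ▷ gᵃ) ⊗≫ χ := by bicategory
      _ = χ := by rw [zigzag_right']; simp [bicategoricalComp]
  rw [key φ, key ψ, h]

/-- Transposition along `iota f` turns endomorphisms of `fᵃ` into endomorphisms of `f`. -/
lemma EndScalar.dual {A B : C} {f : A ⟶ B} (hf : EndScalar F f) : EndScalar F fᵃ := by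
  refine EndScalar.of (fun φ => ?_) fun h => hf.id_ne_zero (id_dual_eq_zero F h)
  obtain ⟨ψ, hψ⟩ := exists_eq_iota (iota f ≫ f ◁ φ)
  obtain ⟨r, rfl⟩ := hf.exists_smul ψ
  refine ⟨r, eq_of_iota_whiskerLeft ?_⟩
  rw [hψ, smul_id_whiskerRight, whiskerLeft_smul_id]

namespace SimpleBases

variable (ℬ : SimpleBases F C)

lemma rk_eq_sum (A B : C) :
    ℬ.rk A B = ∑ x, ℬ.rk A (ℬ.obj x) * ℬ.rk (ℬ.obj x) B := by
  have h := (ℬ.isBasis A B).card_eq (ℬ.semisimple A B _ _ _ _ (fun x => ℬ.isBasis A (ℬ.obj x))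
    (fun x => ℬ.isBasis (ℬ.obj x) B))
  simpa using h

lemma rk_ne_zero {A B : C} {f : A ⟶ B} (hf : 𝟙 f ≠ 0) : ℬ.rk A B ≠ 0 := by
  intro h
  refine hf (((ℬ.isBasis A B).splits f).id_eq_zero fun i => ?_)
  exact absurd i.2 (by omega)

lemma rk_ne_zero_dual {A B : C} (h : ℬ.rk A B ≠ 0) : ℬ.rk B A ≠ 0 := by
  have hf := ((ℬ.isBasis A B).endScalar ⟨0, Nat.pos_of_ne_zero h⟩).id_ne_zero
  exact ℬ.rk_ne_zero fun h0 => hf (id_dual_eq_zero F h0)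

lemma rk_obj_pos (x : Fin ℬ.n) : ℬ.rk (ℬ.obj x) (ℬ.obj x) ≠ 0 := by
  obtain ⟨f, hf⟩ := ℬ.obj_nonzero x
  exact ℬ.rk_ne_zero fun h => hf ((isZero_iff_id f).2 h)

/-- One term of `rk_eq_sum` is the square of the rank, so the rank `r` satisfies `r ^ 2 ≤ r` and is
positive. -/
lemma rk_obj_self (x : Fin ℬ.n) : ℬ.rk (ℬ.obj x) (ℬ.obj x) = 1 := by
  have h := ℬ.rk_eq_sum (ℬ.obj x) (ℬ.obj x)
  have h1 := Finset.single_le_sum (f := fun y => ℬ.rk (ℬ.obj x) (ℬ.obj y) * ℬ.rk (ℬ.obj y) (ℬ.obj x))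
    (fun _ _ => Nat.zero_le _) (Finset.mem_univ x)
  rw [← h] at h1
  have h2 := Nat.pos_of_ne_zero (ℬ.rk_obj_pos x)
  nlinarith

/-- The term of `x` already exhausts the rank one of `End(X)`. By duality a non-zero `Hom(X, Y)` has
a non-zero `Hom(Y, X)` and would add the term of `y`. -/
lemma rk_obj_ne {x y : Fin ℬ.n} (hxy : x ≠ y) : ℬ.rk (ℬ.obj x) (ℬ.obj y) = 0 := by
  by_contra h0
  have h0' := ℬ.rk_ne_zero_dual h0
  have h := ℬ.rk_eq_sum (ℬ.obj x) (ℬ.obj x)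
  rw [Fintype.sum_eq_add_sum_compl x, ℬ.rk_obj_self] at h
  have h1 := Finset.single_le_sum (f := fun y => ℬ.rk (ℬ.obj x) (ℬ.obj y) * ℬ.rk (ℬ.obj y) (ℬ.obj x))
    (s := ({x}ᶜ : Finset _)) (fun _ _ => Nat.zero_le _) (by simpa using hxy.symm : y ∈ ({x}ᶜ : Finset _))
  have h2 := Nat.pos_of_ne_zero (mul_ne_zero h0 h0')
  omega

lemma id_eq_zero_of_ne {x y : Fin ℬ.n} (hxy : x ≠ y) (f : ℬ.obj x ⟶ ℬ.obj y) : 𝟙 f = 0 := by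
  by_contra h
  exact ℬ.rk_ne_zero h (ℬ.rk_obj_ne hxy)

/-- If `s` is the only basis element of `End(X)`, then `s ≫ s` belongs to a basis as well by
semi-simplicity, so `s ≫ s ≅ s`, and `unit_iso` identifies `s` with `𝟙 X`. -/
lemma unitSplit (x : Fin ℬ.n) : UnitSplit F (ℬ.obj x) := by
  set X := ℬ.obj x
  let i0 : Fin (ℬ.rk X X) := ⟨0, Nat.pos_of_ne_zero (ℬ.rk_obj_pos x)⟩
  have hi : ∀ i : Fin (ℬ.rk X X), i = i0 := fun i => by
    have h1 : ℬ.rk X X = 1 := ℬ.rk_obj_self x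
    have h2 := i.2
    exact Fin.ext (show i.1 = 0 by omega)
  have hb := ℬ.isBasis X X
  have hs := hb.endScalar i0
  have hss : EndScalar F (ℬ.mor X X i0 ≫ ℬ.mor X X i0) :=
    (ℬ.semisimple X X _ _ _ _ (fun x => ℬ.isBasis X (ℬ.obj x))
      (fun x => ℬ.isBasis (ℬ.obj x) X)).endScalar ⟨x, i0, i0⟩
  obtain ⟨i, ⟨θ⟩⟩ := (hb.splits _).exists_iso hb.endScalar hss
  obtain rfl := hi i
  have hsplit : ∀ u : X ⟶ X, SplitsThrough (fun _ : Unit => ℬ.mor X X i0) u := fun u =>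
    (hb.splits u).of_iso fun i => ⟨(), ⟨eqToIso (by rw [hi i])⟩⟩
  obtain ⟨e⟩ := unit_iso hs θ (hsplit _)
  exact ⟨hs.of_iso e.symm, fun u => (hsplit u).of_iso fun _ => ⟨(), ⟨e.symm⟩⟩⟩

lemma comp_dual_eq_zero {x y : Fin ℬ.n} {B : C} (i : Fin (ℬ.rk (ℬ.obj x) B))
    (j : Fin (ℬ.rk (ℬ.obj y) B))
    (h : (⟨x, i⟩ : Σ x, Fin (ℬ.rk (ℬ.obj x) B)) ≠ ⟨y, j⟩) :
    𝟙 (ℬ.mor _ B i ≫ (ℬ.mor _ B j)ᵃ) = 0 := by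
  by_cases hxy : x = y
  · subst hxy
    refine id_comp_dual_eq_zero (ℬ.unitSplit x) ?_
    exact (ℬ.isBasis _ B).2.1 i j fun hij => h (by rw [hij])
  · exact ℬ.id_eq_zero_of_ne hxy _

end SimpleBases

end Structure

/-! ### Cells between composites of two 1-morphisms -/

section Strands

variable {C : Type u} [Bicategory.{w, v} C]

/-- A cell on the first two factors of a composite. -/
def onHead {A B B' D E : C} {f : A ⟶ B} {g : B ⟶ D} {f' : A ⟶ B'} {g' : B' ⟶ D}
    (φ : f ≫ g ⟶ f' ≫ g') (h : D ⟶ E) : f ≫ g ≫ h ⟶ f' ≫ g' ≫ h :=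
  (α_ f g h).inv ≫ φ ▷ h ≫ (α_ f' g' h).hom

/-- Interchange: cells on the first two and on the last two of four strands commute. -/
lemma onHead_onTail {A B B' D D' E G : C} {f : A ⟶ B} {g : B ⟶ D} {f' : A ⟶ B'} {g' : B' ⟶ D}
    (φ : f ≫ g ⟶ f' ≫ g') {h : D ⟶ E} {k : E ⟶ G} {h' : D ⟶ D'} {k' : D' ⟶ G}
    (ψ : h ≫ k ⟶ h' ≫ k') :
    onHead φ (h ≫ k) ≫ f' ◁ (g' ◁ ψ) = f ◁ (g ◁ ψ) ≫ onHead φ (h' ≫ k') := by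
  simp only [onHead]
  calc _ = 𝟙 _ ⊗≫ (φ ▷ (h ≫ k) ≫ (f' ≫ g') ◁ ψ) ⊗≫ 𝟙 _ := by bicategory
    _ = 𝟙 _ ⊗≫ ((f ≫ g) ◁ ψ ≫ φ ▷ (h' ≫ k')) ⊗≫ 𝟙 _ := by rw [whisker_exchange]
    _ = _ := by bicategory

/-- A composite of three cells on three strands, starting with the first two strands. -/
abbrev hexL {A B₁ B₂ B₃ D₁ D₂ E : C} {a₁ : A ⟶ B₁} {b₁ : B₁ ⟶ D₁} {c₁ : D₁ ⟶ E}
    {a₂ : A ⟶ B₂} {b₂ : B₂ ⟶ D₁} {b₃ : B₂ ⟶ D₂} {c₂ : D₂ ⟶ E} {a₃ : A ⟶ B₃} {b₄ : B₃ ⟶ D₂}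
    (φ₁ : a₁ ≫ b₁ ⟶ a₂ ≫ b₂) (φ₂ : b₂ ≫ c₁ ⟶ b₃ ≫ c₂) (φ₃ : a₂ ≫ b₃ ⟶ a₃ ≫ b₄) :
    a₁ ≫ b₁ ≫ c₁ ⟶ a₃ ≫ b₄ ≫ c₂ :=
  onHead φ₁ c₁ ≫ a₂ ◁ φ₂ ≫ onHead φ₃ c₂

/-- A composite of three cells on three strands, starting with the last two strands. -/
abbrev hexR {A B₁ B₂ D₁ D₂ D₃ E : C} {a₁ : A ⟶ B₁} {b₁ : B₁ ⟶ D₁} {c₁ : D₁ ⟶ E}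
    {b₂ : B₁ ⟶ D₂} {c₂ : D₂ ⟶ E} {a₂ : A ⟶ B₂} {b₃ : B₂ ⟶ D₂} {b₄ : B₂ ⟶ D₃} {c₃ : D₃ ⟶ E}
    (ψ₁ : b₁ ≫ c₁ ⟶ b₂ ≫ c₂) (ψ₂ : a₁ ≫ b₂ ⟶ a₂ ≫ b₃) (ψ₃ : b₃ ≫ c₂ ⟶ b₄ ≫ c₃) :
    a₁ ≫ b₁ ≫ c₁ ⟶ a₂ ≫ b₄ ≫ c₃ :=
  a₁ ◁ ψ₁ ≫ onHead ψ₂ c₂ ≫ a₂ ◁ ψ₃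

/-- Regrouping exhibits a hexagon whiskered by `k`, so relations between hexagons can be applied
next to a fourth strand. -/
lemma onHead_hexL {A B₁ B₂ B₃ D₁ D₂ E G : C} {a₁ : A ⟶ B₁} {b₁ : B₁ ⟶ D₁} {c₁ : D₁ ⟶ E}
    {a₂ : A ⟶ B₂} {b₂ : B₂ ⟶ D₁} {b₃ : B₂ ⟶ D₂} {c₂ : D₂ ⟶ E} {a₃ : A ⟶ B₃} {b₄ : B₃ ⟶ D₂}
    (φ₁ : a₁ ≫ b₁ ⟶ a₂ ≫ b₂) (φ₂ : b₂ ≫ c₁ ⟶ b₃ ≫ c₂) (φ₃ : a₂ ≫ b₃ ⟶ a₃ ≫ b₄) (k : E ⟶ G) :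
    onHead φ₁ (c₁ ≫ k) ≫ a₂ ◁ onHead φ₂ k ≫ onHead φ₃ (c₂ ≫ k) =
      a₁ ◁ (α_ _ _ _).inv ≫ (α_ _ _ _).inv ≫ hexL φ₁ φ₂ φ₃ ▷ k ≫ (α_ _ _ _).hom ≫
        a₃ ◁ (α_ _ _ _).hom := by
  simp only [hexL, onHead]
  bicategory

lemma onHead_hexR {A B₁ B₂ D₁ D₂ D₃ E G : C} {a₁ : A ⟶ B₁} {b₁ : B₁ ⟶ D₁} {c₁ : D₁ ⟶ E}
    {b₂ : B₁ ⟶ D₂} {c₂ : D₂ ⟶ E} {a₂ : A ⟶ B₂} {b₃ : B₂ ⟶ D₂} {b₄ : B₂ ⟶ D₃} {c₃ : D₃ ⟶ E}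
    (ψ₁ : b₁ ≫ c₁ ⟶ b₂ ≫ c₂) (ψ₂ : a₁ ≫ b₂ ⟶ a₂ ≫ b₃) (ψ₃ : b₃ ≫ c₂ ⟶ b₄ ≫ c₃) (k : E ⟶ G) :
    a₁ ◁ onHead ψ₁ k ≫ onHead ψ₂ (c₂ ≫ k) ≫ a₂ ◁ onHead ψ₃ k =
      a₁ ◁ (α_ _ _ _).inv ≫ (α_ _ _ _).inv ≫ hexR ψ₁ ψ₂ ψ₃ ▷ k ≫ (α_ _ _ _).hom ≫
        a₂ ◁ (α_ _ _ _).hom := by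
  simp only [hexR, onHead]
  bicategory

variable [Bicategory.Strict C]

lemma cell_onHead {A B B' D E : C} {f : A ⟶ B} {g : B ⟶ D} {f' : A ⟶ B'} {g' : B' ⟶ D}
    (φ : f ≫ g ⟶ f' ≫ g') (h : D ⟶ E) : Cell (onHead φ h) = Cell (φ ▷ h) := by
  rw [onHead, associator_hom_eq, associator_inv_eq]; simp

end Strands

/-! ### Tetrahedra and tensorators as cells on two strands -/

section TensorCells

variable {C : Type u} [Bicategory.{w, v} C] [Bicategory.Strict C] [SemiStrictMonoidal C]

/-- `f ⊗ W` with reassociated target. -/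
abbrev rTa {a b c : C} (f : a ⟶ b * c) (W : C) : a * W ⟶ b * (c * W) :=
  f ⊲ W ≫ eqToHom (mul_assoc b c W)

/-- `A ⊗ φ` for a cell between composites. -/
def lTc (A : C) {X Y Y' Z : C} {f : X ⟶ Y} {g : Y ⟶ Z} {f' : X ⟶ Y'} {g' : Y' ⟶ Z}
    (φ : f ≫ g ⟶ f' ≫ g') : (A ⊳ f) ≫ (A ⊳ g) ⟶ (A ⊳ f') ≫ (A ⊳ g') :=
  eqToHom (lT_comp ..).symm ≫ A ⊳₂ φ ≫ eqToHom (lT_comp ..)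

/-- `φ ⊗ W` for an element `φ` of `2H(ijkl)`, with reassociated boundary. -/
def rTc {eij eik eil ejk ejl ekl : C} {fijk : eik ⟶ ejk * eij} {fijl : eil ⟶ ejl * eij}
    {fikl : eil ⟶ ekl * eik} {fjkl : ejl ⟶ ekl * ejk} (φ : twoH fijk fijl fikl fjkl) (W : C) :
    rTa fikl W ≫ (ekl ⊳ rTa fijk W) ⟶ rTa fijl W ≫ rTa fjkl (eij * W) :=
  eqToHom (by simp [rTa]) ≫
    (φ ⊲₂ W) ▷ eqToHom (show ekl * (ejk * eij) * W = ekl * (ejk * (eij * W)) by simp [mul_assoc]) ≫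
      eqToHom (by simp [rTa])

/-- The tensorator with reassociated boundary. -/
def tenc {a b c x y : C} (f : a ⟶ b * c) (g : x ⟶ y) :
    rTa f x ≫ (b ⊳ (c ⊳ g)) ⟶ (a ⊳ g) ≫ rTa f y :=
  eqToHom (by simp) ≫ (ten f g).hom ▷ eqToHom (mul_assoc b c y) ≫ eqToHom (by simp)

instance {A X Y : C} {f g : X ⟶ Y} (α : f ⟶ g) [IsIso α] : IsIso (A ⊳₂ α) :=
  ⟨A ⊳₂ inv α, by rw [← lT₂_comp]; simp [lT₂_id], by rw [← lT₂_comp]; simp [lT₂_id]⟩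

instance {A X Y : C} {f g : X ⟶ Y} (α : f ⟶ g) [IsIso α] : IsIso (α ⊲₂ A) :=
  ⟨inv α ⊲₂ A, by rw [← rT₂_comp]; simp [rT₂_id], by rw [← rT₂_comp]; simp [rT₂_id]⟩

instance {A X Y Y' Z : C} {f : X ⟶ Y} {g : Y ⟶ Z} {f' : X ⟶ Y'} {g' : Y' ⟶ Z}
    (φ : f ≫ g ⟶ f' ≫ g') [IsIso φ] : IsIso (lTc A φ) := by
  unfold lTc; infer_instance

instance {eij eik eil ejk ejl ekl W : C} {fijk : eik ⟶ ejk * eij} {fijl : eil ⟶ ejl * eij}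
    {fikl : eil ⟶ ekl * eik} {fjkl : ejl ⟶ ekl * ejk} (φ : twoH fijk fijl fikl fjkl) [IsIso φ] :
    IsIso (rTc φ W) := by
  unfold rTc; infer_instance

instance {a b c x y : C} (f : a ⟶ b * c) (g : x ⟶ y) : IsIso (tenc f g) := by
  unfold tenc; infer_instance

instance {A B B' D E : C} {f : A ⟶ B} {g : B ⟶ D} {f' : A ⟶ B'} {g' : B' ⟶ D}
    (φ : f ≫ g ⟶ f' ≫ g') [IsIso φ] (h : D ⟶ E) : IsIso (onHead φ h) := by
  unfold onHead; infer_instance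

lemma cell_lTc (A : C) {X Y Y' Z : C} {f : X ⟶ Y} {g : Y ⟶ Z} {f' : X ⟶ Y'} {g' : Y' ⟶ Z}
    (φ : f ≫ g ⟶ f' ≫ g') : Cell (lTc A φ) = Cell (A ⊳₂ φ) := by
  simp [lTc]

lemma cell_rTc {eij eik eil ejk ejl ekl : C} {fijk : eik ⟶ ejk * eij} {fijl : eil ⟶ ejl * eij}
    {fikl : eil ⟶ ekl * eik} {fjkl : ejl ⟶ ekl * ejk} (φ : twoH fijk fijl fikl fjkl) (W : C) :
    Cell (rTc φ W) = Cell (φ ⊲₂ W) := by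
  simp [rTc]

lemma cell_tenc {a b c x y : C} (f : a ⟶ b * c) (g : x ⟶ y) :
    Cell (tenc f g) = Cell (ten f g).hom := by
  simp [tenc]

lemma cell_ten_comp_eqToHom {a b x y z : C} (f : a ⟶ b) (g : x ⟶ y) (h : y = z) :
    Cell (ten f (g ≫ eqToHom h)).hom = Cell (ten f g).hom :=
  Cell.ten_congr rfl (by simp)

lemma cell_ten_eqToHom_comp {a b c x y : C} (f : a ⟶ b) (g : x ⟶ y) (h : b = c) :
    Cell (ten (f ≫ eqToHom h) g).hom = Cell (ten f g).hom :=
  Cell.ten_congr (by simp) rfl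

lemma cell_ten_rT {X X' Y Y' : C} (f : X ⟶ X') (g : Y ⟶ Y') (A : C) :
    Cell (ten f (g ⊲ A)).hom = Cell ((ten f g).hom ⊲₂ A) := by
  refine cell_of_heq' ?_ ?_ (ten_rT f g A)
  · rw [rT_comp]
    exact Arr.comp_congr (arr_rT_mul ..) (arr_lT_rT ..).symm
  · rw [rT_comp]
    exact Arr.comp_congr (arr_lT_rT ..).symm (arr_rT_mul ..)

lemma cell_ten_lT (A : C) {X X' Y Y' : C} (f : X ⟶ X') (g : Y ⟶ Y') :
    Cell (ten (A ⊳ f) g).hom = Cell (A ⊳₂ (ten f g).hom) := by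
  refine cell_of_heq' ?_ ?_ (ten_lT A f g)
  · rw [lT_comp]
    exact Arr.comp_congr (arr_lT_rT ..) (arr_mul_lT ..)
  · rw [lT_comp]
    exact Arr.comp_congr (arr_mul_lT ..) (arr_lT_rT ..)

lemma cell_ten_rT_lT {X X' Y Y' : C} (f : X ⟶ X') (B : C) (g : Y ⟶ Y') :
    Cell (ten (f ⊲ B) g).hom = Cell (ten f (B ⊳ g)).hom := by
  refine cell_of_heq' ?_ ?_ (ten_rT_lT f B g)
  · exact Arr.comp_congr (arr_rT_mul ..).symm (arr_mul_lT ..)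
  · exact Arr.comp_congr (arr_mul_lT ..) (arr_rT_mul ..).symm

lemma cell_ten_comp_right {A A' B B' B'' : C} (f : A ⟶ A') (g : B ⟶ B') (g' : B' ⟶ B'') :
    Cell (ten f (g ≫ g')).hom =
      Cell ((ten f g).hom ▷ (A' ⊳ g') ≫ (α_ _ _ _).hom ≫ (A ⊳ g) ◁ (ten f g').hom) := by
  refine (cell_of_heq (by simp) (by simp) (ten_comp_right f g g')).trans ?_
  rw [associator_hom_eq]
  rfl

lemma cell_ten_comp_left {A A' A'' B B' : C} (f : A ⟶ A') (f' : A' ⟶ A'') (g : B ⟶ B') :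
    Cell (ten (f ≫ f') g).hom =
      Cell ((f ⊲ B) ◁ (ten f' g).hom ≫ (α_ _ _ _).inv ≫ (ten f g).hom ▷ (f' ⊲ B')) := by
  refine (cell_of_heq (by simp) (by simp) (ten_comp_left f f' g)).trans ?_
  rw [associator_inv_eq]
  rfl

lemma arr_rTa {a b c : C} (f : a ⟶ b * c) (W : C) : Arr (rTa f W) = Arr (f ⊲ W) :=
  arr_comp_eqToHom _ _

lemma cell_onHead_congr {A B B' D E : C} {f : A ⟶ B} {g : B ⟶ D} {f' : A ⟶ B'} {g' : B' ⟶ D}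
    {φ : f ≫ g ⟶ f' ≫ g'} {h : D ⟶ E} {A₁ D₁ E₁ : C} {k k' : A₁ ⟶ D₁} {ψ : k ⟶ k'} {h₁ : D₁ ⟶ E₁}
    (hφ : Cell φ = Cell ψ) (hh : Arr h = Arr h₁) : Cell (onHead φ h) = Cell (ψ ▷ h₁) := by
  rw [cell_onHead]
  exact Cell.whiskerRight_congr hφ hh

lemma cell_comp_eqToHom_comp {A B A' B' : C} {f g g' h : A ⟶ B} {f₁ g₁ h₁ : A' ⟶ B'}
    {α : f ⟶ g} {β : g' ⟶ h} {α' : f₁ ⟶ g₁} {β' : g₁ ⟶ h₁} (e : g = g')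
    (hα : Cell α = Cell α') (hβ : Cell β = Cell β') :
    Cell (α ≫ eqToHom e ≫ β) = Cell (α' ≫ β') :=
  cell_vcomp e hα hβ

lemma cell_ten_comp_right' {a b c X Y Z : C} (f : a ⟶ b * c) (g : X ⟶ Y) (h : Y ⟶ Z) :
    Cell (ten f (g ≫ h)).hom =
      Cell (onHead (tenc f g) (b ⊳ (c ⊳ h)) ≫ (a ⊳ g) ◁ tenc f h) := by
  rw [cell_ten_comp_right, associator_hom_eq]
  refine cell_comp_eqToHom_comp _ ?_ ?_
  · exact (cell_onHead_congr (cell_tenc f g) (arr_mul_lT b c h).symm).symm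
  · exact Cell.whiskerLeft_congr rfl (cell_tenc f h).symm

/-- Naturality of the tensorator in the second variable, on three strands. -/
lemma tenc_natural_right {a b c X Y Y' Z : C} (f : a ⟶ b * c) {g : X ⟶ Y} {h : Y ⟶ Z} {g' : X ⟶ Y'}
    {h' : Y' ⟶ Z} (ψ : g ≫ h ⟶ g' ≫ h') :
    hexR (lTc b (lTc c ψ)) (tenc f g') (tenc f h') = hexL (tenc f g) (tenc f h) (lTc a ψ) := by
  refine eq_of_cell ?_
  have h1 := ten_natural (𝟙 f) ψ
  rw [rT₂_id, rT₂_id, hcomp₂_id_left, hcomp₂_id_right] at h1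
  refine Eq.trans ?_ ((congrArg Cell h1).trans ?_)
  · refine Cell.comp_congr ?_ (cell_ten_comp_right' f g' h').symm
    refine Cell.whiskerLeft_congr (arr_rTa f X) ?_
    rw [cell_lTc, cell_mul_lT]
    exact Cell.lT_congr rfl (cell_lTc c ψ)
  · refine Eq.trans ?_ (congrArg Cell (Category.assoc _ _ _))
    refine Cell.comp_congr (cell_ten_comp_right' f g h) ?_
    exact (cell_onHead_congr (cell_lTc a ψ) (arr_rTa f Z)).symm

/-- Naturality of the tensorator in the first variable, on three strands. -/
lemma tenc_natural_left {eij eik eil ejk ejl ekl : C} {fijk : eik ⟶ ejk * eij}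
    {fijl : eil ⟶ ejl * eij}
    {fikl : eil ⟶ ekl * eik} {fjkl : ejl ⟶ ekl * ejk} (φ : twoH fijk fijl fikl fjkl)
    {x y : C} (g : x ⟶ y) :
    hexL (rTc φ x) (tenc fjkl (eij ⊳ g)) (tenc fijl g) =
      hexR (lTc ekl (tenc fijk g)) (tenc fikl g) (rTc φ y) := by
  refine eq_of_cell ?_
  have h1 := ten_natural φ (𝟙 g)
  rw [lT₂_id, lT₂_id, hcomp₂_id_right, hcomp₂_id_left] at h1
  refine Eq.trans ?_ ((congrArg Cell h1).trans ?_)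
  · refine Cell.comp_congr ?_ ?_
    · refine cell_onHead_congr (cell_rTc φ x) ?_
      rw [mul_lT']
      simp
    · rw [fR, cell_ten_comp_left, associator_inv_eq]
      refine (cell_comp_eqToHom_comp _ (Eq.symm ?_) (Eq.symm ?_)).symm
      · refine Cell.whiskerLeft_congr (arr_rTa fijl x) ?_
        rw [cell_tenc, cell_ten_eqToHom_comp, cell_ten_rT_lT]
      · refine cell_onHead_congr (cell_tenc fijl g) ?_
        rw [arr_rTa, rT_comp, eqToHom_rT, arr_comp_eqToHom, arr_rT_mul]
  · refine Eq.trans ?_ (congrArg Cell (Category.assoc _ _ _))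
    refine Cell.comp_congr ?_ (Cell.whiskerLeft_congr rfl (cell_rTc φ y).symm)
    rw [fL, cell_ten_comp_left, associator_inv_eq]
    refine cell_comp_eqToHom_comp _ ?_ ?_
    · refine Cell.whiskerLeft_congr (arr_rTa fikl x).symm ?_
      rw [cell_lTc, cell_ten_lT]
      exact Cell.lT_congr rfl (cell_tenc fijk g).symm
    · refine (cell_onHead_congr (cell_tenc fikl g) ?_).symm
      rw [arr_lT_rT]
      exact Arr.lT_congr rfl (arr_rTa fijk y)

end TensorCells

/-! ### The cocycle identity of a 5-simplex -/

section Cocycle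

variable {F : Type*} [Field F] {C : Type u} [Bicategory.{w, v} C] [Bicategory.Strict C]
  [SemiStrictMonoidal C] [∀ A B : C, Preadditive (A ⟶ B)] [∀ A B : C, Linear F (A ⟶ B)]
  [VectLinear F C]

lemma hexL_whiskerRight {A B₁ B₂ B₃ D₁ D₂ D₁' E G : C}
    {a₁ : A ⟶ B₁} {b₁ : B₁ ⟶ D₁} {c₁ : D₁ ⟶ E}
    {a₂ : A ⟶ B₂} {b₂ : B₂ ⟶ D₁} {b₃ : B₂ ⟶ D₂} {c₂ : D₂ ⟶ E} {a₃ : A ⟶ B₃} {b₄ : B₃ ⟶ D₂}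
    {φ₁ : a₁ ≫ b₁ ⟶ a₂ ≫ b₂} {φ₂ : b₂ ≫ c₁ ⟶ b₃ ≫ c₂} {φ₃ : a₂ ≫ b₃ ⟶ a₃ ≫ b₄}
    {b₂' : B₁ ⟶ D₁'} {c₂' : D₁' ⟶ E} {b₃' : B₃ ⟶ D₁'}
    {ψ₁ : b₁ ≫ c₁ ⟶ b₂' ≫ c₂'} {ψ₂ : a₁ ≫ b₂' ⟶ a₃ ≫ b₃'} {ψ₃ : b₃' ≫ c₂' ⟶ b₄ ≫ c₂}
    {z : F} (h : hexL φ₁ φ₂ φ₃ = z • hexR ψ₁ ψ₂ ψ₃) (k : E ⟶ G) :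
    onHead φ₁ (c₁ ≫ k) ≫ a₂ ◁ onHead φ₂ k ≫ onHead φ₃ (c₂ ≫ k) =
      z • (a₁ ◁ onHead ψ₁ k ≫ onHead ψ₂ (c₂' ≫ k) ≫ a₃ ◁ onHead ψ₃ k) := by
  rw [onHead_hexL, h, onHead_hexR, VectLinear.whiskerRight_smul]
  simp only [Linear.smul_comp, Linear.comp_smul]

lemma hexL_whiskerLeft {A₀ A B₁ B₂ B₃ D₁ D₂ D₁' E : C}
    {a₁ : A ⟶ B₁} {b₁ : B₁ ⟶ D₁} {c₁ : D₁ ⟶ E}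
    {a₂ : A ⟶ B₂} {b₂ : B₂ ⟶ D₁} {b₃ : B₂ ⟶ D₂} {c₂ : D₂ ⟶ E} {a₃ : A ⟶ B₃} {b₄ : B₃ ⟶ D₂}
    {φ₁ : a₁ ≫ b₁ ⟶ a₂ ≫ b₂} {φ₂ : b₂ ≫ c₁ ⟶ b₃ ≫ c₂} {φ₃ : a₂ ≫ b₃ ⟶ a₃ ≫ b₄}
    {b₂' : B₁ ⟶ D₁'} {c₂' : D₁' ⟶ E} {b₃' : B₃ ⟶ D₁'}
    {ψ₁ : b₁ ≫ c₁ ⟶ b₂' ≫ c₂'} {ψ₂ : a₁ ≫ b₂' ⟶ a₃ ≫ b₃'} {ψ₃ : b₃' ≫ c₂' ⟶ b₄ ≫ c₂}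
    {z : F} (h : hexL φ₁ φ₂ φ₃ = z • hexR ψ₁ ψ₂ ψ₃) (f : A₀ ⟶ A) :
    f ◁ onHead φ₁ c₁ ≫ f ◁ (a₂ ◁ φ₂) ≫ f ◁ onHead φ₃ c₂ =
      z • (f ◁ (a₁ ◁ ψ₁) ≫ f ◁ onHead ψ₂ c₂' ≫ f ◁ (a₃ ◁ ψ₃)) := by
  simp only [← whiskerLeft_comp]
  exact (congrArg (f ◁ ·) h).trans (VectLinear.whiskerLeft_smul ..)

lemma lTc_hex {A B₁ B₂ B₃ D₁ D₂ D₁' E : C}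
    {a₁ : A ⟶ B₁} {b₁ : B₁ ⟶ D₁} {c₁ : D₁ ⟶ E}
    {a₂ : A ⟶ B₂} {b₂ : B₂ ⟶ D₁} {b₃ : B₂ ⟶ D₂} {c₂ : D₂ ⟶ E} {a₃ : A ⟶ B₃} {b₄ : B₃ ⟶ D₂}
    {φ₁ : a₁ ≫ b₁ ⟶ a₂ ≫ b₂} {φ₂ : b₂ ≫ c₁ ⟶ b₃ ≫ c₂} {φ₃ : a₂ ≫ b₃ ⟶ a₃ ≫ b₄}
    {b₂' : B₁ ⟶ D₁'} {c₂' : D₁' ⟶ E} {b₃' : B₃ ⟶ D₁'}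
    {ψ₁ : b₁ ≫ c₁ ⟶ b₂' ≫ c₂'} {ψ₂ : a₁ ≫ b₂' ⟶ a₃ ≫ b₃'} {ψ₃ : b₃' ≫ c₂' ⟶ b₄ ≫ c₂}
    {z : F} (h : hexL φ₁ φ₂ φ₃ = z • hexR ψ₁ ψ₂ ψ₃) (X : C) :
    hexL (lTc X φ₁) (lTc X φ₂) (lTc X φ₃) = z • hexR (lTc X ψ₁) (lTc X ψ₂) (lTc X ψ₃) := by
  refine eq_of_cell ?_
  have h1 := congrArg (X ⊳₂ ·) h
  rw [VectLinear.lT₂_smul, lT₂_comp, lT₂_comp, lT₂_comp, lT₂_comp] at h1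
  have key : ∀ {A B B' D E : C} {f : A ⟶ B} {g : B ⟶ D} {f' : A ⟶ B'} {g' : B' ⟶ D}
      (φ : f ≫ g ⟶ f' ≫ g') (h : D ⟶ E), Cell (onHead (lTc X φ) (X ⊳ h)) = Cell (X ⊳₂ onHead φ h) :=
    fun φ h => (cell_onHead_congr (cell_lTc X φ) rfl).trans
      ((cell_lT_whiskerRight X φ h).symm.trans (Cell.lT_congr rfl (cell_onHead φ h).symm))
  have key' : ∀ {A B B' D E : C} {f : B ⟶ E} {g : E ⟶ D} {f' : B ⟶ B'} {g' : B' ⟶ D}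
      (k : A ⟶ B) (φ : f ≫ g ⟶ f' ≫ g'), Cell ((X ⊳ k) ◁ lTc X φ) = Cell (X ⊳₂ (k ◁ φ)) :=
    fun k φ => (Cell.whiskerLeft_congr rfl (cell_lTc X φ)).trans (cell_lT_whiskerLeft X k φ).symm
  refine Eq.trans ?_ ((congrArg Cell h1).trans (Cell.smul_congr z ?_))
  · exact Cell.comp_congr (key _ _) (Cell.comp_congr (key' _ _) (key _ _))
  · exact (Cell.comp_congr (key' _ _) (Cell.comp_congr (key _ _) (key' _ _))).symm

/-- Tensoring a 4-simplex with `W` keeps its scalar: `ten_rT` absorbs `W` into the tensorator, and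
tensoring `α` with `eij` and then `W` is tensoring it with `eij * W`. -/
lemma rTc_hex {eij eik eil eim ejk ejl ejm ekl ekm elm : C}
    {fijk : eik ⟶ ejk * eij} {fijl : eil ⟶ ejl * eij} {fijm : eim ⟶ ejm * eij}
    {fikl : eil ⟶ ekl * eik} {fikm : eim ⟶ ekm * eik} {film : eim ⟶ elm * eil}
    {fjkl : ejl ⟶ ekl * ejk} {fjkm : ejm ⟶ ekm * ejk} {fjlm : ejm ⟶ elm * ejl}
    {fklm : ekm ⟶ elm * ekl} {β : twoH fikl fikm film fklm} {δ : twoH fijk fijm fikm fjkm}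
    {α : twoH fjkl fjkm fjlm fklm} {γ : twoH fijl fijm film fjlm} {ϵ : twoH fijk fijl fikl fjkl}
    {z : F} (h : hexL β (tenc fklm fijk) δ = z • hexR (lTc elm ϵ) γ (rTc α eij)) (W : C) :
    hexL (rTc β W) (tenc fklm (rTa fijk W)) (rTc δ W) =
      z • hexR (lTc elm (rTc ϵ W)) (rTc γ W) (rTc α (eij * W)) := by
  refine eq_of_cell ?_
  have h1 := congrArg (· ⊲₂ W) h
  rw [VectLinear.rT₂_smul, rT₂_comp, rT₂_comp, rT₂_comp, rT₂_comp] at h1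
  refine Eq.trans ?_ ((congrArg Cell h1).trans (Cell.smul_congr z ?_))
  · refine Cell.comp_congr ?_ (Cell.comp_congr ?_ ?_)
    · refine (cell_onHead_congr (cell_rTc β W) ?_).trans ((cell_rT_whiskerRight _ _ W).symm.trans
        (Cell.rT_congr (cell_onHead β _).symm rfl))
      rw [arr_lT_rT]
      refine Arr.lT_congr rfl ?_
      rw [arr_lT_rT]
      exact Arr.lT_congr rfl (arr_rTa ..)
    · refine (Cell.whiskerLeft_congr (arr_rTa fikm W) ?_).trans (cell_rT_whiskerLeft _ _ W).symm
      rw [cell_tenc, cell_ten_comp_eqToHom, cell_ten_rT]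
      exact Cell.rT_congr (cell_tenc _ _).symm rfl
    · refine (cell_onHead_congr (cell_rTc δ W) ?_).trans ((cell_rT_whiskerRight _ _ W).symm.trans
        (Cell.rT_congr (cell_onHead δ _).symm rfl))
      rw [arr_rTa, rT_comp, eqToHom_rT, arr_comp_eqToHom, ← arr_rT_mul]
      exact Arr.rT_congr rfl (mul_assoc ..).symm
  · symm
    refine Cell.comp_congr ?_ (Cell.comp_congr ?_ ?_)
    · refine (Cell.whiskerLeft_congr (arr_rTa film W) ?_).trans (cell_rT_whiskerLeft _ _ W).symm
      rw [cell_lTc]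
      refine (Cell.lT_congr rfl (cell_rTc ϵ W)).trans ?_
      rw [← cell_lT_rT]
      exact Cell.rT_congr (cell_lTc _ _).symm rfl
    · refine (cell_onHead_congr (cell_rTc γ W) ?_).trans ((cell_rT_whiskerRight _ _ W).symm.trans
        (Cell.rT_congr (cell_onHead γ _).symm rfl))
      rw [arr_lT_rT]
      refine Arr.lT_congr rfl ?_
      rw [arr_rTa, rT_comp, eqToHom_rT, arr_comp_eqToHom, arr_rT_mul]
    · refine (Cell.whiskerLeft_congr (arr_rTa fijm W) ?_).trans (cell_rT_whiskerLeft _ _ W).symm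
      rw [cell_rTc, cell_rT_mul]
      exact Cell.rT_congr (cell_rTc _ _).symm rfl

section

variable {e01 e02 e03 e04 e05 e12 e13 e14 e15 e23 e24 e25 e34 e35 e45 : C}
  {f012 : e02 ⟶ e12 * e01} {f013 : e03 ⟶ e13 * e01} {f014 : e04 ⟶ e14 * e01}
  {f015 : e05 ⟶ e15 * e01} {f023 : e03 ⟶ e23 * e02} {f024 : e04 ⟶ e24 * e02}
  {f025 : e05 ⟶ e25 * e02} {f034 : e04 ⟶ e34 * e03} {f035 : e05 ⟶ e35 * e03}
  {f045 : e05 ⟶ e45 * e04} {f123 : e13 ⟶ e23 * e12} {f124 : e14 ⟶ e24 * e12}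
  {f125 : e15 ⟶ e25 * e12} {f134 : e14 ⟶ e34 * e13} {f135 : e15 ⟶ e35 * e13}
  {f145 : e15 ⟶ e45 * e14} {f234 : e24 ⟶ e34 * e23} {f235 : e25 ⟶ e35 * e23}
  {f245 : e25 ⟶ e45 * e24} {f345 : e35 ⟶ e45 * e34}

/-- The composite of six tetrahedra from the left comb to the right comb. -/
def sixfold (φ0123 : twoH f012 f013 f023 f123) (φ0134 : twoH f013 f014 f034 f134)
    (φ0145 : twoH f014 f015 f045 f145) (φ1234 : twoH f123 f124 f134 f234)
    (φ1245 : twoH f124 f125 f145 f245) (φ2345 : twoH f234 f235 f245 f345) :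
    f045 ≫ (e45 ⊳ f034) ≫ (e45 ⊳ (e34 ⊳ f023)) ≫ (e45 ⊳ (e34 ⊳ (e23 ⊳ f012))) ⟶
      f015 ≫ rTa f125 e01 ≫ rTa f235 (e12 * e01) ≫ rTa f345 (e23 * (e12 * e01)) :=
  f045 ◁ ((e45 ⊳ f034) ◁ lTc e45 (lTc e34 φ0123)) ≫
    f045 ◁ onHead (lTc e45 φ0134) (e45 ⊳ (e34 ⊳ rTa f123 e01)) ≫
    onHead φ0145 ((e45 ⊳ rTa f134 e01) ≫ (e45 ⊳ (e34 ⊳ rTa f123 e01))) ≫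
    f015 ◁ (rTa f145 e01 ◁ lTc e45 (rTc φ1234 e01)) ≫
    f015 ◁ onHead (rTc φ1245 e01) (e45 ⊳ rTa f234 (e12 * e01)) ≫
    f015 ◁ (rTa f125 e01 ◁ rTc φ2345 (e12 * e01))

instance (φ0123 : twoH f012 f013 f023 f123) (φ0134 : twoH f013 f014 f034 f134)
    (φ0145 : twoH f014 f015 f045 f145) (φ1234 : twoH f123 f124 f134 f234)
    (φ1245 : twoH f124 f125 f145 f245) (φ2345 : twoH f234 f235 f245 f345)
    [IsIso φ0123] [IsIso φ0134] [IsIso φ0145] [IsIso φ1234] [IsIso φ1245] [IsIso φ2345] :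
    IsIso (sixfold φ0123 φ0134 φ0145 φ1234 φ1245 φ2345) := by
  unfold sixfold; infer_instance

/-- The index of a scalar is the vertex missing from its 4-simplex. The cell `A` leads from the left
comb to the right comb. The hexagons opposite `1`, `3`, `5`, and likewise those opposite `4`, `2`,
`0`, turn it into a multiple of the same `sixfold`; the other moves are interchange and naturality
of the tensorator, which carry no factor. -/
lemma smul_sixfold_eq
    (φ0123 : twoH f012 f013 f023 f123) (φ0124 : twoH f012 f014 f024 f124)
    (φ0125 : twoH f012 f015 f025 f125) (φ0134 : twoH f013 f014 f034 f134)
    (φ0135 : twoH f013 f015 f035 f135) (φ0145 : twoH f014 f015 f045 f145)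
    (φ0234 : twoH f023 f024 f034 f234) (φ0235 : twoH f023 f025 f035 f235)
    (φ0245 : twoH f024 f025 f045 f245) (φ0345 : twoH f034 f035 f045 f345)
    (φ1234 : twoH f123 f124 f134 f234) (φ1235 : twoH f123 f125 f135 f235)
    (φ1245 : twoH f124 f125 f145 f245) (φ1345 : twoH f134 f135 f145 f345)
    (φ2345 : twoH f234 f235 f245 f345) {z0 z1 z2 z3 z4 z5 : F}
    (h0 : hexL φ1345 (tenc f345 f123) φ1235 = z0 • hexR (lTc e45 φ1234) φ1245 (rTc φ2345 e12))
    (h1 : hexL φ0345 (tenc f345 f023) φ0235 = z1 • hexR (lTc e45 φ0234) φ0245 (rTc φ2345 e02))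
    (h2 : hexL φ0345 (tenc f345 f013) φ0135 = z2 • hexR (lTc e45 φ0134) φ0145 (rTc φ1345 e01))
    (h3 : hexL φ0245 (tenc f245 f012) φ0125 = z3 • hexR (lTc e45 φ0124) φ0145 (rTc φ1245 e01))
    (h4 : hexL φ0235 (tenc f235 f012) φ0125 = z4 • hexR (lTc e35 φ0123) φ0135 (rTc φ1235 e01))
    (h5 : hexL φ0234 (tenc f234 f012) φ0124 = z5 • hexR (lTc e34 φ0123) φ0134 (rTc φ1234 e01)) :
    (z1 * z3 * z5) • sixfold φ0123 φ0134 φ0145 φ1234 φ1245 φ2345 =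
      (z0 * z2 * z4) • sixfold φ0123 φ0134 φ0145 φ1234 φ1245 φ2345 := by
  -- The two naturality relations enter the whiskering lemma as hexagon relations with scalar `1`.
  have one : ∀ {A B : C} {f g : A ⟶ B} (x : f ⟶ g), x = (1 : F) • x := fun x => (one_smul F x).symm
  have n1 := hexL_whiskerLeft ((tenc_natural_left φ2345 f012).trans (one _)) f025
  have n2 := hexL_whiskerLeft ((tenc_natural_right f345 φ0123).symm.trans (one _)) f035
  rw [← one] at n1 n2
  have H1 := hexL_whiskerRight h1 (e45 ⊳ (e34 ⊳ (e23 ⊳ f012)))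
  have H3 := hexL_whiskerRight h3 (e45 ⊳ rTa f234 (e12 * e01))
  have H5 := hexL_whiskerLeft (lTc_hex h5 e45) f045
  have H4 := hexL_whiskerRight h4 (rTa f345 (e23 * (e12 * e01)))
  have H2 := hexL_whiskerRight h2 (e45 ⊳ (e34 ⊳ rTa f123 e01))
  have H0 := hexL_whiskerLeft (rTc_hex h0 e01) f015
  set A := onHead φ0345 ((e45 ⊳ (e34 ⊳ f023)) ≫ (e45 ⊳ (e34 ⊳ (e23 ⊳ f012)))) ≫
    f035 ◁ onHead (tenc f345 f023) (e45 ⊳ (e34 ⊳ (e23 ⊳ f012))) ≫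
    onHead φ0235 (rTa f345 (e23 * e02) ≫ (e45 ⊳ (e34 ⊳ (e23 ⊳ f012)))) ≫
    f025 ◁ (rTa f235 e02 ◁ tenc f345 (e23 ⊳ f012)) ≫
    f025 ◁ onHead (tenc f235 f012) (rTa f345 (e23 * (e12 * e01))) ≫
    onHead φ0125 (rTa f235 (e12 * e01) ≫ rTa f345 (e23 * (e12 * e01))) with hA
  have left : A = (z1 * z3 * z5) • sixfold φ0123 φ0134 φ0145 φ1234 φ1245 φ2345 := by
    rw [hA, reassoc_of% H1]
    simp only [Linear.smul_comp, Category.assoc]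
    rw [reassoc_of% n1, ← onHead_onTail, reassoc_of% (onHead_onTail φ0245 (lTc e45 (tenc f234 f012))),
      reassoc_of% H3]
    simp only [Linear.smul_comp, Linear.comp_smul, Category.assoc]
    rw [reassoc_of% H5]
    simp only [Linear.smul_comp, Linear.comp_smul, Category.assoc, smul_smul]
    rw [← reassoc_of% (onHead_onTail φ0145 (lTc e45 (rTc φ1234 e01))), ← mul_assoc z1]
    rfl
  have right : A = (z0 * z2 * z4) • sixfold φ0123 φ0134 φ0145 φ1234 φ1245 φ2345 := by
    rw [hA, reassoc_of% (onHead_onTail φ0235 (tenc f345 (e23 ⊳ f012))), H4]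
    simp only [Linear.smul_comp, Linear.comp_smul, Category.assoc]
    rw [reassoc_of% n2, ← reassoc_of% (onHead_onTail φ0135 (tenc f345 (rTa f123 e01))),
      reassoc_of% (onHead_onTail φ0345 (lTc e45 (lTc e34 φ0123))), reassoc_of% H2]
    simp only [Linear.smul_comp, Linear.comp_smul, Category.assoc]
    rw [H0]
    simp only [Linear.smul_comp, Linear.comp_smul, Category.assoc, smul_smul]
    rw [sixfold, mul_comm z0, mul_comm]
  rw [← left, right]

end

end Cocycle

section LinearCategory

variable {F : Type*} [Field F] {H : Type*} [Category H] [Preadditive H] [Linear F H]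

lemma SplitsThrough.exists_comp_ne_zero {ι : Type*} {s : ι → H} {u w : H}
    (h : SplitsThrough s w) {a : u ⟶ w} {b : w ⟶ u} (hab : a ≫ b ≠ 0) :
    ∃ (i : ι) (a' : u ⟶ s i) (b' : s i ⟶ u), a' ≫ b' ≠ 0 := by
  obtain ⟨n, k, p, q, hpq⟩ := h
  have h1 : a ≫ b = ∑ j, (a ≫ p j) ≫ (q j ≫ b) := by
    calc a ≫ b = a ≫ (∑ j, p j ≫ q j) ≫ b := by rw [hpq]; simp
      _ = _ := by simp [Preadditive.sum_comp, Preadditive.comp_sum]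
  rw [h1] at hab
  obtain ⟨j, -, hj⟩ := Finset.exists_ne_zero_of_sum_ne_zero hab
  exact ⟨k j, _, _, hj⟩

end LinearCategory

/-! ### Unique factorisation of scalar 1-morphisms into `A ⊗ B` -/

section Labels

variable {F : Type*} [Field F] {C : Type u} [Bicategory.{w, v} C] [Bicategory.Strict C]
  [SemiStrictMonoidal C] [∀ A B : C, Preadditive (A ⟶ B)] [∀ A B : C, Linear F (A ⟶ B)]
  [VectLinear F C]

variable (F) in
include F in
lemma SplitsThrough.whiskerRight {A B D : C} {ι : Type*} {s : ι → (A ⟶ B)} {u : A ⟶ B}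
    (h : SplitsThrough s u) (g : B ⟶ D) : SplitsThrough (fun i => s i ≫ g) (u ≫ g) := by
  obtain ⟨n, k, a, b, hab⟩ := h
  refine ⟨n, k, fun j => a j ▷ g, fun j => b j ▷ g, ?_⟩
  simp only [← comp_whiskerRight]
  rw [← sum_whiskerRight' F, hab, id_whiskerRight]

variable (F) in
include F in
lemma SplitsThrough.whiskerLeft_lT {X A B D : C} {ι : Type*} {s : ι → (B ⟶ D)} {u : B ⟶ D}
    (h : SplitsThrough s u) (f : X ⟶ A * B) :
    SplitsThrough (fun i => f ≫ (A ⊳ s i)) (f ≫ (A ⊳ u)) := by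
  obtain ⟨n, k, a, b, hab⟩ := h
  refine ⟨n, k, fun j => f ◁ (A ⊳₂ a j), fun j => f ◁ (A ⊳₂ b j), ?_⟩
  simp only [← whiskerLeft_comp, ← lT₂_comp]
  rw [← whiskerLeft_sum' F, ← lT_sum' F, hab, lT₂_id, whiskerLeft_id]

/-- Tensoring with an object preserves isomorphisms of 1-morphisms. -/
def lTIso (A : C) {X Y : C} {f g : X ⟶ Y} (e : f ≅ g) : A ⊳ f ≅ A ⊳ g where
  hom := A ⊳₂ e.hom
  inv := A ⊳₂ e.inv
  hom_inv_id := by rw [← lT₂_comp, e.hom_inv_id, lT₂_id]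
  inv_hom_id := by rw [← lT₂_comp, e.inv_hom_id, lT₂_id]

/-- Tensoring with an object preserves isomorphisms of 1-morphisms. -/
def rTIso {X Y : C} {f g : X ⟶ Y} (e : f ≅ g) (A : C) : f ⊲ A ≅ g ⊲ A where
  hom := e.hom ⊲₂ A
  inv := e.inv ⊲₂ A
  hom_inv_id := by rw [← rT₂_comp, e.hom_inv_id, rT₂_id]
  inv_hom_id := by rw [← rT₂_comp, e.inv_hom_id, rT₂_id]

variable [DualStructure C] [HasDuals C]

namespace SimpleBases

variable (ℬ : SimpleBases F C)

lemma endScalar {A B : C} (i : Fin (ℬ.rk A B)) : EndScalar F (ℬ.mor A B i) :=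
  (ℬ.isBasis A B).endScalar i

lemma exists_mor_iso {A B : C} {u : A ⟶ B} (hu : EndScalar F u) :
    ∃ i, Nonempty (u ≅ ℬ.mor A B i) :=
  ((ℬ.isBasis A B).splits u).exists_iso ℬ.endScalar hu

lemma endScalar_comp_lT {X A B : C} {y : Fin ℬ.n} {p : X ⟶ A * ℬ.obj y} (hp : EndScalar F p)
    {q : ℬ.obj y ⟶ B} (hq : EndScalar F q) : EndScalar F (p ≫ (A ⊳ q)) := by
  obtain ⟨c, hc⟩ := exists_coiso (ℬ.unitSplit y) hq
  exact (hc.lT A).endScalar_comp hp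

/-- A splitting of `𝟙 B` through composites `B ⟶ Y ⟶ B` with `Y` in `ℰ` splits `u`. Splitting the
part `X ⟶ A ⊗ Y` into basis elements as well yields a non-zero summand, which is all of `u` because
both are scalar. -/
lemma exists_decomposition {X A B : C} {u : X ⟶ A * B} (hu : EndScalar F u) :
    ∃ (y : Fin ℬ.n) (i : Fin (ℬ.rk X (A * ℬ.obj y))) (j : Fin (ℬ.rk (ℬ.obj y) B)),
      Nonempty (u ≅ ℬ.mor _ _ i ≫ (A ⊳ ℬ.mor _ _ j)) := by
  have hB := (ℬ.semisimple B B _ _ _ _ (fun x => ℬ.isBasis B (ℬ.obj x))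
      (fun x => ℬ.isBasis (ℬ.obj x) B)).splits (𝟙 B)
  have e : u = u ≫ (A ⊳ 𝟙 B) := by simp
  have h1 := (hB.whiskerLeft_lT F u).congr_iso (eqToIso e.symm)
  obtain ⟨⟨y, k, j⟩, a, b, hab⟩ := h1.exists_ne_zero hu.id_ne_zero
  have h2 := ((ℬ.isBasis _ _).splits (u ≫ (A ⊳ ℬ.mor B (ℬ.obj y) k))).whiskerRight F
    (A ⊳ ℬ.mor (ℬ.obj y) B j)
  have h3 := h2.congr_iso (v := u ≫ (A ⊳ (ℬ.mor B (ℬ.obj y) k ≫ ℬ.mor (ℬ.obj y) B j)))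
    (eqToIso (by simp))
  obtain ⟨i, a', b', hab'⟩ := h3.exists_comp_ne_zero hab
  exact ⟨y, i, j, ⟨(hu.iso (ℬ.endScalar_comp_lT (ℬ.endScalar i) (ℬ.endScalar j)) hab').choose⟩⟩

/-- Different second factors are orthogonal and leave no non-zero cell. For equal second factors
whiskering is full, and the first factors are compared inside one basis. -/
lemma decomposition_unique {X A B : C} {y y' : Fin ℬ.n} {i : Fin (ℬ.rk X (A * ℬ.obj y))}
    {j : Fin (ℬ.rk (ℬ.obj y) B)} {i' : Fin (ℬ.rk X (A * ℬ.obj y'))}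
    {j' : Fin (ℬ.rk (ℬ.obj y') B)}
    (e : ℬ.mor _ _ i ≫ (A ⊳ ℬ.mor _ _ j) ≅ ℬ.mor _ _ i' ≫ (A ⊳ ℬ.mor _ _ j')) :
    (⟨y, i, j⟩ : Σ y, Fin (ℬ.rk X (A * ℬ.obj y)) × Fin (ℬ.rk (ℬ.obj y) B)) = ⟨y', i', j'⟩ := by
  have h0 := (ℬ.endScalar_comp_lT (ℬ.endScalar i) (ℬ.endScalar j)).id_ne_zero
  have hne : e.hom ≠ 0 := fun h => h0 (by rw [← e.hom_inv_id, h, Limits.zero_comp])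
  have hj : (⟨y, j⟩ : Σ y, Fin (ℬ.rk (ℬ.obj y) B)) = ⟨y', j'⟩ := by
    by_contra hj
    refine hne (hom_eq_zero_of_comp_dual F ?_ e.hom)
    have h1 := congrArg (A ⊳₂ ·) (ℬ.comp_dual_eq_zero j' j (fun h => hj h.symm))
    rw [lT₂_id, lT_zero' F] at h1
    have : A ⊳ (ℬ.mor _ B j' ≫ (ℬ.mor _ B j)ᵃ) = (A ⊳ ℬ.mor _ B j') ≫ (A ⊳ ℬ.mor _ B j)ᵃ := by
      simp
    rwa [← this]
  cases hj
  obtain ⟨c, hc⟩ := exists_coiso (ℬ.unitSplit y) (ℬ.endScalar j)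
  suffices i = i' by rw [this]
  by_contra hi
  exact hne ((hc.lT A).hom_eq_zero ((ℬ.isBasis _ _).2.1 i i' hi) e.hom)

/-- The second factors are arbitrary scalar 1-morphisms here; replacing them by isomorphic basis
elements reduces to `decomposition_unique`. -/
lemma cancel_lT {X A B : C} {y y' : Fin ℬ.n} {i : Fin (ℬ.rk X (A * ℬ.obj y))}
    {i' : Fin (ℬ.rk X (A * ℬ.obj y'))} {h : ℬ.obj y ⟶ B} {h' : ℬ.obj y' ⟶ B}
    (hh : EndScalar F h) (hh' : EndScalar F h')
    (e : ℬ.mor _ _ i ≫ (A ⊳ h) ≅ ℬ.mor _ _ i' ≫ (A ⊳ h')) :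
    ∃ hy : y' = y, hy ▸ i' = i ∧ Nonempty (h ≅ eqToHom (by rw [hy]) ≫ h') := by
  obtain ⟨j, ⟨ej⟩⟩ := ℬ.exists_mor_iso hh
  obtain ⟨j', ⟨ej'⟩⟩ := ℬ.exists_mor_iso hh'
  have := ℬ.decomposition_unique ((whiskerLeftIso _ (lTIso A ej)).symm ≪≫ e ≪≫
    whiskerLeftIso _ (lTIso A ej'))
  cases this
  exact ⟨rfl, rfl, ⟨ej ≪≫ ej'.symm ≪≫ eqToIso (by simp)⟩⟩

/-! ### The dimension -/

lemma isNonzero_isSimple (x : Fin ℬ.n) : IsNonzero (ℬ.obj x) ∧ IsSimple F (ℬ.obj x) :=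
  ⟨ℬ.obj_nonzero x, by
    have h := ℬ.isBasis (ℬ.obj x) (ℬ.obj x)
    have h1 := ℬ.rk_obj_self x
    exact ⟨fun i => ℬ.mor _ _ (Fin.cast h1.symm i), fun i => h.1 _, fun i j hij => h.2.1 _ _ fun e => hij
      (Fin.cast_injective _ e), fun X => by
        obtain ⟨m, k, b, hb⟩ := h.2.2 X
        exact ⟨m, fun a => Fin.cast h1 (k a), b, hb⟩⟩⟩

/-- Rank one of `End(A)` leaves a single composite `A ⟶ X ⟶ A` of basis elements. Let `q : X ⟶ A` be
its second factor. Then `q ≫ qᵃ ≅ 𝟙` because the unit of `q` is unitary up to a scalar, and `𝟙 A`, a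
non-zero retract of the scalar 1-morphism `qᵃ ≫ q`, is isomorphic to it. -/
lemma nonempty_equivalence {A : C} (hA : IsNonzero A) (hs : IsSimple F A) :
    ∃ x, Nonempty (ℬ.obj x ≌ A) := by
  obtain ⟨s, hs⟩ := hs
  have hb := ℬ.semisimple A A _ _ _ _ (fun x => ℬ.isBasis A (ℬ.obj x))
      (fun x => ℬ.isBasis (ℬ.obj x) A)
  have hc := hb.card_eq hs
  rw [Fintype.card_fin, Fintype.card_eq_one_iff] at hc
  obtain ⟨⟨x, i, j⟩, ht⟩ := hc
  refine ⟨x, ?_⟩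
  set q := ℬ.mor (ℬ.obj x) A j
  have hq : EndScalar F q := ℬ.endScalar j
  obtain ⟨c, hc⟩ := exists_coiso (ℬ.unitSplit x) hq
  obtain ⟨k, ⟨ek⟩⟩ := ℬ.exists_mor_iso hq.dual
  have hk : k = i := by have := ht ⟨x, k, j⟩; simpa using this
  subst hk
  have hsp : SplitsThrough (fun _ : Unit => qᵃ ≫ q) (𝟙 A) :=
    (hb.splits (𝟙 A)).of_iso fun t => ⟨(), ⟨eqToIso (by rw [ht t]) ≪≫ (whiskerRightIso ek q).symm⟩⟩
  have hqq : EndScalar F (qᵃ ≫ q) :=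
    EndScalar.of_iso (hb.endScalar ⟨x, k, j⟩) (whiskerRightIso ek q).symm
  have h1 : 𝟙 (𝟙 A) ≠ 0 := fun h0 => by
    obtain ⟨f, hf⟩ := hA
    refine hf ((isZero_iff_id f).2 ?_)
    calc 𝟙 f = (λ_ f).inv ≫ 𝟙 (𝟙 A) ▷ f ≫ (λ_ f).hom := by simp
      _ = 0 := by rw [h0, zero_whiskerRight' F]; simp
  obtain ⟨m, k', a, b, hab⟩ := hsp
  have ha : ∀ l, ∃ r : F, a l = r • epsD q := fun l => by
    obtain ⟨b', hb'⟩ := exists_eq_epsD (a l)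
    obtain ⟨r, rfl⟩ := hq.dual.exists_smul b'
    exact ⟨r, by rw [hb', smul_id_whiskerRight, Linear.comp_smul, Category.comp_id]⟩
  choose r hr using ha
  obtain ⟨e⟩ := hqq.retract_iso (a := epsD q) (b := ∑ l, r l • b l) (u := 𝟙 A) (by
    rw [← hab, Preadditive.comp_sum]
    refine Finset.sum_congr rfl fun l _ => ?_
    rw [hr l, Linear.comp_smul, Linear.smul_comp]) h1
  let u : 𝟙 (ℬ.obj x) ≅ q ≫ qᵃ :=
    { hom := iota q
      inv := c⁻¹ • iotaD q
      hom_inv_id := by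
        have h2 : iota q ≫ iotaD q = c • 𝟙 _ := hc.norm
        rw [Linear.comp_smul, h2, smul_smul, inv_mul_cancel₀ hc.ne_zero, one_smul]
      inv_hom_id := by
        rw [Linear.smul_comp, hc.conorm, smul_smul, inv_mul_cancel₀ hc.ne_zero, one_smul] }
  exact ⟨Bicategory.Equivalence.mkOfAdjointifyCounit u e.symm⟩

lemma dimension_eq : dimension F C = ℬ.n := by
  have e : Function.Bijective fun x : Fin ℬ.n => Quot.mk
      (fun A B : {A : C // IsNonzero A ∧ IsSimple F A} => Nonempty (A.1 ≌ B.1))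
      ⟨ℬ.obj x, ℬ.isNonzero_isSimple x⟩ := by
    constructor
    · intro x y hxy
      have inv : ∀ {A B : C} (e : A ≌ B), (∃ f : ℬ.obj x ⟶ A, 𝟙 f ≠ 0) →
          ∃ f : ℬ.obj x ⟶ B, 𝟙 f ≠ 0 := by
        rintro A B e ⟨f, hf⟩
        refine ⟨f ≫ e.hom, fun h => hf ?_⟩
        calc 𝟙 f = (ρ_ f).inv ≫ f ◁ e.unit.hom ≫ (α_ _ _ _).inv ≫ 𝟙 (f ≫ e.hom) ▷ e.inv ≫
              (α_ _ _ _).hom ≫ f ◁ e.unit.inv ≫ (ρ_ f).hom := by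
                rw [id_whiskerRight, Category.id_comp, Iso.inv_hom_id_assoc,
                  ← whiskerLeft_comp_assoc, e.unit.hom_inv_id]; simp
          _ = 0 := by rw [h, zero_whiskerRight' F]; simp
      have inv' : ∀ {A B : C} (e : A ≌ B), (∃ f : ℬ.obj x ⟶ B, 𝟙 f ≠ 0) →
          ∃ f : ℬ.obj x ⟶ A, 𝟙 f ≠ 0 := by
        rintro A B e ⟨f, hf⟩
        refine ⟨f ≫ e.inv, fun h => hf ?_⟩
        calc 𝟙 f = (ρ_ f).inv ≫ f ◁ e.counit.inv ≫ (α_ _ _ _).inv ≫ 𝟙 (f ≫ e.inv) ▷ e.hom ≫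
              (α_ _ _ _).hom ≫ f ◁ e.counit.hom ≫ (ρ_ f).hom := by
                rw [id_whiskerRight, Category.id_comp, Iso.inv_hom_id_assoc,
                  ← whiskerLeft_comp_assoc, e.counit.inv_hom_id]; simp
          _ = 0 := by rw [h, zero_whiskerRight' F]; simp
      -- Equality in `Quot` only gives the generated equivalence relation, so classes are separated
      -- by an invariant: whether a non-zero 1-morphism from the member `x` exists.
      let P : Quot (fun A B : {A : C // IsNonzero A ∧ IsSimple F A} => Nonempty (A.1 ≌ B.1)) → Prop :=
        Quot.lift (fun A => ∃ f : ℬ.obj x ⟶ A.1, 𝟙 f ≠ 0)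
          fun A B ⟨e⟩ => propext ⟨inv e, inv' e⟩
      have h1 : ∃ f : ℬ.obj x ⟶ ℬ.obj x, 𝟙 f ≠ 0 := by
        obtain ⟨f, hf⟩ := ℬ.obj_nonzero x
        exact ⟨f, fun h => hf ((isZero_iff_id f).2 h)⟩
      have h2 : ∃ f : ℬ.obj x ⟶ ℬ.obj y, 𝟙 f ≠ 0 := (congrArg P hxy).mp h1
      by_contra hne
      obtain ⟨f, hf⟩ := h2
      exact hf (ℬ.id_eq_zero_of_ne hne f)
    · rintro ⟨⟨A, hA, hs⟩⟩
      obtain ⟨x, e⟩ := ℬ.nonempty_equivalence hA hs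
      exact ⟨x, Quot.sound e⟩
  rw [dimension, ← Nat.card_eq_of_bijective _ e, Nat.card_fin]

end SimpleBases

/-! ### Admissible labels of tetrahedra -/

/-- The two 1-morphisms attached to a tetrahedron are isomorphic. -/
def Tet {eij eik eil ejk ejl ekl : C} (fijk : eik ⟶ ejk * eij) (fijl : eil ⟶ ejl * eij)
    (fikl : eil ⟶ ekl * eik) (fjkl : ejl ⟶ ekl * ejk) : Prop :=
  Nonempty (fL fijk fikl ≅ fR fijl fjkl)

namespace SimpleBases

variable (ℬ : SimpleBases F C)

section

variable {eij eik eil eim ejk ejl ejm ekl ekm elm : Fin ℬ.n}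
  {fijk : ℬ.Face eij ejk eik} {fijl : ℬ.Face eij ejl eil} {fijm : ℬ.Face eij ejm eim}
  {fikl : ℬ.Face eik ekl eil} {fikm : ℬ.Face eik ekm eim} {film : ℬ.Face eil elm eim}
  {fjkl : ℬ.Face ejk ekl ejl} {fjkm : ℬ.Face ejk ekm ejm} {fjlm : ℬ.Face ejl elm ejm}
  {fklm : ℬ.Face ekl elm ekm}

lemma endScalar_fL : EndScalar F (fL (ℬ.face fijk) (ℬ.face fikl)) :=
  ℬ.endScalar_comp_lT (ℬ.endScalar _) (ℬ.endScalar _)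

lemma endScalar_fR : EndScalar F (fR (ℬ.face fijl) (ℬ.face fjkl)) := by
  obtain ⟨c, hc⟩ := exists_coiso (ℬ.unitSplit _) (ℬ.endScalar fjkl)
  exact ((hc.rT (ℬ.obj eij)).congr (arr_comp_eqToHom _ _).symm).endScalar_comp (ℬ.endScalar fijl)

lemma exists_tet_fL (fijl : ℬ.Face eij ejl eil) (fjkl : ℬ.Face ejk ekl ejl) :
    ∃ (eik : Fin ℬ.n) (fikl : ℬ.Face eik ekl eil) (fijk : ℬ.Face eij ejk eik),
      Tet (ℬ.face fijk) (ℬ.face fijl) (ℬ.face fikl) (ℬ.face fjkl) := by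
  obtain ⟨y, i, j, ⟨e⟩⟩ := ℬ.exists_decomposition (ℬ.endScalar_fR (fijl := fijl) (fjkl := fjkl))
  exact ⟨y, i, j, ⟨e.symm⟩⟩

lemma tet_fL_unique {eik' : Fin ℬ.n} {fikl' : ℬ.Face eik' ekl eil} {fijk' : ℬ.Face eij ejk eik'}
    (h : Tet (ℬ.face fijk) (ℬ.face fijl) (ℬ.face fikl) (ℬ.face fjkl))
    (h' : Tet (ℬ.face fijk') (ℬ.face fijl) (ℬ.face fikl') (ℬ.face fjkl)) :
    (⟨eik, fikl, fijk⟩ : Σ eik : Fin ℬ.n, ℬ.Face eik ekl eil × ℬ.Face eij ejk eik) =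
      ⟨eik', fikl', fijk'⟩ := by
  obtain ⟨e⟩ := h
  obtain ⟨e'⟩ := h'
  exact ℬ.decomposition_unique (e ≪≫ e'.symm)

/-- Three admissible tetrahedra and a tensorator give an isomorphism between composites ending in
`e_lm ⊗ -`. Decomposing `f_{i(jlm)}` and cancelling the common first factor produces `fijl` and the
two missing tetrahedra. -/
lemma exists_tet_pentagon (h₁ : Tet (ℬ.face fikl) (ℬ.face fikm) (ℬ.face film) (ℬ.face fklm))
    (h₂ : Tet (ℬ.face fijk) (ℬ.face fijm) (ℬ.face fikm) (ℬ.face fjkm))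
    (h₃ : Tet (ℬ.face fjkl) (ℬ.face fjkm) (ℬ.face fjlm) (ℬ.face fklm)) :
    ∃ fijl : ℬ.Face eij ejl eil,
      Tet (ℬ.face fijk) (ℬ.face fijl) (ℬ.face fikl) (ℬ.face fjkl) ∧
      Tet (ℬ.face fijl) (ℬ.face fijm) (ℬ.face film) (ℬ.face fjlm) := by
  obtain ⟨e₁⟩ := h₁
  obtain ⟨e₂⟩ := h₂
  obtain ⟨e₃⟩ := h₃
  let E : ℬ.face film ≫ (ℬ.obj elm ⊳ fL (ℬ.face fijk) (ℬ.face fikl)) ≅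
      (fR (ℬ.face fijm) (ℬ.face fjlm)) ≫ (ℬ.obj elm ⊳ rTa (ℬ.face fjkl) (ℬ.obj eij)) :=
    eqToIso (by simp) ≪≫ whiskerRightIso e₁ (ℬ.obj elm ⊳ (ℬ.obj ekl ⊳ ℬ.face fijk)) ≪≫
      eqToIso (by simp) ≪≫ whiskerLeftIso (ℬ.face fikm)
        (asIso (tenc (ℬ.face fklm) (ℬ.face fijk))) ≪≫ eqToIso (by simp) ≪≫
      whiskerRightIso e₂ (rTa (ℬ.face fklm) (ℬ.obj ejk * ℬ.obj eij)) ≪≫ eqToIso (by simp [rTa]) ≪≫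
      whiskerRightIso (whiskerLeftIso (ℬ.face fijm) (rTIso e₃.symm (ℬ.obj eij)))
        (eqToHom (show ℬ.obj elm * (ℬ.obj ekl * ℬ.obj ejk) * ℬ.obj eij =
          ℬ.obj elm * (ℬ.obj ekl * (ℬ.obj ejk * ℬ.obj eij)) by simp [mul_assoc])) ≪≫
      eqToIso (by simp)
  -- The decomposition comes with its own edge label `y` and face label `i`; cancellation identifies
  -- them with `eil` and `film`.
  obtain ⟨y, i, j, ⟨e⟩⟩ := ℬ.exists_decomposition (ℬ.endScalar_fR (fijl := fijm) (fjkl := fjlm))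
  obtain ⟨hy, hi, ⟨e'⟩⟩ := ℬ.cancel_lT (i' := i) (ℬ.endScalar_fL (fijk := fijk) (fikl := fikl))
    (ℬ.endScalar_fR (fijl := j) (fjkl := fjkl))
    (E ≪≫ whiskerRightIso e _ ≪≫ eqToIso (by simp))
  subst hy
  dsimp only at hi
  subst hi
  exact ⟨j, ⟨e' ≪≫ eqToIso (by simp)⟩, ⟨e.symm⟩⟩

end

end SimpleBases

section NonDeg

variable [NonDegenerate F C]

-- The pairing of `α` with `β` depends only on `α ≫ β`, so a cell all of whose composites vanish
-- lies in the radical.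
variable (F) in
include F in
lemma exists_comp_ne_zero {A B : C} {f g : A ⟶ B} {α : f ⟶ g} (h : α ≠ 0) :
    ∃ β : g ⟶ f, α ≫ β ≠ 0 := by
  by_contra! hα
  refine h ((NonDegenerate.nondegenerate (F := F) f g).1 α fun β => ?_)
  have h1 : pairing F f g α β = pairing F f f (α ≫ β) (𝟙 f) := by
    simp [pairing, pairing₀]
  rw [h1, hα, map_zero, LinearMap.zero_apply]

lemma EndScalar.iso_of_ne_zero {A B : C} {f g : A ⟶ B} (hf : EndScalar F f) (hg : EndScalar F g)
    {α : f ⟶ g} (h : α ≠ 0) : ∃ e : f ≅ g, e.hom = α := by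
  obtain ⟨β, hβ⟩ := exists_comp_ne_zero F h
  exact hf.iso hg hβ

/-- A non-zero element would be an isomorphism between the two scalar 1-morphisms of the
tetrahedron. -/
lemma SimpleBases.subsingleton_twoH (ℬ : SimpleBases F C) {eij eik eil ejk ejl ekl : Fin ℬ.n}
    {fijk : ℬ.Face eij ejk eik} {fijl : ℬ.Face eij ejl eil} {fikl : ℬ.Face eik ekl eil}
    {fjkl : ℬ.Face ejk ekl ejl}
    (h : ¬ Tet (ℬ.face fijk) (ℬ.face fijl) (ℬ.face fikl) (ℬ.face fjkl)) :
    Subsingleton (twoH (ℬ.face fijk) (ℬ.face fijl) (ℬ.face fikl) (ℬ.face fjkl)) := by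
  refine subsingleton_of_forall_eq 0 fun α => ?_
  by_contra hα
  exact h ⟨(EndScalar.iso_of_ne_zero ℬ.endScalar_fL ℬ.endScalar_fR hα).choose⟩

end NonDeg

end Labels

/-! ### Quantum dimensions -/

section Dimensions

variable {C : Type u} [Bicategory.{w, v} C] [Bicategory.Strict C]
  [SemiStrictMonoidal C] [DualStructure C] [HasDuals C]

variable [∀ A B : C, Preadditive (A ⟶ B)]

lemma dagger_comp_dagger {A B : C} {f g : A ⟶ B} {α : f ⟶ g} {β : g ⟶ f} (h : β ≫ α = 𝟙 g) :
    dagger α ≫ dagger β = 𝟙 gᵃ := by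
  refine eq_of_iota_whiskerLeft ?_
  rw [whiskerLeft_comp, ← Category.assoc, iota_dagger, Category.assoc, ← whisker_exchange,
    ← Category.assoc, iota_dagger, Category.assoc, ← comp_whiskerRight, h]
  simp

/-- The isomorphism of duals induced by an isomorphism of 1-morphisms. -/
def dualIso {A B : C} {f g : A ⟶ B} (e : f ≅ g) : gᵃ ≅ fᵃ where
  hom := dagger e.hom
  inv := dagger e.inv
  hom_inv_id := dagger_comp_dagger e.inv_hom_id
  inv_hom_id := dagger_comp_dagger e.hom_inv_id

/-- Closing the strand `f ⊲ Aᵛ` first leaves `trB f (α ≫ β) ⊲₂ Aᵛ` inside the loop of `coev A`.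
Hence the targets of the two 1-morphisms may differ. -/
lemma pairing₀_eq_of_trB {A B B' : C} {f g : A ⟶ B} {f' g' : A ⟶ B'} {α : f ⟶ g} {β : g ⟶ f}
    {α' : f' ⟶ g'} {β' : g' ⟶ f'} (h : trB f (α ≫ β) = trB f' (α' ≫ β')) :
    pairing₀ α β = pairing₀ α' β' := by
  rw [pairing₀_eq, pairing₀_eq, trB_comp, trB_comp, rtr_whiskerLeft, rtr_whiskerLeft]
  have e : Cell (trB (f ⊲ Aᵛ) ((α ≫ β) ⊲₂ Aᵛ)) = Cell (trB (f' ⊲ Aᵛ) ((α' ≫ β') ⊲₂ Aᵛ)) := by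
    rw [cell_trB_rT, cell_trB_rT, h]
  rw [eq_of_cell e]

variable {F : Type*} [Field F] [∀ A B : C, Linear F (A ⟶ B)]
  [VectLinear F C]

lemma pairing_apply {A B : C} {f g : A ⟶ B} (α : f ⟶ g) (β : g ⟶ f) :
    pairing F f g α β = scalar F (pairing₀ α β) := rfl

lemma pairing_eq_of_trB {A B B' : C} {f g : A ⟶ B} {f' g' : A ⟶ B'} {α : f ⟶ g} {β : g ⟶ f}
    {α' : f' ⟶ g'} {β' : g' ⟶ f'} (h : trB f (α ≫ β) = trB f' (α' ≫ β')) :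
    pairing F f g α β = pairing F f' g' α' β' := by
  rw [pairing_apply, pairing_apply, pairing₀_eq_of_trB h]

lemma pairing_comm {A B : C} {f g : A ⟶ B} (α : f ⟶ g) (β : g ⟶ f) :
    pairing F f g α β = pairing F g f β α :=
  pairing_eq_of_trB (trB_comm α β)

lemma pairing_eq_id {A B : C} {f g : A ⟶ B} (α : f ⟶ g) (β : g ⟶ f) :
    pairing F f g α β = pairing F f f (α ≫ β) (𝟙 f) :=
  pairing_eq_of_trB (by rw [Category.comp_id])

lemma pairing_eq_mul_dimObj {A B : C} {f g : A ⟶ B} {α : f ⟶ g} {β : g ⟶ f} {r : F}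
    (h : trB f (α ≫ β) = r • 𝟙 (𝟙 A)) : pairing F f g α β = r * dimObj F A := by
  rw [pairing_eq_of_trB (f' := 𝟙 A) (g' := 𝟙 A) (α' := r • 𝟙 (𝟙 A)) (β' := 𝟙 (𝟙 A)), map_smul]
  · rfl
  · rw [h, Category.comp_id, trB_smul, trB_id]

lemma pairing_id_trB {A B : C} {f : A ⟶ B} (x : f ⟶ f) :
    pairing F (𝟙 A) (𝟙 A) (trB f x) (𝟙 _) = pairing F f f x (𝟙 f) := by
  refine pairing_eq_of_trB ?_
  rw [Category.comp_id, Category.comp_id]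
  exact trB_id _

/-- The unit of `qᵃ` is the dual of the counit of `q`, so the paired cell is the loop of `qᵃ`. -/
lemma pairing_epsD_eps {A B : C} (q : A ⟶ B) :
    pairing F (𝟙 B) (𝟙 B) (epsD q ≫ eps q) (𝟙 _) = dimMor F qᵃ := by
  have e : epsD q ≫ eps q = trB qᵃ (𝟙 qᵃ) := by
    rw [trB, id_whiskerRight, Category.id_comp]
    have h1 : Cell (iota qᵃ) = Cell (epsD q) := cell_of_heq rfl (by simp) (HasDuals.iota_dual₁ q)
    refine eq_of_cell (Cell.comp_congr h1.symm ?_)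
    have := Cell.dual_congr h1
    rwa [epsD, HasDuals.dual₂_dual₂, eq_comm] at this
  rw [e, pairing_id_trB]; rfl

lemma NormIota.dimMor_eq {A B : C} {f : A ⟶ B} {c : F} (h : NormIota F f c) :
    dimMor F f = c * dimObj F A :=
  pairing_eq_mul_dimObj (by rw [Category.comp_id, normIota_iff.1 h])

lemma dimMor_congr_iso {A B : C} {f g : A ⟶ B} (e : f ≅ g) : dimMor F f = dimMor F g := by
  rw [dimMor, dimMor, pairing_eq_of_trB (f' := f) (g' := g) (α' := e.hom) (β' := e.inv) (by simp),
    pairing_comm, pairing_eq_of_trB]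
  simp

lemma scalar_smul_id (r : F) : scalar F (r • 𝟙 (𝟙 (1 : C))) = r := by
  have h := VectLinear.twoEnd_one (F := F) (r • 𝟙 (𝟙 (1 : C)))
  exact h.unique (scalar_spec F _) rfl

variable (F) in
lemma normIota_one_iff {B : C} (h : (1 : C) ⟶ B) (c : F) :
    NormIota F h c ↔ scalar F (iota h ≫ iotaD h) = c := by
  constructor
  · intro e
    rw [show iota h ≫ iotaD h = c • 𝟙 _ from e, scalar_smul_id]
  · rintro rfl
    exact scalar_spec F _

lemma pairing_id_id {A B : C} (f : A ⟶ B) :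
    dimMor F f = scalar F (iota (coev A ≫ (f ⊲ Aᵛ)) ≫ iotaD (coev A ≫ (f ⊲ Aᵛ))) := by
  rw [dimMor, pairing_apply, pairing₀_eq, Category.comp_id, rT₂_id, whiskerLeft_id, trB,
    id_whiskerRight, Category.id_comp]

lemma scalar_iota_congr {B B' : C} {h : (1 : C) ⟶ B} {h' : (1 : C) ⟶ B'} (e : Arr h = Arr h') :
    scalar F (iota h ≫ iotaD h) = scalar F (iota h' ≫ iotaD h') := by
  have : Cell (iota h ≫ iotaD h) = Cell (iota h' ≫ iotaD h') :=
    Cell.comp_congr (Cell.iota_congr e) (Cell.dual_congr (Cell.iota_congr e))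
  rw [eq_of_cell this]

/-- This turns object dimensions into loop values, which multiply under composition. -/
lemma normIota_coev (A : C) : NormIota F (coev A) (dimObj F A) := by
  rw [normIota_one_iff]
  refine Eq.trans ?_ (pairing_id_id (F := F) (𝟙 A)).symm
  exact scalar_iota_congr (by simp)

lemma arr_coev_mul (A B : C) : Arr (coev (A * B)) = Arr (coev A ≫ₛ ((A ⊳ coev B) ⊲ Aᵛ)) := by
  have h1 : A * B * (A * B)ᵛ = A * (B * Bᵛ) * Aᵛ := by rw [dual₀_mul]; simp [mul_assoc]
  have h := coev_mul A B
  generalize coev (A * B) = x at h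
  revert x
  rw [h1]
  intro x h
  rw [eq_of_heq h]

lemma dimObj_mul (A B : C) : dimObj F (A * B) = dimObj F A * dimObj F B := by
  refine ((normIota_one_iff F _ _).1 (normIota_coev (A * B))).symm.trans
    ((normIota_one_iff F _ _).1 ?_)
  refine NormIota.congr (arr_coev_mul A B).symm ?_
  refine (normIota_coev A).comp ?_
  refine NormIota.congr ?_ (((normIota_coev (F := F) B).lT A).rT Aᵛ)
  exact (arr_eqToHom_comp _ _).symm

/-- `thetaR` carries the cap of `f` to the cap of `fᵃ` and is compatible with the cups, so the two
closed loops agree. -/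
lemma dimMor_dual [Pivotal C] [Consistent C] {A B : C} (f : A ⟶ B) :
    dimMor F fᵃ = dimMor F f := by
  have h : ∀ {A B : C} (f : A ⟶ B), pairing₀ (𝟙 f) (𝟙 f) = capR f ≫ cupR f := fun f => by
    rw [pairing₀, Category.comp_id, TrR₂, id_whiskerRight, rT₂_id, id_whiskerRight,
      whiskerLeft_id, Category.id_comp]
  rw [dimMor, dimMor, pairing_apply, pairing_apply, h, h, ← Consistent.theta_cupR f, vcomp,
    ← Category.assoc (capR f), Consistent.capR_theta, vcomp]
  simp

/-- The loop of `coev Aᵛ` is the left loop of `𝟙 A` and that of `coev A` the right one; `sigma`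
exchanges them. -/
lemma dimObj_dual [IsSpherical C] (A : C) : dimObj F Aᵛ = dimObj F A := by
  have h : capL (𝟙 A) ≫ cupL (𝟙 A) = capR (𝟙 A) ≫ cupR (𝟙 A) := by
    have h1 := IsSpherical.capL_sigma A
    have h2 := IsSpherical.sigma_cupR A
    have e : TrL (𝟙 A) = TrL (𝟙 A ≫ (𝟙 A)ᵃ) := by simp
    have e' : TrR (𝟙 A) = TrR (𝟙 A ≫ (𝟙 A)ᵃ) := by simp
    calc capL (𝟙 A) ≫ cupL (𝟙 A) = capL (𝟙 A) ≫ eqToHom e.symm ≫ 𝟙 _ ≫ eqToHom e ≫ cupL (𝟙 A) := by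
          simp
      _ = (capL (𝟙 A) ≫ eqToHom e.symm ≫ IsSpherical.sigma (𝟙 A)) ≫ eqToHom e' ≫ cupR (𝟙 A) := by
          rw [show 𝟙 _ ≫ eqToHom e ≫ cupL (𝟙 A) = _ from h2.symm]
          simp [vcomp]
      _ = _ := by
          rw [show capL (𝟙 A) ≫ eqToHom e.symm ≫ IsSpherical.sigma (𝟙 A) = _ from h1]
          simp [vcomp]
  have hL : capL (𝟙 A) ≫ cupL (𝟙 A) = iota (coev Aᵛ) ≫ iotaD (coev Aᵛ) := by
    refine eq_of_cell (Cell.comp_congr ?_ ?_)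
    · rw [capL, vcomp, Category.comp_id, cell_comp_eqToHom]
      exact Cell.iota_congr (by simp)
    · rw [cupL, vcomp]
      refine (congrArg Cell (Category.id_comp _)).trans ?_
      rw [cell_eqToHom_comp]
      exact Cell.dual_congr (Cell.iota_congr (by simp))
  have hR : capR (𝟙 A) ≫ cupR (𝟙 A) = iota (coev A) ≫ iotaD (coev A) := by
    refine eq_of_cell (Cell.comp_congr ?_ ?_)
    · rw [capR, vcomp, Category.comp_id, cell_comp_eqToHom]
      exact Cell.iota_congr (by simp)
    · rw [cupR, vcomp]
      refine (congrArg Cell (Category.id_comp _)).trans ?_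
      rw [cell_eqToHom_comp]
      exact Cell.dual_congr (Cell.iota_congr (by simp))
  have h1 := (normIota_one_iff F _ _).1 (normIota_coev (F := F) Aᵛ)
  rw [← h1, ← hL, h, hR]
  exact (normIota_one_iff F _ _).1 (normIota_coev A)

section NonDeg

variable [NonDegenerate F C]

lemma dimMor_ne_zero {A B : C} {f : A ⟶ B} (hf : EndScalar F f) : dimMor F f ≠ 0 := by
  intro h
  refine hf.id_ne_zero ((NonDegenerate.nondegenerate (F := F) f f).1 _ fun β => ?_)
  obtain ⟨r, rfl⟩ := hf.exists_smul β
  rw [map_smul, show pairing F f f (𝟙 f) (𝟙 f) = 0 from h, smul_zero]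

variable (ℬ : SimpleBases F C)

namespace SimpleBases

lemma dimObj_ne_zero (x : Fin ℬ.n) : dimObj F (ℬ.obj x) ≠ 0 :=
  dimMor_ne_zero (ℬ.unitSplit x).scalar

/-- Taking traces determines the scalar of `exists_coiso`. -/
lemma coiso {x : Fin ℬ.n} {B : C} {f : ℬ.obj x ⟶ B} (hf : EndScalar F f) :
    Coiso F f (dimMor F f / dimObj F (ℬ.obj x)) := by
  obtain ⟨c, hc⟩ := exists_coiso (ℬ.unitSplit x) hf
  rw [hc.norm.dimMor_eq, mul_div_cancel_right₀ _ (ℬ.dimObj_ne_zero x)]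
  exact hc

variable [Pivotal C] [Consistent C]

/-- `qᵃ ≫ q` is scalar, so the composite is a number `s`; computing the dimension of `qᵃ` through it
gives `s * d = 1`. -/
lemma eps_epsD {x : Fin ℬ.n} {B : C} {q : ℬ.obj x ⟶ B} (hq : EndScalar F q) :
    eps q ≫ epsD q = (dimMor F q / dimObj F (ℬ.obj x))⁻¹ • 𝟙 (qᵃ ≫ q) := by
  have hc := ℬ.coiso hq
  set d := dimMor F q / dimObj F (ℬ.obj x)
  obtain ⟨s, hs⟩ := (hc.endScalar_comp hq.dual).exists_smul (eps q ≫ epsD q)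
  have hd : dimMor F qᵃ ≠ 0 := dimMor_ne_zero hq.dual
  have h1 : dimMor F qᵃ = s * (d * dimMor F qᵃ) := by
    calc dimMor F qᵃ = pairing F _ _ (epsD q) (eps q) := by
          rw [pairing_eq_id, pairing_epsD_eps]
      _ = pairing F _ _ (s • 𝟙 (qᵃ ≫ q)) (𝟙 _) := by rw [pairing_comm, pairing_eq_id, hs]
      _ = s * pairing F (qᵃ ≫ q) (qᵃ ≫ q) (𝟙 _) (𝟙 _) := by
          rw [map_smul]; rfl
      _ = s * pairing F qᵃ qᵃ (d • 𝟙 qᵃ) (𝟙 _) := by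
          congr 1
          refine pairing_eq_of_trB ?_
          rw [Category.comp_id, Category.comp_id, ← id_whiskerRight, hc.norm.trB_whiskerRight,
            trB_smul]
      _ = _ := by rw [map_smul]; rfl
  have h2 : s * d = 1 := mul_right_cancel₀ hd (by rw [mul_assoc, ← h1, one_mul])
  rw [hs, eq_inv_of_mul_eq_one_left h2]

/-- The cells `d t • (epsD (q t) ≫ eps (q t))` are orthogonal idempotents with sum `𝟙 B`. Their
traces are `d t * dimMor F (q t)`, since `q` and its dual have equal dimension. -/
lemma dimObj_eq_sum (B : C) : dimObj F B = ∑ x, ∑ i : Fin (ℬ.rk (ℬ.obj x) B),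
    dimMor F (ℬ.mor (ℬ.obj x) B i) ^ 2 / dimObj F (ℬ.obj x) := by
  let q := fun t : Σ x, Fin (ℬ.rk (ℬ.obj x) B) => ℬ.mor (ℬ.obj t.1) B t.2
  let d := fun t => dimMor F (q t) / dimObj F (ℬ.obj t.1)
  have hq : ∀ t, EndScalar F (q t) := fun t => ℬ.endScalar t.2
  have hd : ∀ t, d t ≠ 0 := fun t => (ℬ.coiso (hq t)).ne_zero
  let E : 𝟙 B ⟶ 𝟙 B := ∑ t, d t • (epsD (q t) ≫ eps (q t))
  have hE : ∀ t, (epsD (q t) ≫ eps (q t)) ≫ E = epsD (q t) ≫ eps (q t) := fun t => by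
    rw [Preadditive.comp_sum, Finset.sum_eq_single t]
    · have h1 : eps (q t) ≫ epsD (q t) ≫ eps (q t) = (d t)⁻¹ • eps (q t) := by
        rw [← Category.assoc, ℬ.eps_epsD (hq t), Linear.smul_comp, Category.id_comp]
      rw [Linear.comp_smul, Category.assoc, h1, Linear.comp_smul, smul_smul,
        mul_inv_cancel₀ (hd t), one_smul]
    · intro t' _ ht
      have h1 : eps (q t) ≫ epsD (q t') = 0 :=
        hom_eq_zero_of_comp_dual F (ℬ.comp_dual_eq_zero t'.2 t.2 ht) _
      rw [Linear.comp_smul, Category.assoc, ← Category.assoc (eps (q t)), h1]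
      simp
    · simp
  -- By mates every term of a splitting of `𝟙 B` is a multiple of some `epsD q ≫ eps q`, and these
  -- are fixed by `E`.
  have h1 : E = 𝟙 _ := by
    obtain ⟨m, k, a, b, hab⟩ := (ℬ.semisimple B B _ _ _ _ (fun x => ℬ.isBasis B (ℬ.obj x))
      (fun x => ℬ.isBasis (ℬ.obj x) B)).splits (𝟙 B)
    rw [← Category.id_comp E, ← hab, Preadditive.sum_comp]
    refine Finset.sum_congr rfl fun j _ => ?_
    obtain ⟨a', ha'⟩ := exists_eq_epsD (a j)
    obtain ⟨b', hb'⟩ := exists_eq_epsD (dual₂ (b j))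
    have hb : b j = dual₂ b' ▷ q ⟨(k j).1, (k j).2.2⟩ ≫ eps (q ⟨(k j).1, (k j).2.2⟩) := by
      refine dual₂_inj ?_
      rw [hb', HasDuals.dual₂_comp, dual₂_whiskerRight, HasDuals.dual₂_dual₂]
    obtain ⟨r, hr⟩ := (hq ⟨(k j).1, (k j).2.2⟩).dual.exists_smul (a' ≫ dual₂ b')
    have : a j ≫ b j = r • (epsD (q ⟨(k j).1, (k j).2.2⟩) ≫ eps (q ⟨(k j).1, (k j).2.2⟩)) := by
      rw [ha', hb, Category.assoc, ← comp_whiskerRight_assoc, hr, smul_id_whiskerRight]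
      simp [q]
    rw [this, Linear.smul_comp, hE]
  have h2 : ∀ t, pairing F (𝟙 B) (𝟙 B) (epsD (q t) ≫ eps (q t)) (𝟙 _) = dimMor F (q t) := fun t => by
    rw [pairing_epsD_eps, dimMor_dual]
  calc dimObj F B = pairing F (𝟙 B) (𝟙 B) E (𝟙 _) := by rw [h1]; rfl
    _ = ∑ t, d t * dimMor F (q t) := by
      rw [map_sum, LinearMap.sum_apply]
      refine Finset.sum_congr rfl fun t _ => ?_
      rw [map_smul, LinearMap.smul_apply, h2, smul_eq_mul]
    _ = _ := by
      rw [Fintype.sum_sigma]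
      refine Finset.sum_congr rfl fun x _ => Finset.sum_congr rfl fun i _ => ?_
      simp only [d, q]; ring

end SimpleBases

end NonDeg

end Dimensions

/-! ### Bending a leg of a 1-morphism -/

section Bend

variable {C : Type u} [Bicategory.{w, v} C] [Bicategory.Strict C]
  [SemiStrictMonoidal C] [DualStructure C] [HasDuals C]

/-- The mate of `h : X ⊗ Y ⟶ Z` under the duality between `Y` and `Y*`. -/
abbrev bend {X Y Z : C} (h : X * Y ⟶ Z) : X ⟶ Z * Yᵛ :=
  eqToHom (mul_one X).symm ≫ (X ⊳ coev Y) ≫ eqToHom (mul_assoc X Y Yᵛ).symm ≫ (h ⊲ Yᵛ)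

/-- The mate of `q : X ⟶ Z ⊗ Y*` under the duality between `Y` and `Y*`. -/
abbrev unbend {X Y Z : C} (q : X ⟶ Z * Yᵛ) : X * Y ⟶ Z :=
  (q ⊲ Y) ≫ eqToHom (mul_assoc Z Yᵛ Y) ≫ (Z ⊳ ev Y) ≫ eqToHom (mul_one Z)

/-- `unbend` on 2-morphisms. -/
def unbend₂ {X Y Z : C} {q q' : X ⟶ Z * Yᵛ} (θ : q ⟶ q') : unbend q ⟶ unbend q' :=
  (θ ⊲₂ Y) ▷ _

lemma unbend₂_id {X Y Z : C} (q : X ⟶ Z * Yᵛ) : unbend₂ (𝟙 q) = 𝟙 (unbend q) := by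
  rw [unbend₂, rT₂_id, id_whiskerRight]

/-- `unbend` preserves isomorphisms. -/
def unbendIso {X Y Z : C} {q q' : X ⟶ Z * Yᵛ} (e : q ≅ q') : unbend q ≅ unbend q' :=
  whiskerRightIso (rTIso e Y) _

/-- The triangulator is invertible. -/
def triIso (A : C) : 𝟙 A ≫ₛ (coev A ⊲ A) ≫ₛ (A ⊳ ev A) ≫ₛ 𝟙 A ≅ 𝟙 A where
  hom := tri A
  inv := dual₂ (tri A)
  hom_inv_id := (HasDuals.tri_unitary A).1
  inv_hom_id := (HasDuals.tri_unitary A).2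

/-- `unbend` is left inverse to `bend` up to isomorphism. -/
def unbendBend {X Y Z : C} (h : X * Y ⟶ Z) : unbend (bend h) ≅ h :=
  eqToIso (by simp [unbend, bend]) ≪≫
    whiskerLeftIso (eqToHom (show X * Y = X * (1 * Y) by simp) ≫ (X ⊳ (coev Y ⊲ Y)) ≫
        eqToHom (show X * (Y * Yᵛ * Y) = X * Y * (Yᵛ * Y) by simp [mul_assoc]))
      (whiskerRightIso (SemiStrictMonoidal.ten h (ev Y)) (eqToHom (mul_one Z))) ≪≫
    eqToIso (by simp) ≪≫ whiskerRightIso (lTIso X (triIso Y)) h ≪≫ eqToIso (by simp)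

variable [∀ A B : C, Preadditive (A ⟶ B)]

/-- The other triangle identity, up to isomorphism. -/
def triDualIso (Y : C) :
    eqToHom (mul_one Yᵛ).symm ≫ (Yᵛ ⊳ coev Y) ≫ eqToHom (mul_assoc Yᵛ Y Yᵛ).symm ≫ (ev Y ⊲ Yᵛ) ≫
      eqToHom (one_mul Yᵛ) ≅ 𝟙 Yᵛ :=
  eqToIso (by simp) ≪≫ (dualIso (triIso Yᵛ)).symm ≪≫ eqToIso (by simp)

lemma eq_of_whiskerRight {A B : C} {f g : A ⟶ B} {k : B ⟶ B} (e : k ≅ 𝟙 B) {θ θ' : f ⟶ g}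
    (h : θ ▷ k = θ' ▷ k) : θ = θ' := by
  have key : ∀ θ : f ⟶ g, θ = (ρ_ f).inv ≫ f ◁ e.inv ≫ θ ▷ k ≫ g ◁ e.hom ≫ (ρ_ g).hom := fun θ => by
    rw [← whisker_exchange_assoc, ← whiskerLeft_comp_assoc, e.inv_hom_id]; simp
  rw [key θ, key θ', h]

/-- Bending the strand back and moving `θ` across `coev Y` by naturality of the tensorator
determines `θ` whiskered by the zigzag 1-morphism, which is isomorphic to an identity by the
triangulator. -/
lemma unbend₂_injective {X Y Z : C} {q q' : X ⟶ Z * Yᵛ} {θ θ' : q ⟶ q'}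
    (h : unbend₂ θ = unbend₂ θ') : θ = θ' := by
  let W : Z * Yᵛ * (Y * Yᵛ) ⟶ Z * Yᵛ :=
    eqToHom (by simp [mul_assoc]) ≫ (Z ⊳ (ev Y ⊲ Yᵛ)) ≫ eqToHom (by simp)
  have h1 : (θ ⊲₂ (Y * Yᵛ)) ▷ W = (θ' ⊲₂ (Y * Yᵛ)) ▷ W := by
    have key : ∀ θ : q ⟶ q', Cell ((θ ⊲₂ (Y * Yᵛ)) ▷ W) = Cell (unbend₂ θ ⊲₂ Yᵛ) := fun θ => by
      rw [unbend₂, cell_rT_whiskerRight]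
      refine Cell.whiskerRight_congr (cell_rT_mul _ _ _) ?_
      simp [W]
    exact eq_of_cell ((key θ).trans ((congrArg (fun x => Cell (x ⊲₂ Yᵛ)) h).trans (key θ').symm))
  have h2 : ∀ θ : q ⟶ q', (θ ⊲₂ 1) ▷ ((Z * Yᵛ) ⊳ coev Y) ≫ (SemiStrictMonoidal.ten q' (coev Y)).hom =
      (SemiStrictMonoidal.ten q (coev Y)).hom ≫ (X ⊳ coev Y) ◁ (θ ⊲₂ (Y * Yᵛ)) := fun θ => by
    have := ten_natural θ (𝟙 (coev Y))
    rwa [lT₂_id, lT₂_id, hcomp₂_id_right, hcomp₂_id_left] at this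
  have h3 : ((θ ⊲₂ 1) ▷ ((Z * Yᵛ) ⊳ coev Y)) ▷ W = ((θ' ⊲₂ 1) ▷ ((Z * Yᵛ) ⊳ coev Y)) ▷ W := by
    rw [← cancel_mono ((SemiStrictMonoidal.ten q' (coev Y)).hom ▷ W), ← comp_whiskerRight,
      ← comp_whiskerRight, h2, h2, comp_whiskerRight, comp_whiskerRight, whisker_assoc,
      whisker_assoc, h1]
  refine eq_of_whiskerRight (lTIso Z (triDualIso Y) ≪≫ eqToIso (lT_id Z Yᵛ)) ?_
  have key : ∀ θ : q ⟶ q', Cell (((θ ⊲₂ 1) ▷ ((Z * Yᵛ) ⊳ coev Y)) ▷ W) =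
      Cell (θ ▷ (Z ⊳ (eqToHom (mul_one Yᵛ).symm ≫ (Yᵛ ⊳ coev Y) ≫ eqToHom (mul_assoc Yᵛ Y Yᵛ).symm ≫
        (ev Y ⊲ Yᵛ) ≫ eqToHom (one_mul Yᵛ)))) := fun θ => by
    rw [← cell_whiskerRight_comp]
    refine Cell.whiskerRight_congr (cell_rT_one θ) ?_
    simp [W]
  exact eq_of_cell ((key θ).symm.trans ((congrArg Cell h3).trans (key θ')))

variable {F : Type*} [Field F] [∀ A B : C, Linear F (A ⟶ B)] [VectLinear F C]

lemma endScalar_bend {X Y Z : C} {h : X * Y ⟶ Z} (hh : EndScalar F h) :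
    EndScalar F (bend h) := by
  have h1 := hh.of_iso (unbendBend h).symm
  refine EndScalar.of (fun θ => ?_) fun h0 => h1.id_ne_zero ?_
  · obtain ⟨r, hr⟩ := h1.exists_smul (unbend₂ θ)
    refine ⟨r, unbend₂_injective ?_⟩
    rw [hr, ← unbend₂_id, unbend₂, unbend₂, VectLinear.rT₂_smul, VectLinear.whiskerRight_smul]
  · rw [← unbend₂_id, h0, unbend₂, zero_rT' F, zero_whiskerRight' F]

/-- Both dimensions are values of loops around the same 1-morphism, because `coev (X * Y)` is `coev
X` followed by the tensored `coev Y`. -/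
lemma dimMor_bend {X Y Z : C} (h : X * Y ⟶ Z) : dimMor F (bend h) = dimMor F h := by
  rw [pairing_id_id, pairing_id_id]
  refine scalar_iota_congr ?_
  have h1 : Arr (h ⊲ (X * Y)ᵛ) = Arr ((h ⊲ Yᵛ) ⊲ Xᵛ) :=
    (Arr.rT_congr rfl (dual₀_mul X Y)).trans (arr_rT_mul ..)
  have e : X * (Y * Yᵛ) * Xᵛ = X * Y * Yᵛ * Xᵛ := by simp [mul_assoc]
  calc Arr (coev X ≫ (bend h ⊲ Xᵛ)) =
        Arr ((coev X ≫ₛ ((X ⊳ coev Y) ⊲ Xᵛ)) ≫ eqToHom e ≫ ((h ⊲ Yᵛ) ⊲ Xᵛ)) := by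
        simp
    _ = _ := Arr.comp_congr (arr_coev_mul X Y).symm ((arr_eqToHom_comp _ _).trans h1.symm)

namespace SimpleBases

variable (ℬ : SimpleBases F C)

/-- Injectivity holds because `unbend` and a second dualisation recover the original basis element
up to isomorphism. -/
lemma exists_injective_bend (x z : Fin ℬ.n) (Y : C) :
    ∃ t : Fin (ℬ.rk (ℬ.obj z) (ℬ.obj x * Y)) → Fin (ℬ.rk (ℬ.obj x) (ℬ.obj z * Yᵛ)),
      Function.Injective t ∧
        ∀ i, Nonempty (bend (ℬ.mor (ℬ.obj z) (ℬ.obj x * Y) i)ᵃ ≅ ℬ.mor _ _ (t i)) := by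
  choose t ht using fun i => ℬ.exists_mor_iso
    (endScalar_bend (ℬ.endScalar (A := ℬ.obj z) (B := ℬ.obj x * Y) i).dual)
  refine ⟨t, fun i j hij => ?_, ht⟩
  obtain ⟨e⟩ := ht i
  obtain ⟨e'⟩ := ht j
  have e1 := dualIso ((unbendBend _).symm ≪≫
    unbendIso (e ≪≫ eqToIso (by rw [hij]) ≪≫ e'.symm) ≪≫ unbendBend _)
  exact (ℬ.isBasis _ _).eq_of_iso (eqToIso (dual₁_dual₁ _).symm ≪≫ e1.symm ≪≫
    eqToIso (dual₁_dual₁ _))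

/-- The second injection is the first one for `Yᵛ` with `x` and `z` exchanged, using `Yᵛᵛ = Y`. -/
lemma rk_bend (x z : Fin ℬ.n) (Y : C) :
    ℬ.rk (ℬ.obj z) (ℬ.obj x * Y) = ℬ.rk (ℬ.obj x) (ℬ.obj z * Yᵛ) := by
  obtain ⟨t, ht, -⟩ := ℬ.exists_injective_bend x z Y
  obtain ⟨t', ht', -⟩ := ℬ.exists_injective_bend z x Yᵛ
  have h := Fintype.card_le_of_injective t ht
  have h' := Fintype.card_le_of_injective t' ht'
  rw [Fintype.card_fin, Fintype.card_fin] at h h'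
  rw [dual₀_dual₀] at h'
  exact le_antisymm h h'

variable [Pivotal C] [Consistent C] [IsSpherical C] [NonDegenerate F C]

/-- This is `dimObj_eq_sum` for `Z ⊗ Y*`, reindexed by bending the leg `Y`, which preserves
dimensions. -/
lemma sum_dimMor_sq (z : Fin ℬ.n) (Y : C) :
    ∑ x, ∑ f : Fin (ℬ.rk (ℬ.obj z) (ℬ.obj x * Y)),
      dimMor F (ℬ.mor _ _ f) ^ 2 / dimObj F (ℬ.obj x) = dimObj F (ℬ.obj z) * dimObj F Y := by
  rw [← dimObj_dual Y, ← dimObj_mul, ℬ.dimObj_eq_sum]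
  refine Finset.sum_congr rfl fun x _ => ?_
  obtain ⟨t, ht, hi⟩ := ℬ.exists_injective_bend x z Y
  have hb : Function.Bijective t :=
    (Fintype.bijective_iff_injective_and_card t).2 ⟨ht, by simp [ℬ.rk_bend x z Y]⟩
  refine Fintype.sum_bijective t hb _ _ fun i => ?_
  obtain ⟨e⟩ := hi i
  rw [← dimMor_congr_iso e, dimMor_bend, dimMor_dual]

end SimpleBases

end Bend

/-! ### The maps attached to 4-simplices on lines -/

section LinearCategory

variable {F : Type*} [Field F] {H : Type*} [Category H] [Preadditive H] [Linear F H]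

lemma EndScalar.exists_eq_smul {s t : H} (hs : EndScalar F s) (x y : s ⟶ t) [IsIso x] [IsIso y] :
    ∃ z : F, z ≠ 0 ∧ x = z • y := by
  obtain ⟨z, hz⟩ := hs.exists_smul (x ≫ inv y)
  have h : x = z • y := by
    calc x = (x ≫ inv y) ≫ y := by simp
      _ = _ := by rw [hz, Linear.smul_comp, Category.id_comp]
  refine ⟨z, ?_, h⟩
  rintro rfl
  refine hs.id_ne_zero ?_
  calc 𝟙 s = x ≫ inv x := by simp
    _ = (0 : F) • y ≫ inv x := by rw [← Linear.smul_comp, ← h]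
    _ = 0 := by simp

lemma EndScalar.exists_eq_smul_hom {s t : H} (hs : EndScalar F s) (e : s ≅ t) (x : s ⟶ t) :
    ∃ r : F, x = r • e.hom := by
  obtain ⟨r, hr⟩ := hs.exists_smul (x ≫ e.inv)
  refine ⟨r, ?_⟩
  calc x = (x ≫ e.inv) ≫ e.hom := by simp
    _ = _ := by rw [hr, Linear.smul_comp, Category.id_comp]

lemma EndScalar.exists_eq_smul_inv {s t : H} (hs : EndScalar F s) (e : s ≅ t) (x : t ⟶ s) :
    ∃ r : F, x = r • e.inv := by
  obtain ⟨r, hr⟩ := hs.exists_smul (e.hom ≫ x)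
  refine ⟨r, ?_⟩
  calc x = e.inv ≫ e.hom ≫ x := by simp
    _ = _ := by rw [hr, Linear.comp_smul, Category.comp_id]

end LinearCategory

section Whisk

variable {C : Type u} [Bicategory.{w, v} C] [Bicategory.Strict C]

lemma whisk_comp {P Q Q' R R' S : C} (X : P ⟶ Q) {f g h : Q' ⟶ R} (α : f ⟶ g) (β : g ⟶ h)
    (Y : R' ⟶ S) (hQ : Q = Q') (hR : R = R') :
    whisk X α Y hQ hR ≫ whisk X β Y hQ hR = whisk X (α ≫ β) Y hQ hR := by
  simp only [whisk, ← whiskerLeft_comp, ← comp_whiskerRight]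

lemma whisk_id {P Q Q' R R' S : C} (X : P ⟶ Q) (f : Q' ⟶ R)
    (Y : R' ⟶ S) (hQ : Q = Q') (hR : R = R') :
    whisk X (𝟙 f) Y hQ hR = 𝟙 _ := by
  simp only [whisk, whiskerLeft_id, id_whiskerRight]

lemma whisk_comp_inv {P Q Q' R R' S : C} (X : P ⟶ Q) {f g : Q' ⟶ R} {α : f ⟶ g} {β : g ⟶ f}
    (h : α ≫ β = 𝟙 f) (Y : R' ⟶ S) (hQ : Q = Q') (hR : R = R') {Z : P ⟶ S} (x : _ ⟶ Z) :
    whisk X α Y hQ hR ≫ whisk X β Y hQ hR ≫ x = x := by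
  rw [← Category.assoc, whisk_comp, h, whisk_id, Category.id_comp]

end Whisk

section Simplices

variable {C : Type u} [Bicategory.{w, v} C] [Bicategory.Strict C] [SemiStrictMonoidal C]
  {eij eik eil eim ejk ejl ejm ekl ekm elm : C}
  {fijk : eik ⟶ ejk * eij} {fijl : eil ⟶ ejl * eij} {fijm : eim ⟶ ejm * eij}
  {fikl : eil ⟶ ekl * eik} {fikm : eim ⟶ ekm * eik} {film : eim ⟶ elm * eil}
  {fjkl : ejl ⟶ ekl * ejk} {fjkm : ejm ⟶ ekm * ejk} {fjlm : ejm ⟶ elm * ejl}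
  {fklm : ekm ⟶ elm * ekl}

lemma arr_fRR : Arr (fRR fijm fjkm fklm) =
    Arr (fijm ≫ rTa fjkm eij ≫ rTa fklm (ejk * eij)) := by
  simp [fRR, rTa]

lemma cell_whisk_id_left {P Q' R R' S : C} {f g : Q' ⟶ R} (α : f ⟶ g) (Y : R' ⟶ S)
    (hQ : P = Q') (hR : R = R') {S₁ : C} {Y₁ : R ⟶ S₁} (hY : Arr Y = Arr Y₁) :
    Cell (whisk (𝟙 P) α Y hQ hR) = Cell (α ▷ Y₁) := by
  subst hQ
  rw [cell_whisk (𝟙 P) α Y rfl hR rfl rfl hY, cell_id_whiskerLeft]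

lemma cell_whisk_id_right {P Q Q' R S : C} (X : P ⟶ Q) {f g : Q' ⟶ R} (α : f ⟶ g)
    (hQ : Q = Q') (hR : R = S) {P₁ : C} {X₁ : P₁ ⟶ Q'} (hX : Arr X = Arr X₁) :
    Cell (whisk X α (𝟙 S) hQ hR) = Cell (X₁ ◁ α) := by
  subst hR
  rw [cell_whisk X α (𝟙 R) hQ rfl hX rfl rfl]
  exact Cell.whiskerLeft_congr rfl (cell_whiskerRight_id α)

lemma cell_betaDelta₀ (β : twoH fikl fikm film fklm) (δ : twoH fijk fijm fikm fjkm) :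
    Cell (betaDelta₀ β δ) = Cell (hexL β (tenc fklm fijk) δ) := by
  refine (cell_vcomp (α' := 𝟙 _) _ rfl (cell_vcomp (α' := onHead β _) _ ?_
    (cell_vcomp (α' := fikm ◁ tenc fklm fijk) _ ?_
      (cell_vcomp (α' := onHead δ _) (β' := 𝟙 _) _ ?_ ?_)))).trans (by simp)
  · rw [cell_onHead]
    exact cell_whisk_id_left _ _ _ _ rfl
  · refine (cell_whisk_id_right (X₁ := fikm) _ _ _ _ rfl).trans ?_
    exact Cell.whiskerLeft_congr rfl (cell_tenc _ _).symm
  · rw [cell_onHead]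
    exact cell_whisk_id_left _ _ _ _ (by simp [rTa])
  · exact Cell.id_congr arr_fRR

lemma cell_epsGammaAlpha₀ (α : twoH fjkl fjkm fjlm fklm) (γ : twoH fijl fijm film fjlm)
    (ϵ : twoH fijk fijl fikl fjkl) :
    Cell (epsGammaAlpha₀ α γ ϵ) = Cell (hexR (lTc elm ϵ) γ (rTc α eij)) := by
  refine (cell_vcomp (α' := 𝟙 _) _ ?_ (cell_vcomp (α' := film ◁ lTc elm ϵ) _ ?_
    (cell_vcomp (α' := onHead γ _) _ ?_
      (cell_vcomp (α' := fijm ◁ rTc α eij) (β' := 𝟙 _) _ ?_ ?_)))).trans (by simp)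
  · rfl
  · refine (cell_whisk_id_right (X₁ := film) _ _ _ _ rfl).trans ?_
    exact Cell.whiskerLeft_congr rfl (cell_lTc _ _).symm
  · rw [cell_onHead]
    exact cell_whisk_id_left _ _ _ _ (by simp)
  · refine (cell_whisk_id_right (X₁ := fijm) _ _ _ _ rfl).trans ?_
    exact Cell.whiskerLeft_congr rfl (cell_rTc _ _).symm
  · exact Cell.id_congr arr_fRR

lemma epsGammaAlpha₀_comp (α : fL fjkl fjlm ≅ fR fjkm fklm) (γ : fL fijl film ≅ fR fijm fjlm)
    (ϵ : fL fijk fikl ≅ fR fijl fjkl) :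
    epsGammaAlpha₀ α.hom γ.hom ϵ.hom ≫ alphaGammaEps₀ α.inv γ.inv ϵ.inv = 𝟙 _ := by
  have hα : (α.hom ⊲₂ eij) ≫ (α.inv ⊲₂ eij) = 𝟙 _ := by rw [← rT₂_comp, α.hom_inv_id, rT₂_id]
  have hϵ : (elm ⊳₂ ϵ.hom) ≫ (elm ⊳₂ ϵ.inv) = 𝟙 _ := by rw [← lT₂_comp, ϵ.hom_inv_id, lT₂_id]
  simp only [epsGammaAlpha₀, alphaGammaEps₀, vcomp, Category.assoc, Category.id_comp,
    Category.comp_id, eqToHom_trans_assoc, eqToHom_refl, whisk_comp_inv _ hα,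
    whisk_comp_inv _ γ.hom_inv_id, whisk_comp_inv _ hϵ, eqToHom_trans]

lemma betaDelta₀_comp (β : fL fikl film ≅ fR fikm fklm) (δ : fL fijk fikm ≅ fR fijm fjkm) :
    betaDelta₀ β.hom δ.hom ≫ deltaBeta₀ β.inv δ.inv = 𝟙 _ := by
  simp only [betaDelta₀, deltaBeta₀, vcomp, Category.assoc, Category.id_comp,
    Category.comp_id, eqToHom_trans_assoc, eqToHom_refl, whisk_comp_inv _ β.hom_inv_id,
    whisk_comp_inv _ δ.hom_inv_id, whisk_comp_inv _ (Iso.hom_inv_id _), eqToHom_trans]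

variable {F : Type*} [Field F] [∀ A B : C, Preadditive (A ⟶ B)] [∀ A B : C, Linear F (A ⟶ B)]
  [VectLinear F C]

lemma betaDelta₀_eq {β : twoH fikl fikm film fklm} {δ : twoH fijk fijm fikm fjkm}
    {α : twoH fjkl fjkm fjlm fklm} {γ : twoH fijl fijm film fjlm}
    {ϵ : twoH fijk fijl fikl fjkl} {z : F}
    (h : hexL β (tenc fklm fijk) δ = z • hexR (lTc elm ϵ) γ (rTc α eij)) :
    betaDelta₀ β δ = z • epsGammaAlpha₀ α γ ϵ := by
  refine eq_of_cell ?_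
  rw [cell_betaDelta₀, h]
  exact Cell.smul_congr z (cell_epsGammaAlpha₀ α γ ϵ).symm

/-- Both hexagons are invertible cells with the same boundary and a scalar source. -/
lemma exists_hexL_eq_smul_hexR (β : twoH fikl fikm film fklm) (δ : twoH fijk fijm fikm fjkm)
    (α : twoH fjkl fjkm fjlm fklm) (γ : twoH fijl fijm film fjlm)
    (ϵ : twoH fijk fijl fikl fjkl) [IsIso β] [IsIso δ] [IsIso α] [IsIso γ] [IsIso ϵ]
    (hs : EndScalar F (fLL fijk fikl film)) :
    ∃ z : F, z ≠ 0 ∧ hexL β (tenc fklm fijk) δ = z • hexR (lTc elm ϵ) γ (rTc α eij) :=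
  hs.exists_eq_smul _ _

variable [DualStructure C] [HasDuals C] [NonDegenerate F C]

lemma toDual_apply {A B : C} (f g : A ⟶ B) (x : f ⟶ g) (y : g ⟶ f) :
    toDual F f g x y = pairing F f g x y := rfl

lemma toDual₂_apply {A B A' B' : C} (f g : A ⟶ B) (f' g' : A' ⟶ B') (x : f ⟶ g) (x' : f' ⟶ g')
    (y : g ⟶ f) (y' : g' ⟶ f') :
    toDual₂ F f g f' g' (x ⊗ₜ x') (y ⊗ₜ y') = pairing F f g x y * pairing F f' g' x' y' := by
  simp [toDual₂, toDual_apply, TensorProduct.dualDistribEquiv]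

lemma pairing_hom_inv {A B : C} {f g : A ⟶ B} (e : f ≅ g) :
    pairing F f g e.hom e.inv = dimMor F f := by
  rw [pairing_eq_id, e.hom_inv_id]; rfl

lemma toDual₃_apply {A B A' B' A'' B'' : C} (f g : A ⟶ B) (f' g' : A' ⟶ B') (f'' g'' : A'' ⟶ B'')
    (x : f ⟶ g) (x' : f' ⟶ g') (x'' : f'' ⟶ g'') (y : g ⟶ f) (y' : g' ⟶ f') (y'' : g'' ⟶ f'') :
    toDual₃ F f g f' g' f'' g'' (x ⊗ₜ (x' ⊗ₜ x'')) (y ⊗ₜ (y' ⊗ₜ y'')) =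
      pairing F f g x y * (pairing F f' g' x' y' * pairing F f'' g'' x'' y'') := by
  simp [toDual₃, toDual_apply, toDual₂_apply, TensorProduct.dualDistribEquiv]

lemma smul_tmul_smul_smul {U V W : Type*} [AddCommGroup U] [Module F U] [AddCommGroup V]
    [Module F V] [AddCommGroup W] [Module F W] (a b c : F) (u : U) (v : V) (w : W) :
    (a • u) ⊗ₜ[F] ((b • v) ⊗ₜ[F] (c • w)) = (a * (b * c)) • (u ⊗ₜ[F] (v ⊗ₜ[F] w)) := by
  rw [TensorProduct.smul_tmul_smul, TensorProduct.smul_tmul_smul]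

/-- It suffices to pair with the inverses of the generators, which span the opposite lines. There
each pairing is a dimension, and `βδ = z • ϵγα` meets the inverse of `ϵγα`. -/
lemma Zpos_tmul (β : fL fikl film ≅ fR fikm fklm) (δ : fL fijk fikm ≅ fR fijm fjkm)
    (α : fL fjkl fjlm ≅ fR fjkm fklm) (γ : fL fijl film ≅ fR fijm fjlm)
    (ϵ : fL fijk fikl ≅ fR fijl fjkl) (hα : EndScalar F (fL fjkl fjlm))
    (hγ : EndScalar F (fL fijl film)) (hϵ : EndScalar F (fL fijk fikl)) {z : F}
    (h : hexL β.hom (tenc fklm fijk) δ.hom =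
      z • hexR (lTc elm ϵ.hom) γ.hom (rTc α.hom eij)) :
    Zpos F fijk fijl fijm fikl fikm film fjkl fjkm fjlm fklm (β.hom ⊗ₜ δ.hom) =
      (z * dimMor F (fLL fijk fikl film) / (dimMor F (fL fjkl fjlm) *
        (dimMor F (fL fijl film) * dimMor F (fL fijk fikl)))) •
        (α.hom ⊗ₜ (γ.hom ⊗ₜ ϵ.hom)) := by
  refine (toDual₃ F _ _ _ _ _ _).injective ?_
  rw [Zpos, LinearMap.comp_apply, LinearEquiv.coe_coe, LinearEquiv.apply_symm_apply, map_smul]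
  refine TensorProduct.ext' fun α' x => ?_
  induction x using TensorProduct.induction_on with
  | zero => simp
  | add x y hx hy => rw [TensorProduct.tmul_add, map_add, map_add, hx, hy]
  | tmul γ' ϵ' =>
    obtain ⟨a, rfl⟩ := hα.exists_eq_smul_inv α α'
    obtain ⟨b, rfl⟩ := hγ.exists_eq_smul_inv γ γ'
    obtain ⟨c, rfl⟩ := hϵ.exists_eq_smul_inv ϵ ϵ'
    rw [smul_tmul_smul_smul, map_smul, map_smul]
    refine congrArg _ ?_
    rw [LinearMap.smul_apply, toDual₃_apply, pairing_hom_inv, pairing_hom_inv, pairing_hom_inv,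
      LinearMap.compl₁₂_apply, smul_eq_mul, div_mul_cancel₀ _ (mul_ne_zero (dimMor_ne_zero hα)
        (mul_ne_zero (dimMor_ne_zero hγ) (dimMor_ne_zero hϵ)))]
    change pairing F _ _ (betaDelta₀ β.hom δ.hom) (alphaGammaEps₀ α.inv γ.inv ϵ.inv) = _
    rw [betaDelta₀_eq h, map_smul, LinearMap.smul_apply, pairing_eq_id, epsGammaAlpha₀_comp]
    rfl

/-- The argument of `Zpos_tmul` with the roles exchanged: `ϵγα = z⁻¹ • βδ` meets the inverse of
`βδ`. -/
lemma Zneg_tmul (β : fL fikl film ≅ fR fikm fklm) (δ : fL fijk fikm ≅ fR fijm fjkm)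
    (α : fL fjkl fjlm ≅ fR fjkm fklm) (γ : fL fijl film ≅ fR fijm fjlm)
    (ϵ : fL fijk fikl ≅ fR fijl fjkl) (hβ : EndScalar F (fL fikl film))
    (hδ : EndScalar F (fL fijk fikm)) {z : F} (hz : z ≠ 0)
    (h : hexL β.hom (tenc fklm fijk) δ.hom =
      z • hexR (lTc elm ϵ.hom) γ.hom (rTc α.hom eij)) :
    Zneg F fijk fijl fijm fikl fikm film fjkl fjkm fjlm fklm (α.hom ⊗ₜ (γ.hom ⊗ₜ ϵ.hom)) =
      (z⁻¹ * dimMor F (fLL fijk fikl film) / (dimMor F (fL fikl film) *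
        dimMor F (fL fijk fikm))) • (β.hom ⊗ₜ δ.hom) := by
  refine (toDual₂ F _ _ _ _).injective ?_
  rw [Zneg, LinearMap.comp_apply, LinearEquiv.coe_coe, LinearEquiv.apply_symm_apply, map_smul]
  refine TensorProduct.ext' fun β' δ' => ?_
  obtain ⟨a, rfl⟩ := hβ.exists_eq_smul_inv β β'
  obtain ⟨b, rfl⟩ := hδ.exists_eq_smul_inv δ δ'
  rw [TensorProduct.smul_tmul_smul, map_smul, map_smul]
  refine congrArg _ ?_
  rw [LinearMap.smul_apply, toDual₂_apply, pairing_hom_inv, pairing_hom_inv,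
    LinearMap.flip_apply, LinearMap.compl₁₂_apply, smul_eq_mul,
    div_mul_cancel₀ _ (mul_ne_zero (dimMor_ne_zero hβ) (dimMor_ne_zero hδ))]
  change pairing F _ _ (deltaBeta₀ β.inv δ.inv) (epsGammaAlpha₀ α.hom γ.hom ϵ.hom) = _
  have e : epsGammaAlpha₀ α.hom γ.hom ϵ.hom = z⁻¹ • betaDelta₀ β.hom δ.hom := by
    rw [betaDelta₀_eq h, smul_smul, inv_mul_cancel₀ hz, one_smul]
  rw [e, map_smul, pairing_comm, pairing_eq_id, betaDelta₀_comp]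
  rfl

end Simplices

/-! ### Tensor products with lines -/

section LinearAlgebra

variable {F : Type*} [Field F] {U V W X Y M : Type*} [AddCommGroup U] [Module F U]
  [AddCommGroup V] [Module F V] [AddCommGroup W] [Module F W] [AddCommGroup X] [Module F X]
  [AddCommGroup Y] [Module F Y] [AddCommGroup M] [Module F M]

variable (F U V) in
lemma subsingleton_tensor_left [Subsingleton U] : Subsingleton (U ⊗[F] V) :=
  subsingleton_of_forall_eq 0 fun x => by
    induction x using TensorProduct.induction_on with
    | zero => rfl
    | add x y hx hy => rw [hx, hy, add_zero]
    | tmul a b => rw [Subsingleton.elim a 0, TensorProduct.zero_tmul]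

variable (F U V) in
lemma subsingleton_tensor_right [Subsingleton V] : Subsingleton (U ⊗[F] V) :=
  have := subsingleton_tensor_left F V U
  (TensorProduct.comm F U V).toEquiv.subsingleton

lemma tensorOne₂₃_tmul {Z : U ⊗[F] V →ₗ[F] W ⊗[F] (X ⊗[F] Y)} {u : U} {v : V} {w : W} {x : X}
    {y : Y} {a : F} (h : Z (u ⊗ₜ v) = a • (w ⊗ₜ (x ⊗ₜ y))) (m : M) :
    tensorOne₂₃ Z (u ⊗ₜ[F] (v ⊗ₜ[F] m)) = a • (w ⊗ₜ[F] (x ⊗ₜ[F] (y ⊗ₜ[F] m))) := by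
  simp only [tensorOne₂₃, LinearMap.comp_apply, LinearEquiv.coe_coe, TensorProduct.assoc_symm_tmul,
    LinearMap.rTensor_tmul, h, ← TensorProduct.smul_tmul', map_smul, TensorProduct.assoc_tmul,
    LinearMap.lTensor_tmul]

lemma tensorOne₃₂_tmul {Z : W ⊗[F] (X ⊗[F] Y) →ₗ[F] U ⊗[F] V} {u : U} {v : V} {w : W} {x : X}
    {y : Y} {a : F} (h : Z (w ⊗ₜ (x ⊗ₜ y)) = a • (u ⊗ₜ v)) (m : M) :
    tensorOne₃₂ Z (w ⊗ₜ[F] (x ⊗ₜ[F] (y ⊗ₜ[F] m))) = a • (u ⊗ₜ[F] (v ⊗ₜ[F] m)) := by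
  simp only [tensorOne₃₂, LinearMap.comp_apply, LinearEquiv.coe_coe, TensorProduct.assoc_symm_tmul,
    LinearMap.rTensor_tmul, h, ← TensorProduct.smul_tmul', map_smul, TensorProduct.assoc_tmul,
    LinearMap.lTensor_tmul]

lemma tensorOne₂₃_zero : tensorOne₂₃ (M := M) (0 : U ⊗[F] V →ₗ[F] W ⊗[F] (X ⊗[F] Y)) = 0 := by
  simp [tensorOne₂₃]

lemma tensorOne₃₂_zero : tensorOne₃₂ (M := M) (0 : W ⊗[F] (X ⊗[F] Y) →ₗ[F] U ⊗[F] V) = 0 := by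
  simp [tensorOne₃₂]

lemma partialTrace_zero [Module.Finite F V] :
    partialTrace (0 : V ⊗[F] W →ₗ[F] V ⊗[F] U) = 0 := by
  simp [partialTrace]

/-- On a line the trace runs over one basis vector, so no dimension factor appears. -/
lemma partialTrace_apply_of_line [Module.Finite F V] {T : V ⊗[F] W →ₗ[F] V ⊗[F] U} {v : V}
    (hv : v ≠ 0) (hs : ∀ x : V, ∃ r : F, r • v = x) {x : W} {u : U} (h : T (v ⊗ₜ x) = v ⊗ₜ u) :
    partialTrace T x = u := by
  have h1 : ∀ y : V, T (y ⊗ₜ x) = y ⊗ₜ u := fun y => by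
    obtain ⟨r, rfl⟩ := hs y
    rw [← TensorProduct.smul_tmul', map_smul, h, TensorProduct.smul_tmul']
  have h2 : Module.finrank F V = 1 := finrank_eq_one v hv hs
  simp [partialTrace, h1, h2]

end LinearAlgebra

/-! ### The composite of the five 4-simplices on generators -/

section Composite

variable {C : Type u} [Bicategory.{w, v} C] [Bicategory.Strict C] [SemiStrictMonoidal C]
  {F : Type*} [Field F] [∀ A B : C, Preadditive (A ⟶ B)] [∀ A B : C, Linear F (A ⟶ B)]
  [VectLinear F C] [DualStructure C] [HasDuals C] [NonDegenerate F C]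
  {e01 e02 e03 e04 e05 e12 e13 e14 e15 e23 e24 e25 e34 e35 e45 : C}
  {f012 : e02 ⟶ e12 * e01} {f013 : e03 ⟶ e13 * e01} {f014 : e04 ⟶ e14 * e01}
  {f015 : e05 ⟶ e15 * e01} {f023 : e03 ⟶ e23 * e02} {f024 : e04 ⟶ e24 * e02}
  {f025 : e05 ⟶ e25 * e02} {f034 : e04 ⟶ e34 * e03} {f035 : e05 ⟶ e35 * e03}
  {f045 : e05 ⟶ e45 * e04} {f123 : e13 ⟶ e23 * e12} {f124 : e14 ⟶ e24 * e12}
  {f125 : e15 ⟶ e25 * e12} {f134 : e14 ⟶ e34 * e13} {f135 : e15 ⟶ e35 * e13}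
  {f145 : e15 ⟶ e45 * e14} {f234 : e24 ⟶ e34 * e23} {f235 : e25 ⟶ e35 * e23}
  {f245 : e25 ⟶ e45 * e24} {f345 : e35 ⟶ e45 * e34}

lemma composite_tmul
    {φ0123 : twoH f012 f013 f023 f123} {φ0124 : twoH f012 f014 f024 f124}
    {φ0125 : twoH f012 f015 f025 f125} {φ0134 : twoH f013 f014 f034 f134}
    {φ0135 : twoH f013 f015 f035 f135} {φ0145 : twoH f014 f015 f045 f145}
    {φ0234 : twoH f023 f024 f034 f234} {φ0235 : twoH f023 f025 f035 f235}
    {φ0245 : twoH f024 f025 f045 f245} {φ0345 : twoH f034 f035 f045 f345}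
    {φ1234 : twoH f123 f124 f134 f234} {φ1235 : twoH f123 f125 f135 f235}
    {φ1245 : twoH f124 f125 f145 f245} {φ1345 : twoH f134 f135 f145 f345}
    {φ2345 : twoH f234 f235 f245 f345} {s0 s1 s2 s3 s5 : F}
    (h0 : Zneg F f123 f124 f125 f134 f135 f145 f234 f235 f245 f345
      (φ2345 ⊗ₜ (φ1245 ⊗ₜ φ1234)) = s0 • (φ1345 ⊗ₜ φ1235))
    (h1 : Zpos F f023 f024 f025 f034 f035 f045 f234 f235 f245 f345 (φ0345 ⊗ₜ φ0235) =
      s1 • (φ2345 ⊗ₜ (φ0245 ⊗ₜ φ0234)))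
    (h2 : Zneg F f013 f014 f015 f034 f035 f045 f134 f135 f145 f345
      (φ1345 ⊗ₜ (φ0145 ⊗ₜ φ0134)) = s2 • (φ0345 ⊗ₜ φ0135))
    (h3 : Zpos F f012 f014 f015 f024 f025 f045 f124 f125 f145 f245 (φ0245 ⊗ₜ φ0125) =
      s3 • (φ1245 ⊗ₜ (φ0145 ⊗ₜ φ0124)))
    (h5 : Zpos F f012 f013 f014 f023 f024 f034 f123 f124 f134 f234 (φ0234 ⊗ₜ φ0124) =
      s5 • (φ1234 ⊗ₜ (φ0134 ⊗ₜ φ0123))) :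
    composite F f012 f013 f014 f015 f023 f024 f025 f034 f035 f045 f123 f124 f125 f134 f135 f145
      f234 f235 f245 f345 (φ0345 ⊗ₜ (φ0235 ⊗ₜ φ0125)) =
      φ0345 ⊗ₜ ((s1 * s3 * s5 * s0 * s2) • (φ1235 ⊗ₜ (φ0135 ⊗ₜ φ0123))) := by
  simp only [composite, LinearMap.comp_apply, tensorOne₂₃_tmul h1, map_smul,
    LinearMap.lTensor_tmul, LinearEquiv.coe_coe, TensorProduct.comm_tmul, tensorOne₂₃_tmul h3, h5,
    TensorProduct.tmul_smul, TensorProduct.leftComm_tmul, tensorOne₃₂_tmul h0,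
    tensorOne₃₂_tmul h2, smul_smul, mul_assoc]

lemma composite_eq_zero₁ (h : Zpos F f023 f024 f025 f034 f035 f045 f234 f235 f245 f345 = 0) :
    composite F f012 f013 f014 f015 f023 f024 f025 f034 f035 f045 f123 f124 f125 f134 f135 f145
      f234 f235 f245 f345 = 0 := by
  simp only [composite, h, tensorOne₂₃_zero, LinearMap.comp_zero]

lemma composite_eq_zero₂ (h : Zpos F f012 f014 f015 f024 f025 f045 f124 f125 f145 f245 = 0) :
    composite F f012 f013 f014 f015 f023 f024 f025 f034 f035 f045 f123 f124 f125 f134 f135 f145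
      f234 f235 f245 f345 = 0 := by
  simp only [composite, h, tensorOne₂₃_zero, LinearMap.lTensor_zero, LinearMap.comp_zero,
    LinearMap.zero_comp]

lemma composite_eq_zero₃ (h : Zneg F f123 f124 f125 f134 f135 f145 f234 f235 f245 f345 = 0) :
    composite F f012 f013 f014 f015 f023 f024 f025 f034 f035 f045 f123 f124 f125 f134 f135 f145
      f234 f235 f245 f345 = 0 := by
  simp only [composite, h, tensorOne₃₂_zero, LinearMap.comp_zero,
    LinearMap.zero_comp]

end Composite

/-! ### Scalars of the simplices for basis labels -/

namespace SimpleBases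

variable {C : Type u} [Bicategory.{w, v} C] [Bicategory.Strict C] [SemiStrictMonoidal C]
  {F : Type*} [Field F] [∀ A B : C, Preadditive (A ⟶ B)] [∀ A B : C, Linear F (A ⟶ B)]
  [VectLinear F C] [DualStructure C] [HasDuals C] [NonDegenerate F C] (ℬ : SimpleBases F C)

section Scalars

variable {eij eik eil eim ejk ejl ejm ekl ekm elm : Fin ℬ.n}
  {fijk : ℬ.Face eij ejk eik} {fijl : ℬ.Face eij ejl eil} {fijm : ℬ.Face eij ejm eim}
  {fikl : ℬ.Face eik ekl eil} {fikm : ℬ.Face eik ekm eim} {film : ℬ.Face eil elm eim}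
  {fjkl : ℬ.Face ejk ekl ejl} {fjkm : ℬ.Face ejk ekm ejm} {fjlm : ℬ.Face ejl elm ejm}
  {fklm : ℬ.Face ekl elm ekm}

lemma dimMor_face_ne_zero (t : ℬ.Face eij ejk eik) : dimMor F (ℬ.face t) ≠ 0 :=
  dimMor_ne_zero (ℬ.endScalar t)

/-- The loop values `dim_q(f) / dim_q(source)` multiply under composition; the source of the second
factor leaves the denominator. -/
lemma dimMor_fL : dimMor F (fL (ℬ.face fijk) (ℬ.face fikl)) =
    dimMor F (ℬ.face fikl) * dimMor F (ℬ.face fijk) / dimObj F (ℬ.obj eik) := by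
  rw [((ℬ.coiso (ℬ.endScalar fikl)).comp ((ℬ.coiso (ℬ.endScalar fijk)).lT _)).norm.dimMor_eq]
  have := ℬ.dimObj_ne_zero eil
  field_simp

lemma dimMor_fR : dimMor F (fR (ℬ.face fijl) (ℬ.face fjkl)) =
    dimMor F (ℬ.face fijl) * dimMor F (ℬ.face fjkl) / dimObj F (ℬ.obj ejl) := by
  have h := (ℬ.coiso (ℬ.endScalar fijl)).comp (((ℬ.coiso (ℬ.endScalar fjkl)).rT (ℬ.obj eij)).congr
    (h' := rTa (ℬ.face fjkl) (ℬ.obj eij)) (by simp [rTa]))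
  refine h.norm.dimMor_eq.trans ?_
  have := ℬ.dimObj_ne_zero eil
  field_simp

lemma coiso_fLL : Coiso F (fLL (ℬ.face fijk) (ℬ.face fikl) (ℬ.face film))
    (dimMor F (ℬ.face film) / dimObj F (ℬ.obj eim) *
      (dimMor F (ℬ.face fikl) / dimObj F (ℬ.obj eil) *
        (dimMor F (ℬ.face fijk) / dimObj F (ℬ.obj eik)))) :=
  (ℬ.coiso (ℬ.endScalar film)).comp (((ℬ.coiso (ℬ.endScalar fikl)).lT _).comp
    (((ℬ.coiso (ℬ.endScalar fijk)).lT _).lT _))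

lemma dimMor_fLL : dimMor F (fLL (ℬ.face fijk) (ℬ.face fikl) (ℬ.face film)) =
    dimMor F (ℬ.face film) * dimMor F (ℬ.face fikl) * dimMor F (ℬ.face fijk) /
      (dimObj F (ℬ.obj eil) * dimObj F (ℬ.obj eik)) := by
  rw [ℬ.coiso_fLL.norm.dimMor_eq]
  have := ℬ.dimObj_ne_zero eim
  field_simp

lemma endScalar_fLL : EndScalar F (fLL (ℬ.face fijk) (ℬ.face fikl) (ℬ.face film)) :=
  (((ℬ.coiso (ℬ.endScalar fikl)).lT _).comp
    (((ℬ.coiso (ℬ.endScalar fijk)).lT _).lT _)).endScalar_comp (ℬ.endScalar film)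

/-- What survives is the edge `jl` and the three faces containing it, the simplices interior to the
side with three tetrahedra. -/
lemma Zpos_hom_tmul_hom (β : fL (ℬ.face fikl) (ℬ.face film) ≅ fR (ℬ.face fikm) (ℬ.face fklm))
    (δ : fL (ℬ.face fijk) (ℬ.face fikm) ≅ fR (ℬ.face fijm) (ℬ.face fjkm))
    (α : fL (ℬ.face fjkl) (ℬ.face fjlm) ≅ fR (ℬ.face fjkm) (ℬ.face fklm))
    (γ : fL (ℬ.face fijl) (ℬ.face film) ≅ fR (ℬ.face fijm) (ℬ.face fjlm))
    (ϵ : fL (ℬ.face fijk) (ℬ.face fikl) ≅ fR (ℬ.face fijl) (ℬ.face fjkl)) {z : F}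
    (h : hexL β.hom (tenc (ℬ.face fklm) (ℬ.face fijk)) δ.hom =
      z • hexR (lTc (ℬ.obj elm) ϵ.hom) γ.hom (rTc α.hom (ℬ.obj eij))) :
    Zpos F (ℬ.face fijk) (ℬ.face fijl) (ℬ.face fijm) (ℬ.face fikl) (ℬ.face fikm) (ℬ.face film)
      (ℬ.face fjkl) (ℬ.face fjkm) (ℬ.face fjlm) (ℬ.face fklm) (β.hom ⊗ₜ δ.hom) =
      (z * dimObj F (ℬ.obj ejl) / (dimMor F (ℬ.face fjkl) * dimMor F (ℬ.face fjlm) *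
        dimMor F (ℬ.face fijl))) • (α.hom ⊗ₜ (γ.hom ⊗ₜ ϵ.hom)) := by
  rw [Zpos_tmul β δ α γ ϵ ℬ.endScalar_fL ℬ.endScalar_fL ℬ.endScalar_fL h]
  congr 1
  rw [ℬ.dimMor_fLL, ℬ.dimMor_fL, ℬ.dimMor_fL, ℬ.dimMor_fL]
  have h1 := ℬ.dimObj_ne_zero ejl
  have h2 := ℬ.dimObj_ne_zero eil
  have h3 := ℬ.dimObj_ne_zero eik
  have h4 := ℬ.dimMor_face_ne_zero film
  have h5 := ℬ.dimMor_face_ne_zero fikl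
  have h6 := ℬ.dimMor_face_ne_zero fijk
  have h7 := ℬ.dimMor_face_ne_zero fjkl
  have h8 := ℬ.dimMor_face_ne_zero fjlm
  have h9 := ℬ.dimMor_face_ne_zero fijl
  field_simp

/-- What survives is the face `ikm` shared by the two tetrahedra of the target. -/
lemma Zneg_hom_tmul_hom (β : fL (ℬ.face fikl) (ℬ.face film) ≅ fR (ℬ.face fikm) (ℬ.face fklm))
    (δ : fL (ℬ.face fijk) (ℬ.face fikm) ≅ fR (ℬ.face fijm) (ℬ.face fjkm))
    (α : fL (ℬ.face fjkl) (ℬ.face fjlm) ≅ fR (ℬ.face fjkm) (ℬ.face fklm))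
    (γ : fL (ℬ.face fijl) (ℬ.face film) ≅ fR (ℬ.face fijm) (ℬ.face fjlm))
    (ϵ : fL (ℬ.face fijk) (ℬ.face fikl) ≅ fR (ℬ.face fijl) (ℬ.face fjkl)) {z : F} (hz : z ≠ 0)
    (h : hexL β.hom (tenc (ℬ.face fklm) (ℬ.face fijk)) δ.hom =
      z • hexR (lTc (ℬ.obj elm) ϵ.hom) γ.hom (rTc α.hom (ℬ.obj eij))) :
    Zneg F (ℬ.face fijk) (ℬ.face fijl) (ℬ.face fijm) (ℬ.face fikl) (ℬ.face fikm) (ℬ.face film)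
      (ℬ.face fjkl) (ℬ.face fjkm) (ℬ.face fjlm) (ℬ.face fklm) (α.hom ⊗ₜ (γ.hom ⊗ₜ ϵ.hom)) =
      (z⁻¹ / dimMor F (ℬ.face fikm)) • (β.hom ⊗ₜ δ.hom) := by
  rw [Zneg_tmul β δ α γ ϵ ℬ.endScalar_fL ℬ.endScalar_fL hz h]
  congr 1
  rw [ℬ.dimMor_fLL, ℬ.dimMor_fL, ℬ.dimMor_fL]
  have h2 := ℬ.dimObj_ne_zero eil
  have h3 := ℬ.dimObj_ne_zero eik
  have h4 := ℬ.dimMor_face_ne_zero film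
  have h5 := ℬ.dimMor_face_ne_zero fikl
  have h6 := ℬ.dimMor_face_ne_zero fijk
  have h7 := ℬ.dimMor_face_ne_zero fikm
  field_simp

lemma exists_hex (β : fL (ℬ.face fikl) (ℬ.face film) ≅ fR (ℬ.face fikm) (ℬ.face fklm))
    (δ : fL (ℬ.face fijk) (ℬ.face fikm) ≅ fR (ℬ.face fijm) (ℬ.face fjkm))
    (α : fL (ℬ.face fjkl) (ℬ.face fjlm) ≅ fR (ℬ.face fjkm) (ℬ.face fklm))
    (γ : fL (ℬ.face fijl) (ℬ.face film) ≅ fR (ℬ.face fijm) (ℬ.face fjlm))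
    (ϵ : fL (ℬ.face fijk) (ℬ.face fikl) ≅ fR (ℬ.face fijl) (ℬ.face fjkl)) :
    ∃ z : F, z ≠ 0 ∧ hexL β.hom (tenc (ℬ.face fklm) (ℬ.face fijk)) δ.hom =
      z • hexR (lTc (ℬ.obj elm) ϵ.hom) γ.hom (rTc α.hom (ℬ.obj eij)) :=
  exists_hexL_eq_smul_hexR _ _ _ _ _ ℬ.endScalar_fLL

end Scalars

section Simplex

variable {e01 e02 e03 e04 e05 e12 e13 e14 e15 e23 e24 e25 e34 e35 e45 : Fin ℬ.n}
  {f012 : ℬ.Face e01 e12 e02} {f013 : ℬ.Face e01 e13 e03} {f014 : ℬ.Face e01 e14 e04}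
  {f015 : ℬ.Face e01 e15 e05} {f023 : ℬ.Face e02 e23 e03} {f024 : ℬ.Face e02 e24 e04}
  {f025 : ℬ.Face e02 e25 e05} {f034 : ℬ.Face e03 e34 e04} {f035 : ℬ.Face e03 e35 e05}
  {f045 : ℬ.Face e04 e45 e05} {f123 : ℬ.Face e12 e23 e13} {f124 : ℬ.Face e12 e24 e14}
  {f125 : ℬ.Face e12 e25 e15} {f134 : ℬ.Face e13 e34 e14} {f135 : ℬ.Face e13 e35 e15}
  {f145 : ℬ.Face e14 e45 e15} {f234 : ℬ.Face e23 e34 e24} {f235 : ℬ.Face e23 e35 e25}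
  {f245 : ℬ.Face e24 e45 e25} {f345 : ℬ.Face e34 e45 e35}

lemma endScalar_sixfold_source : EndScalar F (ℬ.face f045 ≫ (ℬ.obj e45 ⊳ ℬ.face f034) ≫
    (ℬ.obj e45 ⊳ (ℬ.obj e34 ⊳ ℬ.face f023)) ≫
      (ℬ.obj e45 ⊳ (ℬ.obj e34 ⊳ (ℬ.obj e23 ⊳ ℬ.face f012)))) :=
  (((ℬ.coiso (ℬ.endScalar f034)).lT _).comp ((((ℬ.coiso (ℬ.endScalar f023)).lT _).lT _).comp
    ((((ℬ.coiso (ℬ.endScalar f012)).lT _).lT _).lT _))).endScalar_comp (ℬ.endScalar f045)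

/-- The cocycle identity turns the five scalars `z` into `z4`. The edges `14`, `24` and seven of the
ten faces in the weight cancel against the 4-simplices. Left over are `e04`, `e34`, `e45` and
`f034`, `f045`, `f345`; equality of dimensions across the tetrahedron `0345` replaces `f034`,
`f045`, `e04` by `f035`, `f345`, `e35`. -/
lemma weight_smul_partialTrace_composite
    (t0123 : Tet (ℬ.face f012) (ℬ.face f013) (ℬ.face f023) (ℬ.face f123))
    (t0124 : Tet (ℬ.face f012) (ℬ.face f014) (ℬ.face f024) (ℬ.face f124))
    (t0125 : Tet (ℬ.face f012) (ℬ.face f015) (ℬ.face f025) (ℬ.face f125))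
    (t0134 : Tet (ℬ.face f013) (ℬ.face f014) (ℬ.face f034) (ℬ.face f134))
    (t0135 : Tet (ℬ.face f013) (ℬ.face f015) (ℬ.face f035) (ℬ.face f135))
    (t0145 : Tet (ℬ.face f014) (ℬ.face f015) (ℬ.face f045) (ℬ.face f145))
    (t0234 : Tet (ℬ.face f023) (ℬ.face f024) (ℬ.face f034) (ℬ.face f234))
    (t0235 : Tet (ℬ.face f023) (ℬ.face f025) (ℬ.face f035) (ℬ.face f235))
    (t0245 : Tet (ℬ.face f024) (ℬ.face f025) (ℬ.face f045) (ℬ.face f245))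
    (t0345 : Tet (ℬ.face f034) (ℬ.face f035) (ℬ.face f045) (ℬ.face f345))
    (t1234 : Tet (ℬ.face f123) (ℬ.face f124) (ℬ.face f134) (ℬ.face f234))
    (t1235 : Tet (ℬ.face f123) (ℬ.face f125) (ℬ.face f135) (ℬ.face f235))
    (t1245 : Tet (ℬ.face f124) (ℬ.face f125) (ℬ.face f145) (ℬ.face f245))
    (t1345 : Tet (ℬ.face f134) (ℬ.face f135) (ℬ.face f145) (ℬ.face f345))
    (t2345 : Tet (ℬ.face f234) (ℬ.face f235) (ℬ.face f245) (ℬ.face f345)) :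
    ((dimObj F (ℬ.obj e04))⁻¹ * (dimObj F (ℬ.obj e14))⁻¹ * (dimObj F (ℬ.obj e24))⁻¹ *
        (dimObj F (ℬ.obj e34))⁻¹ * (dimObj F (ℬ.obj e45))⁻¹ *
        (dimMor F (ℬ.face f014) * dimMor F (ℬ.face f024) * dimMor F (ℬ.face f034) *
          dimMor F (ℬ.face f045) * dimMor F (ℬ.face f124) * dimMor F (ℬ.face f134) *
          dimMor F (ℬ.face f145) * dimMor F (ℬ.face f234) * dimMor F (ℬ.face f245) *
          dimMor F (ℬ.face f345))) •
      partialTrace (composite F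
        (ℬ.face f012) (ℬ.face f013) (ℬ.face f014) (ℬ.face f015) (ℬ.face f023) (ℬ.face f024)
        (ℬ.face f025) (ℬ.face f034) (ℬ.face f035) (ℬ.face f045) (ℬ.face f123) (ℬ.face f124)
        (ℬ.face f125) (ℬ.face f134) (ℬ.face f135) (ℬ.face f145) (ℬ.face f234) (ℬ.face f235)
        (ℬ.face f245) (ℬ.face f345)) =
      (dimMor F (ℬ.face f345) ^ 2 /
        (dimObj F (ℬ.obj e34) * dimObj F (ℬ.obj e45) * dimObj F (ℬ.obj e35))) •
      Zpos F (ℬ.face f012) (ℬ.face f013) (ℬ.face f015) (ℬ.face f023) (ℬ.face f025) (ℬ.face f035)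
        (ℬ.face f123) (ℬ.face f125) (ℬ.face f135) (ℬ.face f235) := by
  obtain ⟨φ0123⟩ := t0123
  obtain ⟨φ0124⟩ := t0124
  obtain ⟨φ0125⟩ := t0125
  obtain ⟨φ0134⟩ := t0134
  obtain ⟨φ0135⟩ := t0135
  obtain ⟨φ0145⟩ := t0145
  obtain ⟨φ0234⟩ := t0234
  obtain ⟨φ0235⟩ := t0235
  obtain ⟨φ0245⟩ := t0245
  obtain ⟨φ0345⟩ := t0345
  obtain ⟨φ1234⟩ := t1234
  obtain ⟨φ1235⟩ := t1235
  obtain ⟨φ1245⟩ := t1245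
  obtain ⟨φ1345⟩ := t1345
  obtain ⟨φ2345⟩ := t2345
  obtain ⟨z0, hz0, h0⟩ := ℬ.exists_hex φ1345 φ1235 φ2345 φ1245 φ1234
  obtain ⟨z1, hz1, h1⟩ := ℬ.exists_hex φ0345 φ0235 φ2345 φ0245 φ0234
  obtain ⟨z2, hz2, h2⟩ := ℬ.exists_hex φ0345 φ0135 φ1345 φ0145 φ0134
  obtain ⟨z3, hz3, h3⟩ := ℬ.exists_hex φ0245 φ0125 φ1245 φ0145 φ0124
  obtain ⟨z4, hz4, h4⟩ := ℬ.exists_hex φ0235 φ0125 φ1235 φ0135 φ0123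
  obtain ⟨z5, hz5, h5⟩ := ℬ.exists_hex φ0234 φ0124 φ1234 φ0134 φ0123
  have hz : z1 * z3 * z5 = z0 * z2 * z4 := by
    have h := smul_sixfold_eq φ0123.hom φ0124.hom φ0125.hom φ0134.hom φ0135.hom φ0145.hom φ0234.hom
      φ0235.hom φ0245.hom φ0345.hom φ1234.hom φ1235.hom φ1245.hom φ1345.hom φ2345.hom
      h0 h1 h2 h3 h4 h5
    -- `sixfold` is invertible with non-zero source, hence non-zero, so its multiples determine
    -- their coefficients.
    refine smul_left_injective F (fun h' => ?_) h
    refine (ℬ.endScalar_sixfold_source (f045 := f045) (f034 := f034) (f023 := f023)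
      (f012 := f012)).id_ne_zero ?_
    have e := IsIso.hom_inv_id (sixfold φ0123.hom φ0134.hom φ0145.hom φ1234.hom φ1245.hom φ2345.hom)
    generalize inv (sixfold φ0123.hom φ0134.hom φ0145.hom φ1234.hom φ1245.hom φ2345.hom) = y at e
    rw [← e, h', Limits.zero_comp]
  -- The two ends of the isomorphism `φ0345` have equal dimension.
  have hd : dimMor F (ℬ.face f045) * dimMor F (ℬ.face f034) / dimObj F (ℬ.obj e04) =
      dimMor F (ℬ.face f035) * dimMor F (ℬ.face f345) / dimObj F (ℬ.obj e35) := by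
    rw [← ℬ.dimMor_fL, ← ℬ.dimMor_fR, dimMor_congr_iso φ0345]
  refine TensorProduct.ext' fun x y => ?_
  obtain ⟨a, rfl⟩ := (ℬ.endScalar_fL (fijk := f023) (fikl := f035)).exists_eq_smul_hom φ0235 x
  obtain ⟨b, rfl⟩ := (ℬ.endScalar_fL (fijk := f012) (fikl := f025)).exists_eq_smul_hom φ0125 y
  rw [TensorProduct.smul_tmul_smul, map_smul, map_smul]
  refine congrArg _ ?_
  rw [LinearMap.smul_apply, LinearMap.smul_apply, ℬ.Zpos_hom_tmul_hom φ0235 φ0125 φ1235 φ0135 φ0123 h4,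
    partialTrace_apply_of_line (v := φ0345.hom) ?_ ?_ (composite_tmul
      (ℬ.Zneg_hom_tmul_hom φ1345 φ1235 φ2345 φ1245 φ1234 hz0 h0)
      (ℬ.Zpos_hom_tmul_hom φ0345 φ0235 φ2345 φ0245 φ0234 h1)
      (ℬ.Zneg_hom_tmul_hom φ0345 φ0135 φ1345 φ0145 φ0134 hz2 h2)
      (ℬ.Zpos_hom_tmul_hom φ0245 φ0125 φ1245 φ0145 φ0124 h3)
      (ℬ.Zpos_hom_tmul_hom φ0234 φ0124 φ1234 φ0134 φ0123 h5)), smul_smul, smul_smul]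
  · congr 1
    have hz' : z4 = z1 * z3 * z5 * z0⁻¹ * z2⁻¹ := by rw [hz]; field_simp
    have d1 := ℬ.dimObj_ne_zero e04
    have d2 := ℬ.dimObj_ne_zero e14
    have d3 := ℬ.dimObj_ne_zero e24
    have d4 := ℬ.dimObj_ne_zero e34
    have d5 := ℬ.dimObj_ne_zero e35
    have d6 := ℬ.dimObj_ne_zero e45
    have D1 := ℬ.dimMor_face_ne_zero f014
    have D2 := ℬ.dimMor_face_ne_zero f024
    have D3 := ℬ.dimMor_face_ne_zero f124
    have D4 := ℬ.dimMor_face_ne_zero f134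
    have D5 := ℬ.dimMor_face_ne_zero f145
    have D6 := ℬ.dimMor_face_ne_zero f234
    have D7 := ℬ.dimMor_face_ne_zero f245
    have D8 := ℬ.dimMor_face_ne_zero f035
    have D9 := ℬ.dimMor_face_ne_zero f123
    have D10 := ℬ.dimMor_face_ne_zero f013
    have D11 := ℬ.dimMor_face_ne_zero f135
    rw [hz']
    rw [div_eq_div_iff d1 d5] at hd
    field_simp
    linear_combination dimMor F (ℬ.face f345) * dimObj F (ℬ.obj e13) * hd
  · intro h
    refine (ℬ.endScalar_fL (fijk := f034) (fikl := f045)).id_ne_zero ?_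
    rw [← φ0345.hom_inv_id, h, Limits.zero_comp]
  · intro x
    obtain ⟨r, hr⟩ := (ℬ.endScalar_fL (fijk := f034) (fikl := f045)).exists_eq_smul_hom φ0345 x
    exact ⟨r, hr.symm⟩

end Simplex

end SimpleBases

/-! ### The sum over the labels containing a vertex -/

namespace SimpleBases

variable {C : Type u} [Bicategory.{w, v} C] [Bicategory.Strict C] [SemiStrictMonoidal C]
  {F : Type*} [Field F] [∀ A B : C, Preadditive (A ⟶ B)] [∀ A B : C, Linear F (A ⟶ B)]
  [VectLinear F C] [DualStructure C] [HasDuals C] (ℬ : SimpleBases F C)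

section Cone

variable (e01 e02 e03 e05 e12 e13 e15 e23 e25 e35 : Fin ℬ.n)

/-- Labels of the edges and faces of the 5-simplex that contain the vertex `4`. -/
abbrev ConeLabels : Type :=
  Σ e04 e14 e24 e34 e45 : Fin ℬ.n, ℬ.Face e01 e14 e04 × ℬ.Face e02 e24 e04 × ℬ.Face e03 e34 e04 ×
    ℬ.Face e04 e45 e05 × ℬ.Face e12 e24 e14 × ℬ.Face e13 e34 e14 × ℬ.Face e14 e45 e15 ×
    ℬ.Face e23 e34 e24 × ℬ.Face e24 e45 e25 × ℬ.Face e34 e45 e35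

end Cone

variable {e01 e02 e03 e05 e12 e13 e15 e23 e25 e35 : Fin ℬ.n}

/-- The label `f345`, with `f035`, `f135`, `f235`, fixes `e04`, `e14`, `e24` and the faces `034`,
`045`, `134`, `145`, `234`, `245`. The tetrahedra `0145`, `0245`, `1245` then fix the remaining
faces. -/
lemma coneLabels_unique {f015 : ℬ.Face e01 e15 e05} {f025 : ℬ.Face e02 e25 e05}
    {f035 : ℬ.Face e03 e35 e05} {f125 : ℬ.Face e12 e25 e15} {f135 : ℬ.Face e13 e35 e15}
    {f235 : ℬ.Face e23 e35 e25} {e04 e14 e24 e34 e45 : Fin ℬ.n} {f014 : ℬ.Face e01 e14 e04}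
    {f024 : ℬ.Face e02 e24 e04} {f034 : ℬ.Face e03 e34 e04} {f045 : ℬ.Face e04 e45 e05}
    {f124 : ℬ.Face e12 e24 e14} {f134 : ℬ.Face e13 e34 e14} {f145 : ℬ.Face e14 e45 e15}
    {f234 : ℬ.Face e23 e34 e24} {f245 : ℬ.Face e24 e45 e25} {f345 : ℬ.Face e34 e45 e35}
    {e04' e14' e24' : Fin ℬ.n} {f014' : ℬ.Face e01 e14' e04'}
    {f024' : ℬ.Face e02 e24' e04'} {f034' : ℬ.Face e03 e34 e04'} {f045' : ℬ.Face e04' e45 e05}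
    {f124' : ℬ.Face e12 e24' e14'} {f134' : ℬ.Face e13 e34 e14'} {f145' : ℬ.Face e14' e45 e15}
    {f234' : ℬ.Face e23 e34 e24'} {f245' : ℬ.Face e24' e45 e25}
    (t0345 : Tet (ℬ.face f034) (ℬ.face f035) (ℬ.face f045) (ℬ.face f345))
    (t1345 : Tet (ℬ.face f134) (ℬ.face f135) (ℬ.face f145) (ℬ.face f345))
    (t2345 : Tet (ℬ.face f234) (ℬ.face f235) (ℬ.face f245) (ℬ.face f345))
    (t0145 : Tet (ℬ.face f014) (ℬ.face f015) (ℬ.face f045) (ℬ.face f145))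
    (t0245 : Tet (ℬ.face f024) (ℬ.face f025) (ℬ.face f045) (ℬ.face f245))
    (t1245 : Tet (ℬ.face f124) (ℬ.face f125) (ℬ.face f145) (ℬ.face f245))
    (t0345' : Tet (ℬ.face f034') (ℬ.face f035) (ℬ.face f045') (ℬ.face f345))
    (t1345' : Tet (ℬ.face f134') (ℬ.face f135) (ℬ.face f145') (ℬ.face f345))
    (t2345' : Tet (ℬ.face f234') (ℬ.face f235) (ℬ.face f245') (ℬ.face f345))
    (t0145' : Tet (ℬ.face f014') (ℬ.face f015) (ℬ.face f045') (ℬ.face f145'))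
    (t0245' : Tet (ℬ.face f024') (ℬ.face f025) (ℬ.face f045') (ℬ.face f245'))
    (t1245' : Tet (ℬ.face f124') (ℬ.face f125) (ℬ.face f145') (ℬ.face f245')) :
    (⟨e04, e14, e24, e34, e45, f014, f024, f034, f045, f124, f134, f145, f234, f245, f345⟩ :
      ℬ.ConeLabels e01 e02 e03 e05 e12 e13 e15 e23 e25 e35) =
    ⟨e04', e14', e24', e34, e45, f014', f024', f034', f045', f124', f134', f145', f234', f245',
      f345⟩ := by
  cases ℬ.tet_fL_unique t0345 t0345'
  cases ℬ.tet_fL_unique t1345 t1345'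
  cases ℬ.tet_fL_unique t2345 t2345'
  cases ℬ.tet_fL_unique t0145 t0145'
  cases ℬ.tet_fL_unique t0245 t0245'
  cases ℬ.tet_fL_unique t1245 t1245'
  rfl

lemma exists_coneLabels {f012 : ℬ.Face e01 e12 e02} {f013 : ℬ.Face e01 e13 e03}
    {f015 : ℬ.Face e01 e15 e05} {f023 : ℬ.Face e02 e23 e03} {f025 : ℬ.Face e02 e25 e05}
    {f035 : ℬ.Face e03 e35 e05} {f123 : ℬ.Face e12 e23 e13} {f125 : ℬ.Face e12 e25 e15}
    {f135 : ℬ.Face e13 e35 e15} {f235 : ℬ.Face e23 e35 e25}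
    (t0125 : Tet (ℬ.face f012) (ℬ.face f015) (ℬ.face f025) (ℬ.face f125))
    (t0135 : Tet (ℬ.face f013) (ℬ.face f015) (ℬ.face f035) (ℬ.face f135))
    (t0235 : Tet (ℬ.face f023) (ℬ.face f025) (ℬ.face f035) (ℬ.face f235))
    (t1235 : Tet (ℬ.face f123) (ℬ.face f125) (ℬ.face f135) (ℬ.face f235))
    {e34 e45 : Fin ℬ.n} (f345 : ℬ.Face e34 e45 e35) :
    ∃ (e04 e14 e24 : Fin ℬ.n) (f014 : ℬ.Face e01 e14 e04) (f024 : ℬ.Face e02 e24 e04)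
      (f034 : ℬ.Face e03 e34 e04) (f045 : ℬ.Face e04 e45 e05) (f124 : ℬ.Face e12 e24 e14)
      (f134 : ℬ.Face e13 e34 e14) (f145 : ℬ.Face e14 e45 e15) (f234 : ℬ.Face e23 e34 e24)
      (f245 : ℬ.Face e24 e45 e25),
      (Tet (ℬ.face f034) (ℬ.face f035) (ℬ.face f045) (ℬ.face f345) ∧
      Tet (ℬ.face f134) (ℬ.face f135) (ℬ.face f145) (ℬ.face f345) ∧
      Tet (ℬ.face f234) (ℬ.face f235) (ℬ.face f245) (ℬ.face f345) ∧
      Tet (ℬ.face f014) (ℬ.face f015) (ℬ.face f045) (ℬ.face f145) ∧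
      Tet (ℬ.face f024) (ℬ.face f025) (ℬ.face f045) (ℬ.face f245) ∧
      Tet (ℬ.face f124) (ℬ.face f125) (ℬ.face f145) (ℬ.face f245)) ∧
      Tet (ℬ.face f013) (ℬ.face f014) (ℬ.face f034) (ℬ.face f134) ∧
      Tet (ℬ.face f023) (ℬ.face f024) (ℬ.face f034) (ℬ.face f234) ∧
      Tet (ℬ.face f123) (ℬ.face f124) (ℬ.face f134) (ℬ.face f234) ∧
      Tet (ℬ.face f012) (ℬ.face f014) (ℬ.face f024) (ℬ.face f124) := by
  obtain ⟨e04, f045, f034, t0345⟩ := ℬ.exists_tet_fL f035 f345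
  obtain ⟨e14, f145, f134, t1345⟩ := ℬ.exists_tet_fL f135 f345
  obtain ⟨e24, f245, f234, t2345⟩ := ℬ.exists_tet_fL f235 f345
  obtain ⟨f014, t0134, t0145⟩ := ℬ.exists_tet_pentagon t0345 t0135 t1345
  obtain ⟨f024, t0234, t0245⟩ := ℬ.exists_tet_pentagon t0345 t0235 t2345
  obtain ⟨f124, t1234, t1245⟩ := ℬ.exists_tet_pentagon t1345 t1235 t2345
  -- The pentagon of `(01245)` gives its own candidate for `f014`; uniqueness across the tetrahedron
  -- `0145` makes it the earlier one.
  obtain ⟨f014', t0124, t0145'⟩ := ℬ.exists_tet_pentagon t0245 t0125 t1245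
  cases ℬ.tet_fL_unique t0145 t0145'
  exact ⟨e04, e14, e24, f014, f024, f034, f045, f124, f134, f145, f234, f245,
    ⟨t0345, t1345, t2345, t0145, t0245, t1245⟩, t0134, t0234, t1234, t0124⟩

variable [NonDegenerate F C]

/-- Each tetrahedron on the edge `45` is a tensor factor of the source or target of one of the maps
composed, which is then zero. Tetrahedra containing `4` but not `5` need no test: the six listed
here already fix the labels. -/
lemma composite_eq_zero {f012 : ℬ.Face e01 e12 e02} {f013 : ℬ.Face e01 e13 e03}
    {f015 : ℬ.Face e01 e15 e05} {f023 : ℬ.Face e02 e23 e03} {f025 : ℬ.Face e02 e25 e05}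
    {f035 : ℬ.Face e03 e35 e05} {f123 : ℬ.Face e12 e23 e13} {f125 : ℬ.Face e12 e25 e15}
    {f135 : ℬ.Face e13 e35 e15} {f235 : ℬ.Face e23 e35 e25} {e04 e14 e24 e34 e45 : Fin ℬ.n}
    {f014 : ℬ.Face e01 e14 e04} {f024 : ℬ.Face e02 e24 e04} {f034 : ℬ.Face e03 e34 e04}
    {f045 : ℬ.Face e04 e45 e05} {f124 : ℬ.Face e12 e24 e14} {f134 : ℬ.Face e13 e34 e14}
    {f145 : ℬ.Face e14 e45 e15} {f234 : ℬ.Face e23 e34 e24} {f245 : ℬ.Face e24 e45 e25}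
    {f345 : ℬ.Face e34 e45 e35}
    (h : ¬ (Tet (ℬ.face f034) (ℬ.face f035) (ℬ.face f045) (ℬ.face f345) ∧
      Tet (ℬ.face f134) (ℬ.face f135) (ℬ.face f145) (ℬ.face f345) ∧
      Tet (ℬ.face f234) (ℬ.face f235) (ℬ.face f245) (ℬ.face f345) ∧
      Tet (ℬ.face f014) (ℬ.face f015) (ℬ.face f045) (ℬ.face f145) ∧
      Tet (ℬ.face f024) (ℬ.face f025) (ℬ.face f045) (ℬ.face f245) ∧
      Tet (ℬ.face f124) (ℬ.face f125) (ℬ.face f145) (ℬ.face f245))) :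
    composite F (ℬ.face f012) (ℬ.face f013) (ℬ.face f014) (ℬ.face f015) (ℬ.face f023)
      (ℬ.face f024) (ℬ.face f025) (ℬ.face f034) (ℬ.face f035) (ℬ.face f045) (ℬ.face f123)
      (ℬ.face f124) (ℬ.face f125) (ℬ.face f134) (ℬ.face f135) (ℬ.face f145) (ℬ.face f234)
      (ℬ.face f235) (ℬ.face f245) (ℬ.face f345) = 0 := by
  by_cases t0345 : Tet (ℬ.face f034) (ℬ.face f035) (ℬ.face f045) (ℬ.face f345)
  swap
  · have := ℬ.subsingleton_twoH t0345
    refine LinearMap.ext fun x => ?_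
    rw [(subsingleton_tensor_left F _ _).elim x 0, map_zero, map_zero]
  by_cases t1345 : Tet (ℬ.face f134) (ℬ.face f135) (ℬ.face f145) (ℬ.face f345)
  swap
  · have := ℬ.subsingleton_twoH t1345
    exact composite_eq_zero₃ (LinearMap.ext fun x => (subsingleton_tensor_left F _ _).elim _ _)
  by_cases t2345 : Tet (ℬ.face f234) (ℬ.face f235) (ℬ.face f245) (ℬ.face f345)
  swap
  · have := ℬ.subsingleton_twoH t2345
    exact composite_eq_zero₁ (LinearMap.ext fun x => (subsingleton_tensor_left F _ _).elim _ _)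
  by_cases t0145 : Tet (ℬ.face f014) (ℬ.face f015) (ℬ.face f045) (ℬ.face f145)
  swap
  · have := ℬ.subsingleton_twoH t0145
    have := subsingleton_tensor_left F
      (twoH (ℬ.face f014) (ℬ.face f015) (ℬ.face f045) (ℬ.face f145))
      (twoH (ℬ.face f012) (ℬ.face f014) (ℬ.face f024) (ℬ.face f124))
    exact composite_eq_zero₂ (LinearMap.ext fun x => (subsingleton_tensor_right F _ _).elim _ _)
  by_cases t0245 : Tet (ℬ.face f024) (ℬ.face f025) (ℬ.face f045) (ℬ.face f245)
  swap
  · have := ℬ.subsingleton_twoH t0245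
    refine composite_eq_zero₂ (LinearMap.ext fun x => ?_)
    rw [(subsingleton_tensor_left F _ _).elim x 0, map_zero, map_zero]
  have t1245 : ¬ Tet (ℬ.face f124) (ℬ.face f125) (ℬ.face f145) (ℬ.face f245) :=
    fun t => h ⟨t0345, t1345, t2345, t0145, t0245, t⟩
  have := ℬ.subsingleton_twoH t1245
  exact composite_eq_zero₂ (LinearMap.ext fun x => (subsingleton_tensor_left F _ _).elim _ _)

/-- For a fixed first edge label `x` the sum is one by `sum_dimMor_sq`, and there are `n` choices of
`x`. -/
lemma sum_dimMor_sq_div [Pivotal C] [Consistent C] [IsSpherical C] (z : Fin ℬ.n) :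
    ∑ s : Σ x y : Fin ℬ.n, ℬ.Face x y z, dimMor F (ℬ.face s.2.2) ^ 2 /
      (dimObj F (ℬ.obj s.1) * dimObj F (ℬ.obj s.2.1) * dimObj F (ℬ.obj z)) = (ℬ.n : F) := by
  rw [Fintype.sum_sigma]
  have h : ∀ x : Fin ℬ.n, ∑ t : Σ y : Fin ℬ.n, ℬ.Face x y z, dimMor F (ℬ.face t.2) ^ 2 /
      (dimObj F (ℬ.obj x) * dimObj F (ℬ.obj t.1) * dimObj F (ℬ.obj z)) = 1 := fun x => by
    have hx := ℬ.dimObj_ne_zero x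
    have hz := ℬ.dimObj_ne_zero z
    rw [Fintype.sum_sigma]
    calc _ = (∑ y, ∑ f : Fin (ℬ.rk (ℬ.obj z) (ℬ.obj y * ℬ.obj x)),
          dimMor F (ℬ.mor _ _ f) ^ 2 / dimObj F (ℬ.obj y)) /
            (dimObj F (ℬ.obj z) * dimObj F (ℬ.obj x)) := by
          rw [Finset.sum_div]
          refine Finset.sum_congr rfl fun y _ => ?_
          rw [Finset.sum_div]
          refine Finset.sum_congr rfl fun f _ => ?_
          rw [div_div]
          congr 1
          ring
      _ = 1 := by rw [ℬ.sum_dimMor_sq z, div_self (mul_ne_zero hz hx)]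
  simp [h]

end SimpleBases

/-! ### Evaluation of the sum -/

namespace SimpleBases

variable {C : Type u} [Bicategory.{w, v} C] [Bicategory.Strict C] [SemiStrictMonoidal C]
  {F : Type*} [Field F] [∀ A B : C, Preadditive (A ⟶ B)] [∀ A B : C, Linear F (A ⟶ B)]
  [VectLinear F C] [DualStructure C] [HasDuals C] [NonDegenerate F C] (ℬ : SimpleBases F C)
  {e01 e02 e03 e05 e12 e13 e15 e23 e25 e35 : Fin ℬ.n}
  (f012 : ℬ.Face e01 e12 e02) (f013 : ℬ.Face e01 e13 e03)
  (f015 : ℬ.Face e01 e15 e05) (f023 : ℬ.Face e02 e23 e03)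
  (f025 : ℬ.Face e02 e25 e05) (f035 : ℬ.Face e03 e35 e05)
  (f123 : ℬ.Face e12 e23 e13) (f125 : ℬ.Face e12 e25 e15)
  (f135 : ℬ.Face e13 e35 e15) (f235 : ℬ.Face e23 e35 e25)

/-- The summand that belongs to labels of the edges and faces containing the vertex `4`. -/
def coneTerm (e04 e14 e24 e34 e45 : Fin ℬ.n) (f014 : ℬ.Face e01 e14 e04)
    (f024 : ℬ.Face e02 e24 e04) (f034 : ℬ.Face e03 e34 e04) (f045 : ℬ.Face e04 e45 e05)
    (f124 : ℬ.Face e12 e24 e14) (f134 : ℬ.Face e13 e34 e14) (f145 : ℬ.Face e14 e45 e15)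
    (f234 : ℬ.Face e23 e34 e24) (f245 : ℬ.Face e24 e45 e25) (f345 : ℬ.Face e34 e45 e35) :
    twoH (ℬ.face f023) (ℬ.face f025) (ℬ.face f035) (ℬ.face f235) ⊗[F]
      twoH (ℬ.face f012) (ℬ.face f015) (ℬ.face f025) (ℬ.face f125) →ₗ[F]
    twoH (ℬ.face f123) (ℬ.face f125) (ℬ.face f135) (ℬ.face f235) ⊗[F]
      (twoH (ℬ.face f013) (ℬ.face f015) (ℬ.face f035) (ℬ.face f135) ⊗[F]
        twoH (ℬ.face f012) (ℬ.face f013) (ℬ.face f023) (ℬ.face f123)) :=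
  ((dimObj F (ℬ.obj e04))⁻¹ * (dimObj F (ℬ.obj e14))⁻¹ * (dimObj F (ℬ.obj e24))⁻¹ *
      (dimObj F (ℬ.obj e34))⁻¹ * (dimObj F (ℬ.obj e45))⁻¹ *
      (dimMor F (ℬ.face f014) * dimMor F (ℬ.face f024) * dimMor F (ℬ.face f034) *
        dimMor F (ℬ.face f045) * dimMor F (ℬ.face f124) * dimMor F (ℬ.face f134) *
        dimMor F (ℬ.face f145) * dimMor F (ℬ.face f234) * dimMor F (ℬ.face f245) *
        dimMor F (ℬ.face f345))) •
    partialTrace (composite F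
      (ℬ.face f012) (ℬ.face f013) (ℬ.face f014) (ℬ.face f015) (ℬ.face f023) (ℬ.face f024)
      (ℬ.face f025) (ℬ.face f034) (ℬ.face f035) (ℬ.face f045) (ℬ.face f123) (ℬ.face f124)
      (ℬ.face f125) (ℬ.face f134) (ℬ.face f135) (ℬ.face f145) (ℬ.face f234) (ℬ.face f235)
      (ℬ.face f245) (ℬ.face f345))

/-- The summand as a function on the type of labels. -/
def coneSummand (t : ℬ.ConeLabels e01 e02 e03 e05 e12 e13 e15 e23 e25 e35) :=
  ℬ.coneTerm f012 f013 f015 f023 f025 f035 f123 f125 f135 f235 t.1 t.2.1 t.2.2.1 t.2.2.2.1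
    t.2.2.2.2.1 t.2.2.2.2.2.1 t.2.2.2.2.2.2.1 t.2.2.2.2.2.2.2.1 t.2.2.2.2.2.2.2.2.1
    t.2.2.2.2.2.2.2.2.2.1 t.2.2.2.2.2.2.2.2.2.2.1 t.2.2.2.2.2.2.2.2.2.2.2.1
    t.2.2.2.2.2.2.2.2.2.2.2.2.1 t.2.2.2.2.2.2.2.2.2.2.2.2.2.1 t.2.2.2.2.2.2.2.2.2.2.2.2.2.2

variable {f012 f013 f015 f023 f025 f035 f123 f125 f135 f235}

section

variable {e04 e14 e24 e34 e45 : Fin ℬ.n} {f014 : ℬ.Face e01 e14 e04} {f024 : ℬ.Face e02 e24 e04}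
  {f034 : ℬ.Face e03 e34 e04} {f045 : ℬ.Face e04 e45 e05} {f124 : ℬ.Face e12 e24 e14}
  {f134 : ℬ.Face e13 e34 e14} {f145 : ℬ.Face e14 e45 e15} {f234 : ℬ.Face e23 e34 e24}
  {f245 : ℬ.Face e24 e45 e25} {f345 : ℬ.Face e34 e45 e35}

lemma coneTerm_eq_zero
    (h : ¬ (Tet (ℬ.face f034) (ℬ.face f035) (ℬ.face f045) (ℬ.face f345) ∧
      Tet (ℬ.face f134) (ℬ.face f135) (ℬ.face f145) (ℬ.face f345) ∧
      Tet (ℬ.face f234) (ℬ.face f235) (ℬ.face f245) (ℬ.face f345) ∧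
      Tet (ℬ.face f014) (ℬ.face f015) (ℬ.face f045) (ℬ.face f145) ∧
      Tet (ℬ.face f024) (ℬ.face f025) (ℬ.face f045) (ℬ.face f245) ∧
      Tet (ℬ.face f124) (ℬ.face f125) (ℬ.face f145) (ℬ.face f245))) :
    ℬ.coneTerm f012 f013 f015 f023 f025 f035 f123 f125 f135 f235 e04 e14 e24 e34 e45
      f014 f024 f034 f045 f124 f134 f145 f234 f245 f345 = 0 := by
  have h0 : composite F (ℬ.face f012) (ℬ.face f013) (ℬ.face f014) (ℬ.face f015) (ℬ.face f023)
      (ℬ.face f024) (ℬ.face f025) (ℬ.face f034) (ℬ.face f035) (ℬ.face f045) (ℬ.face f123)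
      (ℬ.face f124) (ℬ.face f125) (ℬ.face f134) (ℬ.face f135) (ℬ.face f145) (ℬ.face f234)
      (ℬ.face f235) (ℬ.face f245) (ℬ.face f345) = 0 := ℬ.composite_eq_zero h
  rw [coneTerm, h0, partialTrace_zero, smul_zero]

lemma coneTerm_eq
    (t0123 : Tet (ℬ.face f012) (ℬ.face f013) (ℬ.face f023) (ℬ.face f123))
    (t0125 : Tet (ℬ.face f012) (ℬ.face f015) (ℬ.face f025) (ℬ.face f125))
    (t0135 : Tet (ℬ.face f013) (ℬ.face f015) (ℬ.face f035) (ℬ.face f135))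
    (t0235 : Tet (ℬ.face f023) (ℬ.face f025) (ℬ.face f035) (ℬ.face f235))
    (t1235 : Tet (ℬ.face f123) (ℬ.face f125) (ℬ.face f135) (ℬ.face f235))
    (h : Tet (ℬ.face f034) (ℬ.face f035) (ℬ.face f045) (ℬ.face f345) ∧
      Tet (ℬ.face f134) (ℬ.face f135) (ℬ.face f145) (ℬ.face f345) ∧
      Tet (ℬ.face f234) (ℬ.face f235) (ℬ.face f245) (ℬ.face f345) ∧
      Tet (ℬ.face f014) (ℬ.face f015) (ℬ.face f045) (ℬ.face f145) ∧
      Tet (ℬ.face f024) (ℬ.face f025) (ℬ.face f045) (ℬ.face f245) ∧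
      Tet (ℬ.face f124) (ℬ.face f125) (ℬ.face f145) (ℬ.face f245))
    (h' : Tet (ℬ.face f013) (ℬ.face f014) (ℬ.face f034) (ℬ.face f134) ∧
      Tet (ℬ.face f023) (ℬ.face f024) (ℬ.face f034) (ℬ.face f234) ∧
      Tet (ℬ.face f123) (ℬ.face f124) (ℬ.face f134) (ℬ.face f234) ∧
      Tet (ℬ.face f012) (ℬ.face f014) (ℬ.face f024) (ℬ.face f124)) :
    ℬ.coneTerm f012 f013 f015 f023 f025 f035 f123 f125 f135 f235 e04 e14 e24 e34 e45
      f014 f024 f034 f045 f124 f134 f145 f234 f245 f345 =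
      (dimMor F (ℬ.face f345) ^ 2 /
        (dimObj F (ℬ.obj e34) * dimObj F (ℬ.obj e45) * dimObj F (ℬ.obj e35))) •
      Zpos F (ℬ.face f012) (ℬ.face f013) (ℬ.face f015) (ℬ.face f023) (ℬ.face f025) (ℬ.face f035)
        (ℬ.face f123) (ℬ.face f125) (ℬ.face f135) (ℬ.face f235) :=
  ℬ.weight_smul_partialTrace_composite t0123 h'.2.2.2 t0125 h'.1 t0135 h.2.2.2.1 h'.2.1 t0235
    h.2.2.2.2.1 h.1 h'.2.2.1 t1235 h.2.2.2.2.2 h.2.1 h.2.2.1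

end

/-- Only the labellings from `exists_coneLabels` contribute, one for each `(e34, e45, f345)`; their
coefficients add up to `n`. -/
lemma sum_coneSummand [Pivotal C] [Consistent C] [IsSpherical C]
    (t0123 : Tet (ℬ.face f012) (ℬ.face f013) (ℬ.face f023) (ℬ.face f123))
    (t0125 : Tet (ℬ.face f012) (ℬ.face f015) (ℬ.face f025) (ℬ.face f125))
    (t0135 : Tet (ℬ.face f013) (ℬ.face f015) (ℬ.face f035) (ℬ.face f135))
    (t0235 : Tet (ℬ.face f023) (ℬ.face f025) (ℬ.face f035) (ℬ.face f235))
    (t1235 : Tet (ℬ.face f123) (ℬ.face f125) (ℬ.face f135) (ℬ.face f235)) :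
    ∑ t, ℬ.coneSummand f012 f013 f015 f023 f025 f035 f123 f125 f135 f235 t =
      (ℬ.n : F) • Zpos F (ℬ.face f012) (ℬ.face f013) (ℬ.face f015) (ℬ.face f023) (ℬ.face f025)
        (ℬ.face f035) (ℬ.face f123) (ℬ.face f125) (ℬ.face f135) (ℬ.face f235) := by
  have ex := fun s : (Σ e34 e45 : Fin ℬ.n, ℬ.Face e34 e45 e35) =>
    ℬ.exists_coneLabels t0125 t0135 t0235 t1235 s.2.2
  choose e04 e14 e24 f014 f024 f034 f045 f124 f134 f145 f234 f245 h h' using ex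
  rw [← ℬ.sum_dimMor_sq_div e35, Finset.sum_smul]
  refine (Fintype.sum_of_injective
    (fun s => ⟨e04 s, e14 s, e24 s, s.1, s.2.1, f014 s, f024 s, f034 s, f045 s, f124 s, f134 s,
      f145 s, f234 s, f245 s, s.2.2⟩) (fun s s' e => ?_) _ _ ?_ fun s => ?_).symm
  · have e1 := congrArg (fun t : ℬ.ConeLabels e01 e02 e03 e05 e12 e13 e15 e23 e25 e35 =>
      (⟨t.2.2.2.1, t.2.2.2.2.1, t.2.2.2.2.2.2.2.2.2.2.2.2.2.2⟩ :
        Σ e34 e45 : Fin ℬ.n, ℬ.Face e34 e45 e35)) e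
    exact e1
  · rintro ⟨a04, a14, a24, a34, a45, b014, b024, b034, b045, b124, b134, b145, b234, b245, b345⟩ ht
    by_contra hne
    refine ht ⟨⟨a34, a45, b345⟩, ?_⟩
    by_cases hT : (Tet (ℬ.face b034) (ℬ.face f035) (ℬ.face b045) (ℬ.face b345) ∧
      Tet (ℬ.face b134) (ℬ.face f135) (ℬ.face b145) (ℬ.face b345) ∧
      Tet (ℬ.face b234) (ℬ.face f235) (ℬ.face b245) (ℬ.face b345) ∧
      Tet (ℬ.face b014) (ℬ.face f015) (ℬ.face b045) (ℬ.face b145) ∧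
      Tet (ℬ.face b024) (ℬ.face f025) (ℬ.face b045) (ℬ.face b245) ∧
      Tet (ℬ.face b124) (ℬ.face f125) (ℬ.face b145) (ℬ.face b245))
    · obtain ⟨u1, u2, u3, u4, u5, u6⟩ := h ⟨a34, a45, b345⟩
      obtain ⟨v1, v2, v3, v4, v5, v6⟩ := hT
      exact ℬ.coneLabels_unique u1 u2 u3 u4 u5 u6 v1 v2 v3 v4 v5 v6
    · exact absurd (ℬ.coneTerm_eq_zero hT) hne
  · exact (ℬ.coneTerm_eq t0123 t0125 t0135 t0235 t1235 (h s) (h' s)).symm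

lemma sum_coneLabels {M : Type*} [AddCommMonoid M] (g : ∀ (e04 e14 e24 e34 e45 : Fin ℬ.n),
    ℬ.Face e01 e14 e04 → ℬ.Face e02 e24 e04 → ℬ.Face e03 e34 e04 → ℬ.Face e04 e45 e05 →
    ℬ.Face e12 e24 e14 → ℬ.Face e13 e34 e14 → ℬ.Face e14 e45 e15 → ℬ.Face e23 e34 e24 →
    ℬ.Face e24 e45 e25 → ℬ.Face e34 e45 e35 → M) :
    ∑ t : ℬ.ConeLabels e01 e02 e03 e05 e12 e13 e15 e23 e25 e35, g t.1 t.2.1 t.2.2.1 t.2.2.2.1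
      t.2.2.2.2.1 t.2.2.2.2.2.1 t.2.2.2.2.2.2.1 t.2.2.2.2.2.2.2.1 t.2.2.2.2.2.2.2.2.1
      t.2.2.2.2.2.2.2.2.2.1 t.2.2.2.2.2.2.2.2.2.2.1 t.2.2.2.2.2.2.2.2.2.2.2.1
      t.2.2.2.2.2.2.2.2.2.2.2.2.1 t.2.2.2.2.2.2.2.2.2.2.2.2.2.1 t.2.2.2.2.2.2.2.2.2.2.2.2.2.2 =
    ∑ e04, ∑ e14, ∑ e24, ∑ e34, ∑ e45, ∑ f014, ∑ f024, ∑ f034, ∑ f045, ∑ f124, ∑ f134, ∑ f145,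
      ∑ f234, ∑ f245, ∑ f345,
        g e04 e14 e24 e34 e45 f014 f024 f034 f045 f124 f134 f145 f234 f245 f345 := by
  iterate 5
    rw [Fintype.sum_sigma]
    refine Finset.sum_congr rfl fun _ _ => ?_
  -- Ten face labels form nine nested products; the ninth is split by the final rewrite.
  iterate 8
    rw [Fintype.sum_prod_type]
    refine Finset.sum_congr rfl fun _ _ => ?_
  rw [Fintype.sum_prod_type]

end SimpleBases

end Spherical

end
-- The `1 ⇌ 5` move
theorem lemma5p4
    {F : Type*} [Field F] [CharZero F]
    {C : Type u} [Bicategory.{w, v} C] [Bicategory.Strict C]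
    [SemiStrictMonoidal C] [DualStructure C] [HasDuals C] [Pivotal C] [Consistent C]
    [IsSpherical C]
    [∀ A B : C, Preadditive (A ⟶ B)] [∀ A B : C, Linear F (A ⟶ B)]
    [VectLinear F C] [NonDegenerate F C]
    (ℬ : SimpleBases F C)
    (e01 e02 e03 e05 e12 e13 e15 e23 e25 e35 : Fin ℬ.n)
    (f012 : ℬ.Face e01 e12 e02) (f013 : ℬ.Face e01 e13 e03)
    (f015 : ℬ.Face e01 e15 e05) (f023 : ℬ.Face e02 e23 e03)
    (f025 : ℬ.Face e02 e25 e05) (f035 : ℬ.Face e03 e35 e05)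
    (f123 : ℬ.Face e12 e23 e13) (f125 : ℬ.Face e12 e25 e15)
    (f135 : ℬ.Face e13 e35 e15) (f235 : ℬ.Face e23 e35 e25) :
    Zpos F (ℬ.face f012) (ℬ.face f013) (ℬ.face f015) (ℬ.face f023) (ℬ.face f025) (ℬ.face f035)
        (ℬ.face f123) (ℬ.face f125) (ℬ.face f135) (ℬ.face f235) =
      (dimension F C : F)⁻¹ •
        ∑ e04 : Fin ℬ.n, ∑ e14 : Fin ℬ.n, ∑ e24 : Fin ℬ.n, ∑ e34 : Fin ℬ.n, ∑ e45 : Fin ℬ.n,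
        ∑ f014 : ℬ.Face e01 e14 e04, ∑ f024 : ℬ.Face e02 e24 e04,
        ∑ f034 : ℬ.Face e03 e34 e04, ∑ f045 : ℬ.Face e04 e45 e05,
        ∑ f124 : ℬ.Face e12 e24 e14, ∑ f134 : ℬ.Face e13 e34 e14,
        ∑ f145 : ℬ.Face e14 e45 e15, ∑ f234 : ℬ.Face e23 e34 e24,
        ∑ f245 : ℬ.Face e24 e45 e25, ∑ f345 : ℬ.Face e34 e45 e35,
          ((dimObj F (ℬ.obj e04))⁻¹ * (dimObj F (ℬ.obj e14))⁻¹ * (dimObj F (ℬ.obj e24))⁻¹ *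
            (dimObj F (ℬ.obj e34))⁻¹ * (dimObj F (ℬ.obj e45))⁻¹ *
            (dimMor F (ℬ.face f014) * dimMor F (ℬ.face f024) * dimMor F (ℬ.face f034) *
             dimMor F (ℬ.face f045) * dimMor F (ℬ.face f124) * dimMor F (ℬ.face f134) *
             dimMor F (ℬ.face f145) * dimMor F (ℬ.face f234) * dimMor F (ℬ.face f245) *
             dimMor F (ℬ.face f345))) •
          partialTrace (composite F
            (ℬ.face f012) (ℬ.face f013) (ℬ.face f014) (ℬ.face f015) (ℬ.face f023) (ℬ.face f024)
            (ℬ.face f025) (ℬ.face f034) (ℬ.face f035) (ℬ.face f045) (ℬ.face f123) (ℬ.face f124)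
            (ℬ.face f125) (ℬ.face f134) (ℬ.face f135) (ℬ.face f145) (ℬ.face f234) (ℬ.face f235)
            (ℬ.face f245) (ℬ.face f345)) := by
  have hsum := ℬ.sum_coneSummand (f012 := f012) (f013 := f013) (f015 := f015) (f023 := f023)
    (f025 := f025) (f035 := f035) (f123 := f123) (f125 := f125) (f135 := f135) (f235 := f235)
  -- If one of the five tetrahedra of `(01235)` is not admissible, the common source or target of
  -- both sides is zero.
  by_cases t0123 : Tet (ℬ.face f012) (ℬ.face f013) (ℬ.face f023) (ℬ.face f123)
  swap
  · have := ℬ.subsingleton_twoH t0123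
    have := subsingleton_tensor_right F
      (twoH (ℬ.face f013) (ℬ.face f015) (ℬ.face f035) (ℬ.face f135))
      (twoH (ℬ.face f012) (ℬ.face f013) (ℬ.face f023) (ℬ.face f123))
    exact LinearMap.ext fun x => (subsingleton_tensor_right F _ _).elim _ _
  by_cases t0125 : Tet (ℬ.face f012) (ℬ.face f015) (ℬ.face f025) (ℬ.face f125)
  swap
  · have := ℬ.subsingleton_twoH t0125
    refine LinearMap.ext fun x => ?_
    rw [(subsingleton_tensor_right F _ _).elim x 0, map_zero, map_zero]
  by_cases t0135 : Tet (ℬ.face f013) (ℬ.face f015) (ℬ.face f035) (ℬ.face f135)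
  swap
  · have := ℬ.subsingleton_twoH t0135
    have := subsingleton_tensor_left F
      (twoH (ℬ.face f013) (ℬ.face f015) (ℬ.face f035) (ℬ.face f135))
      (twoH (ℬ.face f012) (ℬ.face f013) (ℬ.face f023) (ℬ.face f123))
    exact LinearMap.ext fun x => (subsingleton_tensor_right F _ _).elim _ _
  by_cases t0235 : Tet (ℬ.face f023) (ℬ.face f025) (ℬ.face f035) (ℬ.face f235)
  swap
  · have := ℬ.subsingleton_twoH t0235
    refine LinearMap.ext fun x => ?_
    rw [(subsingleton_tensor_left F _ _).elim x 0, map_zero, map_zero]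
  by_cases t1235 : Tet (ℬ.face f123) (ℬ.face f125) (ℬ.face f135) (ℬ.face f235)
  swap
  · have := ℬ.subsingleton_twoH t1235
    exact LinearMap.ext fun x => (subsingleton_tensor_left F _ _).elim _ _
  specialize hsum t0123 t0125 t0135 t0235 t1235
  -- The label `e01` shows that `ℰ` is not empty; characteristic zero then makes `K` invertible.
  have hn : (ℬ.n : F) ≠ 0 := Nat.cast_ne_zero.2 (Fin.pos e01).ne'
  rw [ℬ.dimension_eq, eq_inv_smul_iff₀ hn, ← hsum]
  exact ℬ.sum_coneLabels
    (ℬ.coneTerm f012 f013 f015 f023 f025 f035 f123 f125 f135 f235)
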